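/- **Setting.** Let $r\ge 1$, $r'\ge 0$; let $A\in\mathbb R^{r\times r}$, $C\in\mathbb R^{r'\times r}$, and let $R\in\mathbb R^{r\times r}$, $\Sigma\in\mathbb R^{r'\times r'}$ be symmetric positive definite. Write $M'$ for the transpose, $\|\cdot\|_2$ for the Euclidean and the spectral norm, $\le$ for the Loewner order, $\mathbb S_r^+$ for the cone of symmetric positive semi-definite $r\times r$ matrices, and $S:=C'\Sigma^{-1}C$. Assume that $(A,C)$ is observable, i.e. the matrix with block rows $C,CA,\dots,CA^{r-1}$ has rank $r$ (controllability of $(A,R^{1/2})$ is automatic). Put $$\mathcal C_t:=\int_0^t e^{Au}Re^{A'u}\,du,\qquad \mathcal O_t(\mathcal C):=\mathcal C_t^{-1}\Big[\int_0^t e^{(t-u)A}\,\mathcal C_u S\,\mathcal C_u\,e^{(t-u)A'}du\Big]\mathcal C_t^{-1},$$ and let $v>0$, $\varpi^c_->0$ and $\varpi^o_+(\mathcal C)$ be such that $\varpi^c_-\,\mathrm{Id}\le \mathcal C_v$ and $\mathcal O_v(\mathcal C)\le\varpi^o_+(\mathcal C)\,\mathrm{Id}$. **Riccati flows.** Let $\mathrm{Ricc}(Q)=AQ+QA'-QSQ+R$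 and, for continuous $\pi:\mathbb S_r^+\to\mathbb S_r^+$, $$\mathrm{Ricc}^\pi(Q)=[A-\pi(Q)S]Q+Q[A-\pi(Q)S]'+R+\pi(Q)S\pi(Q),\qquad \Gamma_\pi:=\mathrm{Ricc}^\pi-\mathrm{Ricc}.$$ Let $\Pi$ be a set of continuous maps $\mathbb S_r^+\to\mathbb S_r^+$ such that for every $\pi\in\Pi$ the equation $\partial_tP=\mathrm{Ricc}^\pi(P)$ has, from every initial matrix in $\mathbb S_r^+$, exactly one $\mathbb S_r^+$-valued solution on $[0,\infty)$. For $s\le t$, $\phi_{s,t}(Q)$ and $\phi^\pi_{s,t}(Q)$ denote the values at time $t$ of the solutions of $\partial_tP=\mathrm{Ricc}(P)$ and $\partial_tP=\mathrm{Ricc}^\pi(P)$ that are equal to $Q$ at time $s$. For $\delta>0$ let $B(\delta)=\{\pi\in\Pi:\ \sup_{Q\in\mathbb S_r^+}\|\pi(Q)-Q\|_2\le\delta\}$. **Hypotheses.** $(H)_0$: for each $\pi\in\Pi$ there are given symmetric matrices $B_0,B_1,B_2$ (depending on $\pi$) with $B_2\le S$, and a symmetric-matrix-valued $\mathcal R$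 with $\varpi:=\sup_{Q\in\mathbb S_r^+}\|\mathcal R(Q)\|_2<\infty$, such that for all $Q\in\mathbb S_r^+$ $$\Gamma_\pi(Q)=B_0+B_1Q+QB_1'+QB_2Q+\mathcal R(Q).$$ $(H)_2$: with $A_\pi:=A+B_1$, $R_\pi:=R+B_0+\varpi\,\mathrm{Id}$, $S_\pi:=S-B_2$, for all $\epsilon\in(0,1]$ and $\alpha\in(0,1)$ there is $\delta>0$ such that for all $\pi\in B(\delta)$ $$\alpha S\le S_\pi\le\alpha^{-1}S,\qquad \alpha R\le R_\pi\le\alpha^{-1}R,\qquad \|A-A_\pi\|_2\le\epsilon .$$ **Processes.** On a probability space let $W,V$ be independent standard Brownian motions of dimensions $r,r'$, let $X_0$ be a Gaussian vector independent of $(W,V)$, and let $$dX_t=AX_t\,dt+R^{1/2}dW_t,\qquad dY_t=CX_t\,dt+\Sigma^{1/2}dV_t,\quad Y_0=0,\qquad \mathcal F_{s,t}=\sigma(Y_u,\ s\le u\le t).$$ For $(x,Q)\in\mathbb R^r\times\mathbb S_r^+$ and $s\ge 0$, let $\psi_{s,t}(x,Q)$ and $\psi^\pi_{s,t}(x,Q)$,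 $t\ge s$, be the filters started at $\psi_{s,s}=\psi^\pi_{s,s}=x$ that solve $$d\psi_{s,t}=A\psi_{s,t}dt+\phi_{s,t}(Q)C'\Sigma^{-1}(dY_t-C\psi_{s,t}dt),\qquad d\psi^\pi_{s,t}=A\psi^\pi_{s,t}dt+\pi(\phi^\pi_{s,t}(Q))C'\Sigma^{-1}(dY_t-C\psi^\pi_{s,t}dt).$$ Let $\overline W,\overline V$ be standard Brownian motions of dimensions $r,r'$, and let $\overline\psi{}^\pi_{s,t}=\overline\psi{}^\pi_{s,t}(x,Q)$, $t\ge s$, be a nonlinear Kalman–Bucy diffusion, i.e. a continuous process whose initial state $\overline\psi{}^\pi_{s,s}$ is Gaussian with mean $x$ and covariance $Q$, where $\overline\psi{}^\pi_{s,s},\overline W,\overline V$ are mutually independent and jointly independent of $(X,Y)$, and such that $$d\overline\psi{}^\pi_{s,t}=A\overline\psi{}^\pi_{s,t}dt+R^{1/2}d\overline W_t+\pi(\mathcal P_{\eta^\pi_{s,t}})C'\Sigma^{-1}\big[dY_t-(C\overline\psi{}^\pi_{s,t}dt+\Sigma^{1/2}d\overline V_t)\big],\qquad \eta^\pi_{s,t}(x,Q):=\mathrm{Law}\big(\overline\psi{}^\pi_{s,t}\mid\mathcal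 F_{s,t}\big),$$ where $\mathcal P_\eta$ is the covariance matrix of $\eta$ and $t\mapsto\mathcal P_{\eta^\pi_{s,t}}$ is taken in a version with continuous paths. Let $\overline\psi_{s,t}(x,Q)$ and $\eta_{s,t}(x,Q)$ be the objects obtained with $\pi=\mathrm{id}$ (and the same $\overline W,\overline V$). **Theorem.** Assume $(H)_0$ and $(H)_2$. Then there is $\delta>0$ such that for all $\pi\in B(\delta)$, all $s\ge 0$ and $t\ge s+v$, all $(x,Q)\in\mathbb R^r\times\mathbb S_r^+$, and all processes as above, almost surely $$\mathrm{Ent}\big(\eta^\pi_{s,t}(x,Q)\,\big|\,\eta_{s,t}(x,Q)\big)\le\frac12\Big(\varpi^o_+(\mathcal C)+\frac1{\varpi^c_-}\Big)\Big[\|\psi^\pi_{s,t}(x,Q)-\psi_{s,t}(x,Q)\|_2^2+\frac52\sqrt r\,\|\phi_{s,t}(Q)-\phi^\pi_{s,t}(Q)\|_2\Big],$$ where $\mathrm{Ent}(\nu_1|\nu_2)=\int\log\frac{d\nu_1}{d\nu_2}\,d\nu_1$ if $\nu_1\ll\nu_2$, and $+\infty$ otherwise. -/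

import Mathlib

open MeasureTheory ProbabilityTheory Filter Topology
open scoped NNReal ENNReal Matrix MatrixOrder Matrix.Norms.L2Operator

namespace KalmanBucy

/-- Euclidean space of dimension `n`. -/
abbrev Vec (n : ℕ) : Type := EuclideanSpace ℝ (Fin n)

/-- Real `m × n` matrices. The norm in force on them is the spectral norm, and `≤` on square
matrices is the Loewner order. -/
abbrev Mat (m n : ℕ) : Type := Matrix (Fin m) (Fin n) ℝ

/-- The cone of real symmetric positive semi-definite `r × r` matrices. -/
abbrev PSD (r : ℕ) : Type := {Q : Mat r r // Q.PosSemidef}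

/-- The action of a matrix on a Euclidean vector. -/
noncomputable def act {m n : ℕ} (M : Mat m n) (x : Vec n) : Vec m := Matrix.toEuclideanLin M x

/-! ### Algebraic data of the filtering problem -/

/-- `(A, C)` is observable: the matrix with block rows `C, C A, …, C A ^ (r - 1)` has rank `r`. -/
def Observable {r r' : ℕ} (A : Mat r r) (C : Mat r' r) : Prop :=
  (Matrix.of fun (p : Fin r × Fin r') (j : Fin r) => (C * A ^ (p.1 : ℕ)) p.2 j).rank = r

/-- `S = C' Σ⁻¹ C`. -/
noncomputable def obsS {r r' : ℕ} (C : Mat r' r) (Sig : Mat r' r') : Mat r r := Cᵀ * Sig⁻¹ * C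

/-- The controllability Gramian `∫₀ᵗ exp (A u) R exp (A' u) du`. -/
noncomputable def gramC {r : ℕ} (A R : Mat r r) (t : ℝ) : Mat r r :=
  ∫ u in (0 : ℝ)..t, NormedSpace.exp (u • A) * R * NormedSpace.exp (u • Aᵀ)

/-- The Gramian `𝒪_t(𝒞) =
𝒞_t⁻¹ [∫₀ᵗ exp ((t - u) A) 𝒞_u S 𝒞_u exp ((t - u) A') du] 𝒞_t⁻¹`. -/
noncomputable def gramOC {r : ℕ} (A R S : Mat r r) (t : ℝ) : Mat r r :=
  (gramC A R t)⁻¹ *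
    (∫ u in (0 : ℝ)..t, NormedSpace.exp ((t - u) • A) * gramC A R u * S * gramC A R u *
      NormedSpace.exp ((t - u) • Aᵀ)) *
    (gramC A R t)⁻¹

/-! ### Riccati equations and their flows -/

/-- The nominal Riccati drift. -/
def ricc {r : ℕ} (A R S : Mat r r) (Q : PSD r) : Mat r r :=
  A * Q.1 + Q.1 * Aᵀ - Q.1 * S * Q.1 + R

/-- The Riccati drift perturbed by a mapping `π` of the cone into itself. -/
def riccPert {r : ℕ} (A R S : Mat r r) (π : C(PSD r, PSD r)) (Q : PSD r) : Mat r r :=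
  (A - (π Q).1 * S) * Q.1 + Q.1 * (A - (π Q).1 * S)ᵀ + R + (π Q).1 * S * (π Q).1

/-- `P : [0, ∞) → PSD r` solves `∂ₜ P = F (P)`, `P 0 = Q`. -/
def IsSolution {r : ℕ} (F : PSD r → Mat r r) (Q : PSD r) (P : ℝ → PSD r) : Prop :=
  P 0 = Q ∧ ∀ t : ℝ, 0 ≤ t →
    HasDerivWithinAt (fun u => (P u).1) (F (P t)) (Set.Ici 0) t

/-- From every initial matrix in the cone the equation `∂ₜ P = F (P)` has exactly one solution
on `[0, ∞)`. -/
def WellPosed {r : ℕ} (F : PSD r → Mat r r) : Prop :=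
  ∀ Q : PSD r, (∃ P, IsSolution F Q P) ∧
    ∀ P₁ P₂, IsSolution F Q P₁ → IsSolution F Q P₂ → ∀ t : ℝ, 0 ≤ t → P₁ t = P₂ t

open Classical in
/-- The semigroup `Q ↦ φ_{s,t}(Q)` of the time-homogeneous equation `∂ₜ P = F (P)`. -/
noncomputable def flow {r : ℕ} (F : PSD r → Mat r r) (s t : ℝ) (Q : PSD r) : PSD r :=
  if h : ∃ P, IsSolution F Q P then h.choose (t - s) else Q

/-! ### The hypotheses on the family of perturbations -/

/-- The perturbations in `Pert` at uniform distance at most `δ` from the identity. -/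
def nearId {r : ℕ} (Pert : Set C(PSD r, PSD r)) (δ : ℝ) : Set C(PSD r, PSD r) :=
  {π | π ∈ Pert ∧ ∀ Q : PSD r, ‖(π Q).1 - Q.1‖ ≤ δ}

/-- The perturbation `Γ_π` of the drift: `Ricc^π = Ricc + Γ_π`. -/
def driftPert {r : ℕ} (A R S : Mat r r) (π : C(PSD r, PSD r)) (Q : PSD r) : Mat r r :=
  riccPert A R S π Q - ricc A R S Q

/-- A quadratic decomposition of each `Γ_π`, `π ∈ Pert`, with a bounded remainder. The matrices and
the remainder may depend on `π`. -/
structure QuadraticPert {r : ℕ} (A R S : Mat r r) (Pert : Set C(PSD r, PSD r))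
    (B₀ B₁ B₂ : C(PSD r, PSD r) → Mat r r) (Rem : C(PSD r, PSD r) → PSD r → Mat r r) : Prop where
  symm₀ : ∀ π ∈ Pert, (B₀ π).IsSymm
  symm₁ : ∀ π ∈ Pert, (B₁ π).IsSymm
  symm₂ : ∀ π ∈ Pert, (B₂ π).IsSymm
  le_S : ∀ π ∈ Pert, B₂ π ≤ S
  symmRem : ∀ π ∈ Pert, ∀ Q, (Rem π Q).IsSymm
  bddRem : ∀ π ∈ Pert, BddAbove (Set.range fun Q => ‖Rem π Q‖)
  decomp : ∀ π ∈ Pert, ∀ Q : PSD r, driftPert A R S π Q =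
    B₀ π + B₁ π * Q.1 + Q.1 * (B₁ π)ᵀ + Q.1 * B₂ π * Q.1 + Rem π Q

/-- `ϖ = sup_Q ‖ℛ(Q)‖`. -/
noncomputable def remBound {r : ℕ} (Rem : PSD r → Mat r r) : ℝ := ⨆ Q : PSD r, ‖Rem Q‖

/-- Continuity at the identity of the matrices
`A_π = A + B₁`, `R_π = R + B₀ + ϖ Id`, `S_π = S - B₂`. -/
def ContinuousAtId {r : ℕ} (A R S : Mat r r) (Pert : Set C(PSD r, PSD r))
    (B₀ B₁ B₂ : C(PSD r, PSD r) → Mat r r) (Rem : C(PSD r, PSD r) → PSD r → Mat r r) : Prop :=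
  ∀ ε ∈ Set.Ioc (0 : ℝ) 1, ∀ α ∈ Set.Ioo (0 : ℝ) 1, ∃ δ : ℝ, 0 < δ ∧ ∀ π ∈ nearId Pert δ,
    α • S ≤ S - B₂ π ∧ S - B₂ π ≤ α⁻¹ • S ∧
    α • R ≤ R + B₀ π + remBound (Rem π) • (1 : Mat r r) ∧
    R + B₀ π + remBound (Rem π) • (1 : Mat r r) ≤ α⁻¹ • R ∧
    ‖A - (A + B₁ π)‖ ≤ ε

/-! ### Stochastic processes -/

section Processes

variable {Ω : Type*} [MeasurableSpace Ω]

/-- The path on `[0, ∞)` of a process. -/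
def path {n : ℕ} (Z : ℝ → Ω → Vec n) (ω : Ω) : ℝ≥0 → Vec n := fun t => Z t ω

/-- `W` is a standard `n`-dimensional Brownian motion on `[0, ∞)`. -/
structure IsBrownian {n : ℕ} (W : ℝ → Ω → Vec n) (μ : Measure Ω) : Prop where
  measurable : ∀ t : ℝ, 0 ≤ t → Measurable (W t)
  coord : ∀ i : Fin n, IsBrownianReal (fun (t : ℝ≥0) ω => W t ω i) μ
  indep : iIndepFun (fun (i : Fin n) ω (t : ℝ≥0) => W t ω i) μ

/-- The linear-Gaussian signal `X` and observation `Y`, driven by the Brownian motions `W`, `V`: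
`dX = A X dt + R^{1/2} dW`, `dY = C X dt + Σ^{1/2} dV`, `Y₀ = 0`. -/
structure IsSignalObservation {r r' : ℕ} (A R : Mat r r) (C : Mat r' r) (Sig : Mat r' r')
    (μ : Measure Ω) (W : ℝ → Ω → Vec r) (V : ℝ → Ω → Vec r')
    (X : ℝ → Ω → Vec r) (Y : ℝ → Ω → Vec r') : Prop where
  brownianW : IsBrownian W μ
  brownianV : IsBrownian V μ
  measurableX : ∀ t : ℝ, 0 ≤ t → Measurable (X t)
  measurableY : ∀ t : ℝ, 0 ≤ t → Measurable (Y t)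
  gaussian : HasGaussianLaw (X 0) μ
  indepWV : IndepFun (path W) (path V) μ
  indepInit : IndepFun (X 0) (fun ω => (path W ω, path V ω)) μ
  contX : ∀ᵐ ω ∂μ, ContinuousOn (fun u => X u ω) (Set.Ici 0)
  signal : ∀ᵐ ω ∂μ, ∀ t : ℝ, 0 ≤ t →
    X t ω = X 0 ω + (∫ u in (0 : ℝ)..t, act A (X u ω)) + act (CFC.sqrt R) (W t ω)
  observation : ∀ᵐ ω ∂μ, ∀ t : ℝ, 0 ≤ t →
    Y t ω = (∫ u in (0 : ℝ)..t, act C (X u ω)) + act (CFC.sqrt Sig) (V t ω)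

/-- The observation path `(Y_u)_{s ≤ u ≤ t}`; it generates `𝓕_{s,t}`. -/
def obsPath {n : ℕ} (Y : ℝ → Ω → Vec n) (s t : ℝ) (ω : Ω) : Set.Icc s t → Vec n := fun u => Y u ω

/-- The (regular) conditional law of `Z_t` given `𝓕_{s,t} = σ(Y_u, s ≤ u ≤ t)`, a random
probability measure. -/
noncomputable def condLaw {r n : ℕ} (μ : Measure Ω) [IsFiniteMeasure μ] (Y : ℝ → Ω → Vec n)
    (s t : ℝ) (Z : ℝ → Ω → Vec r) (ω : Ω) : Measure (Vec r) :=
  condDistrib (Z t) (obsPath Y s t) μ (obsPath Y s t ω)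

/-- The covariance matrix of a measure on `ℝʳ`. -/
noncomputable def covMatrix {r : ℕ} (η : Measure (Vec r)) : Mat r r :=
  Matrix.of fun i j => covariance (fun x : Vec r => x i) (fun x : Vec r => x j) η

/-- The left-point Riemann sum of `∫_s^t G_u dZ_u` over `N` steps of equal length. -/
noncomputable def itoSum {m n : ℕ} (G : ℝ → Ω → Mat m n) (Z : ℝ → Ω → Vec n) (s t : ℝ) (N : ℕ)
    (ω : Ω) : Vec m :=
  ∑ k ∈ Finset.range N, act (G (s + k * ((t - s) / N)) ω)
    (Z (s + (k + 1) * ((t - s) / N)) ω - Z (s + k * ((t - s) / N)) ω)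

/-- `I = ∫_s^t G_u dZ_u` in the sense of Itô, for an adapted integrand `G` with continuous paths
and a continuous semimartingale `Z`: the integral is the limit in probability of the left-point
Riemann sums. -/
def IsItoIntegral {m n : ℕ} (μ : Measure Ω) (G : ℝ → Ω → Mat m n) (Z : ℝ → Ω → Vec n) (s t : ℝ)
    (I : Ω → Vec m) : Prop :=
  TendstoInMeasure μ (fun N => itoSum G Z s t N) atTop I

/-- `Z` is the Kalman-Bucy filter started from `x` at time `s`, with covariance path `K`:
`dZ_t = A Z_t dt + K_t C' Σ⁻¹ (dY_t - C Z_t dt)`. -/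
structure IsFilter {r r' : ℕ} (A : Mat r r) (C : Mat r' r) (Sig : Mat r' r') (μ : Measure Ω)
    (Y : ℝ → Ω → Vec r') (K : ℝ → PSD r) (s : ℝ) (x : Vec r) (Z : ℝ → Ω → Vec r) : Prop where
  measurable : ∀ t : ℝ, s ≤ t → Measurable (Z t)
  cont : ∀ᵐ ω ∂μ, ContinuousOn (fun u => Z u ω) (Set.Ici s)
  init : ∀ᵐ ω ∂μ, Z s ω = x
  sde : ∀ t : ℝ, s ≤ t → IsItoIntegral μ (fun u _ => (K u).1 * Cᵀ * Sig⁻¹)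
    (fun u ω => Y u ω - ∫ w in s..u, act C (Z w ω)) s t
    (fun ω => Z t ω - Z s ω - ∫ u in s..t, act A (Z u ω))

/-- `Z` is the nonlinear (McKean-Vlasov) Kalman-Bucy diffusion perturbed by `π`, started at time
`s` from the Gaussian law with mean `x` and covariance `Q`:
`dZ_t = A Z_t dt + R^{1/2} dW̄_t + π(𝒫_{η_t}) C' Σ⁻¹ [dY_t - (C Z_t dt + Σ^{1/2} dV̄_t)]`,
where `𝒫_{η_t}` is the covariance matrix of `η_t = Law(Z_t | 𝓕_{s,t})`. The field `sde` asks for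
a version `P` of `t ↦ 𝒫_{η_t}` with continuous paths, a priori random. -/
structure IsDiffusion {r r' : ℕ} (A R : Mat r r) (C : Mat r' r) (Sig : Mat r' r') (μ : Measure Ω)
    [IsFiniteMeasure μ] (X : ℝ → Ω → Vec r) (Y : ℝ → Ω → Vec r') (Wb : ℝ → Ω → Vec r)
    (Vb : ℝ → Ω → Vec r') (π : C(PSD r, PSD r)) (s : ℝ) (x : Vec r) (Q : PSD r)
    (Z : ℝ → Ω → Vec r) : Prop where
  brownianW : IsBrownian Wb μ
  brownianV : IsBrownian Vb μ
  measurable : ∀ t : ℝ, s ≤ t → Measurable (Z t)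
  cont : ∀ᵐ ω ∂μ, ContinuousOn (fun u => Z u ω) (Set.Ici s)
  init : HasLaw (Z s) (multivariateGaussian x Q.1) μ
  indepWV : IndepFun (path Wb) (path Vb) μ
  indepInit : IndepFun (Z s) (fun ω => (path Wb ω, path Vb ω)) μ
  indepObs : IndepFun (fun ω => (path X ω, path Y ω))
    (fun ω => (Z s ω, path Wb ω, path Vb ω)) μ
  sde : ∃ P : ℝ → Ω → PSD r,
    (∀ᵐ ω ∂μ, ContinuousOn (fun u => P u ω) (Set.Ici s)) ∧
    (∀ t : ℝ, s ≤ t → ∀ᵐ ω ∂μ, (P t ω).1 = covMatrix (condLaw μ Y s t Z ω)) ∧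
    ∀ t : ℝ, s ≤ t → IsItoIntegral μ (fun u ω => (π (P u ω)).1 * Cᵀ * Sig⁻¹)
      (fun u ω => Y u ω - ((∫ w in s..u, act C (Z w ω)) + act (CFC.sqrt Sig) (Vb u ω))) s t
      (fun ω => Z t ω - Z s ω - (∫ u in s..t, act A (Z u ω)) -
        act (CFC.sqrt R) (Wb t ω - Wb s ω))

end Processes

end KalmanBucy

/-!
Both conditional laws are Gaussian, with the filters as means and the Riccati flows as covariances,
so that the bound reduces to the relative entropy of two Gaussian measures whose covariances are
close.

**Conditional laws.** Suppose first that the gain `K` of the diffusion is a measurable function of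
the observation path. Itô integrals are limits in probability of Riemann sums, so the diffusion is
the limit of its Euler scheme. Given the observations the scheme is an affine image of independent
Gaussian increments, and its conditional characteristic function is explicit
(`condExp_exp_eulerPath`); the Euler schemes for the mean and the covariance converge to the filter
and to the solution of the Lyapunov equation with gain `K`, path by path
(`condExp_exp_diffusion`, `IsGainDiffusion.condDistrib_eq`). The gain of the nonlinear diffusion is
`π` of its own conditional covariance, hence a function of the observations. The covariance of the
Gaussian law just found is therefore a fixed point: it solves `∂ₜ P = Ricc^π (P)`
(`IsDiffusion.isSolution`). By uniqueness it is the deterministic flow (`IsDiffusion.condLaw_eq`).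
The existence of the nominal Riccati flow comes for free from the nominal diffusion.

**Comparison of the flows.** Since `Γ_π (Q) = (π (Q) - Q) S (π (Q) - Q) ≥ 0`, the perturbed flow
dominates the nominal one. If `π` is uniformly so close to the identity that `Γ_π ≤ κ R`, then
`(1 + κ) φ` is a supersolution of the perturbed equation, so that `φ ≤ φ^π ≤ (1 + κ) φ` for all
times (`IsSolution.le_pert`, `IsSolution.pert_le`). Both follow from a comparison principle for
Riccati equations, proved by duality with the adjoint linear equation (`riccati_comparison`).

**Lower bound.** The inverse of the flow at the time `v` is the value of a linear-quadratic control
problem: `⟨x, φ_v⁻¹ x⟩` is at most the cost of steering the linear system from `0` to `x`. The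
control of minimal energy costs `⟨x, (𝒪_v(𝒞) + 𝒞_v⁻¹) x⟩`, and the flow at a time `t ≥ v` is the
flow at the time `v` from another initial matrix. Whence `(ϖ + 1 / c)⁻¹ ‖y‖² ≤ ⟨y, φ_t y⟩`, where
`𝒪_v(𝒞) ≤ ϖ` and `c ≤ 𝒞_v` (`riccati_lower_bound`).

**Entropy.** With `κ = 1 / r`, a basis in which both covariances are diagonal reduces the
relative entropy to one-dimensional ones, where `x - log (1 + x) ≤ x² / 2` is enough
(`klDiv_multivariateGaussian_le`).
-/

namespace KalmanBucy

/-! ### Differential equations with globally Lipschitz right-hand side -/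

section LipschitzODE

variable {E : Type*} [NormedAddCommGroup E] [NormedSpace ℝ E]

lemma hasDerivWithinAt_Icc_glue {α β : ℝ → E} {f : ℝ → E → E} {a b c : ℝ} (hab : a ≤ b)
    (hbc : b ≤ c) (hα : ∀ t ∈ Set.Icc a b, HasDerivWithinAt α (f t (α t)) (Set.Icc a b) t)
    (hβ : ∀ t ∈ Set.Icc b c, HasDerivWithinAt β (f t (β t)) (Set.Icc b c) t) (hb : α b = β b) :
    ∀ t ∈ Set.Icc a c, HasDerivWithinAt (fun u => if u ≤ b then α u else β u)
      (f t (if t ≤ b then α t else β t)) (Set.Icc a c) t := by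
  intro t ht
  have hβ' : ∀ u ∈ Set.Icc b c, (if u ≤ b then α u else β u) = β u := by
    intro u hu
    split_ifs with h
    · rw [le_antisymm h hu.1, hb]
    · rfl
  rw [← Set.Icc_union_Icc_eq_Icc hab hbc]
  apply HasDerivWithinAt.union
  · by_cases h : t ≤ b
    · rw [if_pos h]
      exact (hα t ⟨ht.1, h⟩).congr (fun u hu => if_pos hu.2) (if_pos h)
    · exact HasFDerivWithinAt.of_notMem_closure (by
        rw [isClosed_Icc.closure_eq]
        exact fun h' => h h'.2)
  · by_cases h : b ≤ t
    · have h1 := hβ' t ⟨h, ht.2⟩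
      rw [h1]
      exact (hβ t ⟨h, ht.2⟩).congr hβ' h1
    · exact HasFDerivWithinAt.of_notMem_closure (by
        rw [isClosed_Icc.closure_eq]
        exact fun h' => h h'.1)

/-- A field that is defined on the whole space has solutions on every interval that is short
compared with the inverse of its Lipschitz constant. -/
lemma exists_solution_of_short [CompleteSpace E] {f : ℝ → E → E} {K : ℝ≥0} {a b : ℝ} (hab : a ≤ b)
    (hK : K * (b - a) ≤ 1 / 2)
    (hL : ∀ t ∈ Set.Icc a b, LipschitzWith K (f t))
    (hc : ∀ x, ContinuousOn (fun t => f t x) (Set.Icc a b)) (x₀ : E) :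
    ∃ α : ℝ → E, α a = x₀ ∧
      ∀ t ∈ Set.Icc a b, HasDerivWithinAt α (f t (α t)) (Set.Icc a b) t := by
  obtain ⟨c, hc0⟩ := isCompact_Icc.exists_bound_of_continuousOn (hc x₀)
  have hcn : 0 ≤ c := (norm_nonneg _).trans (hc0 a ⟨le_rfl, hab⟩)
  -- a ball of radius `2 (b - a) c` is wide enough: the field is at most `c + K ρ` on it
  set ρ : ℝ := 2 * (b - a) * c with hρ
  have hba : 0 ≤ b - a := by linarith
  have hρ0 : 0 ≤ ρ := by positivity
  have hPL : IsPicardLindelof f (tmin := a) (tmax := b) ⟨a, le_rfl, hab⟩ x₀ ρ.toNNReal 0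
      (c + K * ρ).toNNReal K := by
    refine ⟨fun t ht => (hL t ht).lipschitzOnWith, fun x _ => hc x, fun t ht x hx => ?_, ?_⟩
    · rw [Real.coe_toNNReal _ (by positivity)]
      rw [Metric.mem_closedBall, Real.coe_toNNReal _ hρ0] at hx
      have h1 : ‖f t x - f t x₀‖ ≤ K * ρ := by
        rw [← dist_eq_norm]
        exact ((hL t ht).dist_le_mul x x₀).trans (by gcongr)
      calc ‖f t x‖ = ‖f t x₀ + (f t x - f t x₀)‖ := by congr 1; abel
        _ ≤ _ := (norm_add_le _ _).trans (add_le_add (hc0 t ht) h1)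
    · rw [Real.coe_toNNReal _ (by positivity), Real.coe_toNNReal _ hρ0]
      simp only [sub_self, NNReal.coe_zero, sub_zero]
      rw [max_eq_left hba]
      nlinarith
  obtain ⟨α, h1, h2⟩ := hPL.exists_eq_forall_mem_Icc_hasDerivWithinAt₀
  exact ⟨α, h1, h2⟩

/-- Global existence on a compact interval: short-time solutions, whose time span depends only on
the Lipschitz constant, are glued. -/
theorem exists_solution_of_lipschitz [CompleteSpace E] {f : ℝ → E → E} {K : ℝ≥0} {a b : ℝ}
    (hab : a ≤ b) (hL : ∀ t ∈ Set.Icc a b, LipschitzWith K (f t))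
    (hc : ∀ x, ContinuousOn (fun t => f t x) (Set.Icc a b)) (x₀ : E) :
    ∃ α : ℝ → E, α a = x₀ ∧
      ∀ t ∈ Set.Icc a b, HasDerivWithinAt α (f t (α t)) (Set.Icc a b) t := by
  set θ : ℝ := 1 / (2 * (K + 1)) with hθ
  have hθ0 : 0 < θ := by positivity
  have hKθ : K * θ ≤ 1 / 2 := by
    rw [hθ, mul_one_div, div_le_div_iff₀ (by positivity) (by norm_num)]
    linarith
  have key : ∀ N : ℕ, ∀ w, a ≤ w → w ≤ b → w ≤ a + N * θ → ∃ α : ℝ → E, α a = x₀ ∧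
      ∀ t ∈ Set.Icc a w, HasDerivWithinAt α (f t (α t)) (Set.Icc a w) t := by
    intro N
    induction N with
    | zero =>
      intro w haw hwb hw
      have : w = a := by simp at hw; exact le_antisymm hw haw
      subst this
      exact exists_solution_of_short le_rfl (by simp)
        (fun t ht => hL t ⟨ht.1, ht.2.trans hwb⟩)
        (fun x => (hc x).mono (Set.Icc_subset_Icc_right hwb)) x₀
    | succ N ih =>
      intro w haw hwb hw
      push_cast at hw
      set u := max a (w - θ)
      have hu1 : a ≤ u := le_max_left _ _
      have hu2 : u ≤ w := max_le haw (by linarith)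
      have hu3 : u ≤ a + N * θ := max_le (by nlinarith [N.cast_nonneg (α := ℝ)]) (by linarith)
      have hu4 : w - u ≤ θ := by linarith [le_max_right a (w - θ)]
      obtain ⟨α, hα0, hα⟩ := ih u hu1 (hu2.trans hwb) hu3
      obtain ⟨β, hβ0, hβ⟩ := exists_solution_of_short (f := f) (K := K) hu2
        ((mul_le_mul_of_nonneg_left hu4 K.2).trans hKθ)
        (fun t ht => hL t ⟨hu1.trans ht.1, ht.2.trans hwb⟩)
        (fun x => (hc x).mono (Set.Icc_subset_Icc hu1 hwb)) (α u)
      refine ⟨_, ?_, hasDerivWithinAt_Icc_glue hu1 hu2 hα hβ hβ0.symm⟩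
      simp [hu1, hα0]
  obtain ⟨N, hN⟩ := exists_nat_ge ((b - a) / θ)
  rw [div_le_iff₀ hθ0] at hN
  exact key N b hab le_rfl (by linarith)

end LipschitzODE

/-! ### Riemann sums and the Euler scheme -/

section Euler

variable {E : Type*} [NormedAddCommGroup E] [NormedSpace ℝ E]

/-- Convergence of the sums `∑ⱼ ∫ F(τⱼ, w) dw`, the `j`-th integral being over `[τⱼ, τⱼ₊₁]`: only
the first argument is frozen at the grid points. -/
theorem tendsto_sum_integral_frozen {F : ℝ → ℝ → E}
    (hF : Continuous (Function.uncurry F)) {a b : ℝ} (hab : a ≤ b) :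
    Tendsto (fun m : ℕ => ∑ j ∈ Finset.range m,
      ∫ w in (a + j * ((b - a) / m))..(a + (j + 1) * ((b - a) / m)), F (a + j * ((b - a) / m)) w)
      atTop (𝓝 (∫ w in a..b, F w w)) := by
  have hdiag : Continuous fun w => F w w := hF.comp (continuous_id.prodMk continuous_id)
  have hfro : ∀ c, Continuous fun w => F c w := fun c =>
    hF.comp (continuous_const.prodMk continuous_id)
  rw [Metric.tendsto_atTop]
  intro ε hε
  have hba : 0 ≤ b - a := by linarith
  set ε' := ε / (2 * (b - a + 1)) with hε'
  have hε'0 : 0 < ε' := by positivity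
  have hUC := (isCompact_Icc.prod isCompact_Icc).uniformContinuousOn_of_continuous
    (hF.continuousOn (s := Set.Icc a b ×ˢ Set.Icc a b))
  obtain ⟨η, hη, hUC⟩ := Metric.uniformContinuousOn_iff.1 hUC ε' hε'0
  obtain ⟨M, hM⟩ := exists_nat_gt ((b - a) / η)
  refine ⟨M + 1, fun m hm => ?_⟩
  have hm0 : (0 : ℝ) < m := by exact_mod_cast (by omega : 0 < m)
  have hMm : (M : ℝ) ≤ m := by exact_mod_cast (by omega : M ≤ m)
  set δ := (b - a) / m with hδ
  have hδ0 : 0 ≤ δ := by positivity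
  have hmδ : m * δ = b - a := by rw [hδ]; field_simp
  have hδη : δ < η := by
    rw [hδ, div_lt_iff₀ hm0]
    rw [div_lt_iff₀ hη] at hM
    nlinarith
  have hsum : ∫ w in a..b, F w w = ∑ j ∈ Finset.range m,
      ∫ w in (a + j * δ)..(a + (j + 1) * δ), F w w := by
    have := intervalIntegral.sum_integral_adjacent_intervals (μ := volume) (f := fun w => F w w)
      (a := fun j : ℕ => a + j * δ) (n := m) (fun k _ => hdiag.intervalIntegrable _ _)
    push_cast at this
    rw [this, hmδ]
    simp
  rw [hsum, dist_eq_norm, ← Finset.sum_sub_distrib]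
  have hblock : ∀ j ∈ Finset.range m, ‖(∫ w in (a + j * δ)..(a + (j + 1) * δ), F (a + j * δ) w) -
      ∫ w in (a + j * δ)..(a + (j + 1) * δ), F w w‖ ≤ ε' * δ := by
    intro j hj
    have hjm : (j : ℝ) + 1 ≤ m := by exact_mod_cast Finset.mem_range.1 hj
    have hj0 : (0 : ℝ) ≤ j := j.cast_nonneg
    rw [← intervalIntegral.integral_sub ((hfro _).intervalIntegrable _ _)
      (hdiag.intervalIntegrable _ _)]
    have hlen : |a + (j + 1) * δ - (a + j * δ)| = δ := by
      rw [show a + (j + 1) * δ - (a + j * δ) = δ by ring, abs_of_nonneg hδ0]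
    conv_rhs => rw [← hlen]
    apply intervalIntegral.norm_integral_le_of_norm_le_const
    intro w hw
    rw [Set.uIoc_of_le (by nlinarith)] at hw
    have h1 : a + j * δ ∈ Set.Icc a b := ⟨by nlinarith, by nlinarith⟩
    have h2 : w ∈ Set.Icc a b := ⟨h1.1.trans hw.1.le, hw.2.trans (by nlinarith)⟩
    rw [← dist_eq_norm]
    refine (hUC (a + j * δ, w) ⟨h1, h2⟩ (w, w) ⟨h2, h2⟩ ?_).le
    rw [Prod.dist_eq, dist_self, max_lt_iff]
    refine ⟨?_, hη⟩
    rw [Real.dist_eq, abs_sub_comm, abs_of_nonneg (by linarith [hw.1])]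
    nlinarith [hw.2]
  calc _ ≤ ∑ j ∈ Finset.range m, ε' * δ := (norm_sum_le _ _).trans (Finset.sum_le_sum hblock)
    _ = ε' * (b - a) := by rw [Finset.sum_const, Finset.card_range, nsmul_eq_mul, ← hmδ]; ring
    _ < ε := by
      rw [hε', div_mul_eq_mul_div, div_lt_iff₀ (by positivity)]
      nlinarith

/-- Convergence of the Euler scheme for `z_τ = z_s + ∫_s^τ 𝓑_u z_u du + ξ_τ`, driven by the exact
increments of `ξ`. The one-step operators `S n k` may differ from `1 + h 𝓑` by `O(h²)`. -/
theorem tendsto_euler [CompleteSpace E] {B : ℝ → E →L[ℝ] E} (hB : Continuous B) {z : ℝ → E}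
    (hz : Continuous z) {s t : ℝ} (hst : s ≤ t) {S : ℕ → ℕ → E →L[ℝ] E} {D : ℝ} (hD : 0 ≤ D)
    (hS : ∀ n k, k < n → ‖S n k - (1 + ((t - s) / n) • B (s + k * ((t - s) / n)))‖ ≤
      D * ((t - s) / n) ^ 2)
    {x : ℕ → ℕ → E} (hx0 : ∀ n, x n 0 = z s)
    (hx : ∀ n k, k < n → x n (k + 1) = S n k (x n k) +
      (z (s + (k + 1) * ((t - s) / n)) - z (s + k * ((t - s) / n)) -
        ∫ u in (s + k * ((t - s) / n))..(s + (k + 1) * ((t - s) / n)), B u (z u))) :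
    Tendsto (fun n => x n n) atTop (𝓝 (z t)) := by
  have hts : 0 ≤ t - s := by linarith
  obtain ⟨K, hK⟩ := isCompact_Icc.exists_bound_of_continuousOn (hB.continuousOn (s := Set.Icc s t))
  obtain ⟨Z, hZ⟩ := isCompact_Icc.exists_bound_of_continuousOn (hz.continuousOn (s := Set.Icc s t))
  have hK0 : 0 ≤ K := (norm_nonneg _).trans (hK s ⟨le_rfl, hst⟩)
  have hZ0 : 0 ≤ Z := (norm_nonneg _).trans (hZ s ⟨le_rfl, hst⟩)
  have hBz : Continuous fun u => B u (z u) := hB.clm_apply hz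
  have hUC := isCompact_Icc.uniformContinuousOn_of_continuous
    (hBz.continuousOn (s := Set.Icc s t))
  rw [Metric.tendsto_atTop]
  intro ε hε
  set Λ := (t - s + 1) * Real.exp ((t - s) * (K + D)) with hΛ
  have hΛ0 : 0 < Λ := by positivity
  set ε' := ε / (2 * Λ) with hε'
  have hε'0 : 0 < ε' := by positivity
  obtain ⟨η, hη, hUC⟩ := Metric.uniformContinuousOn_iff.1 hUC (ε' / 2) (by positivity)
  -- the step must be below `η`, below `1`, and make `D h² Z` smaller than `h ε' / 2`
  set η' := min η (min 1 (ε' / (2 * (D * Z + 1)))) with hη'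
  have hη'0 : 0 < η' := by positivity
  obtain ⟨M, hM⟩ := exists_nat_gt ((t - s) / η')
  refine ⟨M + 1, fun n hn => ?_⟩
  have hn0 : (0 : ℝ) < n := by exact_mod_cast (by omega : 0 < n)
  have hMn : (M : ℝ) ≤ n := by exact_mod_cast (by omega : M ≤ n)
  have hSn := hS n
  have hxn := hx n
  set h := (t - s) / n with hh
  have hh0 : 0 ≤ h := by positivity
  have hnh : n * h = t - s := by rw [hh]; field_simp
  have hhη' : h < η' := by
    rw [hh, div_lt_iff₀ hn0]
    rw [div_lt_iff₀ hη'0] at hM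
    nlinarith
  have hhη : h < η := hhη'.trans_le (min_le_left _ _)
  have hh1 : h ≤ 1 := (hhη'.trans_le ((min_le_right _ _).trans (min_le_left _ _))).le
  have hhD : D * h * Z ≤ ε' / 2 := by
    have h1 : h ≤ ε' / (2 * (D * Z + 1)) :=
      (hhη'.trans_le ((min_le_right _ _).trans (min_le_right _ _))).le
    rw [le_div_iff₀ (by positivity)] at h1
    nlinarith [mul_nonneg hD hZ0]
  have hmem : ∀ k : ℕ, k ≤ n → s + k * h ∈ Set.Icc s t := by
    intro k hk
    have : (k : ℝ) ≤ n := by exact_mod_cast hk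
    exact ⟨by nlinarith [k.cast_nonneg (α := ℝ)], by nlinarith⟩
  -- the error after `k` steps, frozen after the last one so that the recursion holds for all `k`
  set e : ℕ → ℝ := fun k => if k ≤ n then ‖z (s + k * h) - x n k‖ else 0 with he
  have hrec : ∀ k ≥ 0, e (k + 1) ≤ (1 + (h * (K + D))) * e k + h * ε' := by
    intro k _
    by_cases hk : k + 1 ≤ n
    swap
    · have : 0 ≤ e k := by rw [he]; dsimp only; split_ifs <;> positivity
      rw [he]
      dsimp only at this ⊢
      rw [if_neg hk]
      positivity
    have hkn : k ≤ n := by omega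
    simp only [he, if_pos hk, if_pos hkn]
    push_cast
    have hτ := hmem k hkn
    have hτ' := hmem (k + 1) hk
    push_cast at hτ'
    have hle : s + k * h ≤ s + (k + 1) * h := by nlinarith
    rw [hxn k (by omega)]
    have hSk := hSn k (by omega)
    set S₀ := S n k
    set τ := s + k * h with hτdef
    set τ' := s + (k + 1) * h with hτ'def
    have hdecomp : z τ' - (S₀ (x n k) + (z τ' - z τ - ∫ u in τ..τ', B u (z u))) =
        S₀ (z τ - x n k) + ((∫ u in τ..τ', (B u (z u) - B τ (z τ))) -
          (S₀ - (1 + h • B τ)) (z τ)) := by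
      rw [intervalIntegral.integral_sub (hBz.intervalIntegrable _ _) (by simp),
        intervalIntegral.integral_const, show τ' - τ = h by rw [hτdef, hτ'def]; ring]
      simp only [map_sub, sub_apply, add_apply, one_apply_eq_self, smul_apply]
      abel
    rw [hdecomp]
    have h1 : ‖∫ u in τ..τ', (B u (z u) - B τ (z τ))‖ ≤ ε' / 2 * h := by
      have : |τ' - τ| = h := by
        rw [show τ' - τ = h by rw [hτdef, hτ'def]; ring, abs_of_nonneg hh0]
      rw [← this]
      apply intervalIntegral.norm_integral_le_of_norm_le_const
      intro u hu
      rw [Set.uIoc_of_le hle] at hu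
      rw [← dist_eq_norm]
      refine (hUC u ⟨hτ.1.trans hu.1.le, hu.2.trans hτ'.2⟩ τ hτ ?_).le
      rw [Real.dist_eq, abs_of_nonneg (by linarith [hu.1])]
      have : τ' - τ = h := by rw [hτdef, hτ'def]; ring
      linarith [hu.2]
    have h2 : ‖(S₀ - (1 + h • B τ)) (z τ)‖ ≤ ε' / 2 * h := by
      calc _ ≤ D * h ^ 2 * Z := (ContinuousLinearMap.le_opNorm _ _).trans
            (mul_le_mul hSk (hZ τ hτ) (norm_nonneg _) (by positivity))
        _ = D * h * Z * h := by ring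
        _ ≤ _ := by gcongr
    have h3 : ‖S₀‖ ≤ 1 + h * (K + D) := by
      have : S₀ = (S₀ - (1 + h • B τ)) + (1 + h • B τ) := by abel
      rw [this]
      refine (norm_add_le _ _).trans ?_
      have h4 : ‖(1 : E →L[ℝ] E) + h • B τ‖ ≤ 1 + h * K := by
        refine (norm_add_le _ _).trans (add_le_add ContinuousLinearMap.norm_id_le ?_)
        rw [norm_smul, Real.norm_of_nonneg hh0]
        exact mul_le_mul_of_nonneg_left (hK τ hτ) hh0
      have h5 : D * h ^ 2 ≤ h * D := by nlinarith [mul_nonneg hD hh0]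
      linarith
    calc _ ≤ ‖S₀ (z τ - x n k)‖ + (ε' / 2 * h + ε' / 2 * h) :=
          (norm_add_le _ _).trans (add_le_add le_rfl ((norm_sub_le _ _).trans (add_le_add h1 h2)))
      _ ≤ (1 + h * (K + D)) * ‖z τ - x n k‖ + (ε' / 2 * h + ε' / 2 * h) := by
          gcongr
          exact (S₀.le_opNorm _).trans (by gcongr)
      _ = _ := by ring
  have he0 : e 0 = 0 := by simp [he, hx0]
  have hG := discrete_gronwall (u := e) (b := fun _ => h * ε') (c := fun _ => h * (K + D))
    (n₀ := 0) he0.ge hrec (fun _ _ => by positivity) (fun _ _ => by positivity) (Nat.zero_le n)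
  simp only [he0, Finset.sum_const, Nat.card_Ico, tsub_zero, nsmul_eq_mul, zero_add] at hG
  simp only [he, le_refl, if_true] at hG
  rw [show (n : ℝ) * (h * ε') = (t - s) * ε' by rw [← hnh]; ring,
    show (n : ℝ) * (h * (K + D)) = (t - s) * (K + D) by rw [← hnh]; ring,
    show s + n * h = t by rw [hnh]; ring] at hG
  rw [dist_comm, dist_eq_norm]
  calc _ ≤ _ := hG
    _ ≤ Λ * ε' := by
      rw [hΛ]
      have := Real.exp_pos ((t - s) * (K + D))
      nlinarith [mul_pos hε'0 this]
    _ < ε := by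
      rw [hε', mul_div_assoc', div_lt_iff₀ (by positivity)]
      nlinarith

end Euler

/-! ### The action of matrices on Euclidean vectors -/

section Action

variable {l m n : ℕ}

/-- The action of matrices on vectors as a continuous bilinear map. -/
noncomputable def actL (m n : ℕ) : Mat m n →L[ℝ] Vec n →L[ℝ] Vec m :=
  LinearMap.toContinuousLinearMap
    ((LinearMap.toContinuousLinearMap : (Vec n →ₗ[ℝ] Vec m) ≃ₗ[ℝ] _).toLinearMap ∘ₗ
      (Matrix.toEuclideanLin (𝕜 := ℝ) (m := Fin m) (n := Fin n)).toLinearMap)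

lemma actL_apply (M : Mat m n) (x : Vec n) : actL m n M x = act M x := rfl

@[simp] lemma act_zero_left (x : Vec n) : act (0 : Mat m n) x = 0 := by simp [← actL_apply]
@[simp] lemma act_zero_right (M : Mat m n) : act M (0 : Vec n) = 0 := by simp [← actL_apply]
lemma act_add_left (M N : Mat m n) (x : Vec n) : act (M + N) x = act M x + act N x := by
  simp [← actL_apply]
lemma act_sub_left (M N : Mat m n) (x : Vec n) : act (M - N) x = act M x - act N x := by
  simp [← actL_apply]
lemma act_neg_left (M : Mat m n) (x : Vec n) : act (-M) x = -act M x := by simp [← actL_apply]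
lemma act_smul_left (c : ℝ) (M : Mat m n) (x : Vec n) : act (c • M) x = c • act M x := by
  simp [← actL_apply]
lemma act_add_right (M : Mat m n) (x y : Vec n) : act M (x + y) = act M x + act M y := by
  simp [← actL_apply]
lemma act_sub_right (M : Mat m n) (x y : Vec n) : act M (x - y) = act M x - act M y := by
  simp [← actL_apply]
lemma act_smul_right (c : ℝ) (M : Mat m n) (x : Vec n) : act M (c • x) = c • act M x := by
  simp [← actL_apply]
@[simp] lemma act_one (x : Vec n) : act (1 : Mat n n) x = x := by simp [act, Matrix.toLpLin_one]
lemma act_mul (M : Mat l m) (N : Mat m n) (x : Vec n) : act (M * N) x = act M (act N x) := by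
  simp [act, Matrix.toLpLin_apply, Matrix.mulVec_mulVec]

lemma norm_act_le (M : Mat m n) (x : Vec n) : ‖act M x‖ ≤ ‖M‖ * ‖x‖ := by
  have := Matrix.l2_opNorm_mulVec M x
  simpa [act, Matrix.toLpLin_apply] using this

lemma inner_act (M : Mat m n) (u : Vec m) (x : Vec n) :
    inner ℝ u (act M x) = inner ℝ (act Mᵀ u) x := by
  simp only [act, Matrix.toLpLin_apply, EuclideanSpace.inner_eq_star_dotProduct, star_trivial]
  rw [Matrix.mulVec_transpose, dotProduct_comm, Matrix.dotProduct_mulVec, dotProduct_comm]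

lemma inner_act_eq_dotProduct (M : Mat n n) (u : Vec n) :
    inner ℝ u (act M u) = u ⬝ᵥ M *ᵥ u := by
  simp only [act, Matrix.toLpLin_apply, EuclideanSpace.inner_eq_star_dotProduct, star_trivial]
  rw [dotProduct_comm]

lemma _root_.Continuous.act {X : Type*} [TopologicalSpace X] {M : X → Mat m n} {x : X → Vec n}
    (hM : Continuous M) (hx : Continuous x) : Continuous fun a => KalmanBucy.act (M a) (x a) :=
  ((actL m n).continuous.comp hM).clm_apply hx

lemma _root_.Filter.Tendsto.act {X : Type*} {f : Filter X} {M : X → Mat m n} {x : X → Vec n}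
    {M₀ : Mat m n} {x₀ : Vec n} (hM : Tendsto M f (𝓝 M₀)) (hx : Tendsto x f (𝓝 x₀)) :
    Tendsto (fun a => KalmanBucy.act (M a) (x a)) f (𝓝 (KalmanBucy.act M₀ x₀)) :=
  (isBoundedBilinearMap_apply.continuous.tendsto (actL m n M₀, x₀)).comp
    ((((actL m n).continuous.tendsto _).comp hM).prodMk_nhds hx)

end Action

/-! ### Euler schemes for linear equations and for their covariances -/

section EulerSchemes

variable {r r' : ℕ}

/-- The recursion `x_{k+1} = T_k x_k + (ξ_{k+1} - ξ_k)`. -/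
noncomputable def eulerPath (T : ℕ → Mat r r) (x₀ : Vec r) (ξ : ℕ → Vec r) : ℕ → Vec r
  | 0 => x₀
  | k + 1 => act (T k) (eulerPath T x₀ ξ k) + (ξ (k + 1) - ξ k)

/-- The recursion `P_{k+1} = T_k P_k T_k' + (θ_{k+1} - θ_k)`: the covariances of `eulerPath` when
`ξ` has independent increments of covariances `θ_{k+1} - θ_k`. -/
noncomputable def eulerCov (T : ℕ → Mat r r) (Q : Mat r r) (θ : ℕ → Mat r r) : ℕ → Mat r r
  | 0 => Q
  | k + 1 => T k * eulerCov T Q θ k * (T k)ᵀ + (θ (k + 1) - θ k)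

/-- The step matrices `1 + h B(s + k h)`. -/
noncomputable def eulerStep (B : ℝ → Mat r r) (s h : ℝ) (k : ℕ) : Mat r r :=
  1 + h • B (s + k * h)

lemma eulerPath_add (T : ℕ → Mat r r) (x y : Vec r) (ξ ζ : ℕ → Vec r) (k : ℕ) :
    eulerPath T (x + y) (fun k => ξ k + ζ k) k = eulerPath T x ξ k + eulerPath T y ζ k := by
  induction k with
  | zero => rfl
  | succ k ih =>
    simp only [eulerPath, ih, act_add_right]
    abel

lemma tendsto_eulerPath {ι : Type*} {f : Filter ι} (T : ℕ → Mat r r) (x₀ : Vec r)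
    {ξ : ι → ℕ → Vec r} {ξ₀ : ℕ → Vec r} {k : ℕ}
    (h : ∀ j ≤ k, Tendsto (fun i => ξ i j) f (𝓝 (ξ₀ j))) :
    Tendsto (fun i => eulerPath T x₀ (ξ i) k) f (𝓝 (eulerPath T x₀ ξ₀ k)) := by
  induction k with
  | zero => exact tendsto_const_nhds
  | succ k ih =>
    exact (tendsto_const_nhds.act (ih fun j hj => h j (by omega))).add
      ((h _ le_rfl).sub (h _ (by omega)))

lemma tendsto_eulerCov {ι : Type*} {f : Filter ι} (T : ℕ → Mat r r) (Q : Mat r r)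
    {θ : ι → ℕ → Mat r r} {θ₀ : ℕ → Mat r r} {k : ℕ}
    (h : ∀ j ≤ k, Tendsto (fun i => θ i j) f (𝓝 (θ₀ j))) :
    Tendsto (fun i => eulerCov T Q (θ i) k) f (𝓝 (eulerCov T Q θ₀ k)) := by
  induction k with
  | zero => exact tendsto_const_nhds
  | succ k ih =>
    exact ((tendsto_const_nhds.mul (ih fun j hj => h j (by omega))).mul tendsto_const_nhds).add
      ((h _ le_rfl).sub (h _ (by omega)))

/-- The Euler scheme is a linear image of the initial condition and of the noises `w_j`, `v_j`
entering with coefficients `P_j`, `H_j`, and `eulerCov` is the corresponding image of the covariance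
`Q` of the initial condition and of the variance `δ` of the noises. -/
lemma exists_inner_eulerPath (T : ℕ → Mat r r) (P : ℕ → Mat r r) (H : ℕ → Mat r r') (Q : Mat r r)
    (δ : ℝ) (m n : ℕ) (u : Vec r) :
    ∃ (c : Vec r) (a : ℕ → Vec r) (b : ℕ → Vec r'),
      (∀ (x₀ : Vec r) (w : ℕ → Vec r) (v : ℕ → Vec r'),
        inner ℝ u (eulerPath T x₀
          (fun k => ∑ j ∈ Finset.range (k * m), (act (P j) (w j) + act (H j) (v j))) n) =
        inner ℝ c x₀ + ∑ j ∈ Finset.range (n * m), (inner ℝ (a j) (w j) + inner ℝ (b j) (v j))) ∧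
      inner ℝ c (act Q c) + δ * ∑ j ∈ Finset.range (n * m), (‖a j‖ ^ 2 + ‖b j‖ ^ 2) =
        inner ℝ u (act (eulerCov T Q (fun k => δ • ∑ j ∈ Finset.range (k * m),
          (P j * (P j)ᵀ + H j * (H j)ᵀ)) n) u) := by
  induction n generalizing u with
  | zero => exact ⟨u, 0, 0, fun _ _ _ => by simp [eulerPath], by simp [eulerCov]⟩
  | succ n ih =>
    obtain ⟨c, a, b, h1, h2⟩ := ih (act (T n)ᵀ u)
    refine ⟨c, fun j => if j < n * m then a j else act (P j)ᵀ u,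
      fun j => if j < n * m then b j else act (H j)ᵀ u, fun x₀ w v => ?_, ?_⟩
    · rw [eulerPath, inner_add_right, inner_act, h1]
      dsimp only
      rw [add_mul, one_mul, Finset.sum_range_add, add_sub_cancel_left, Finset.sum_range_add,
        add_assoc, inner_sum]
      congr 2
      · refine Finset.sum_congr rfl fun j hj => ?_
        simp [Finset.mem_range.1 hj]
      · refine Finset.sum_congr rfl fun j _ => ?_
        simp [inner_add_right, inner_act]
    · rw [eulerCov, act_add_left, inner_add_right, act_mul, act_mul, inner_act (T n), ← h2]
      dsimp only
      rw [add_mul, one_mul, Finset.sum_range_add, Finset.sum_range_add, smul_add,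
        add_sub_cancel_left, mul_add, add_assoc, act_smul_left, inner_smul_right]
      congr 2
      · congr 1
        refine Finset.sum_congr rfl fun j hj => ?_
        simp [Finset.mem_range.1 hj]
      · congr 1
        rw [← actL_apply, map_sum, sum_apply, inner_sum]
        refine Finset.sum_congr rfl fun j _ => ?_
        simp [actL_apply, act_mul, inner_add_right, inner_act]

/-- The Euler scheme converges to the solution of `z_τ = z_s + ∫_s^τ B_u z_u du + ξ_τ`. -/
theorem tendsto_eulerPath_solution {B : ℝ → Mat r r} (hB : Continuous B) {z : ℝ → Vec r}
    (hz : Continuous z) {s t : ℝ} (hst : s ≤ t) :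
    Tendsto (fun n : ℕ => eulerPath (eulerStep B s ((t - s) / n)) (z s)
      (fun k => z (s + k * ((t - s) / n)) - z s -
        ∫ u in s..(s + k * ((t - s) / n)), act (B u) (z u)) n) atTop (𝓝 (z t)) := by
  have hBz : Continuous fun u => act (B u) (z u) := hB.act hz
  refine tendsto_euler (B := fun u => actL r r (B u)) ((actL r r).continuous.comp hB) hz hst
    (S := fun n k => actL r r (eulerStep B s ((t - s) / n) k)) (D := 0) le_rfl ?_
    (x := fun n k => eulerPath (eulerStep B s ((t - s) / n)) (z s)
      (fun k => z (s + k * ((t - s) / n)) - z s -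
        ∫ u in s..(s + k * ((t - s) / n)), act (B u) (z u)) k) (fun n => rfl) ?_
  · intro n k _
    have h1 : actL r r (1 : Mat r r) = 1 := by ext1 x; exact act_one x
    rw [eulerStep, map_add, map_smul, h1]
    simp
  · intro n k _
    rw [eulerPath, actL_apply]
    congr 1
    simp only [actL_apply]
    rw [← intervalIntegral.integral_interval_sub_left
      (hBz.intervalIntegrable s (s + (k + 1) * ((t - s) / n)))
      (hBz.intervalIntegrable s (s + k * ((t - s) / n)))]
    push_cast
    abel

/-- The linear map `P ↦ B P + P B'`. -/
noncomputable def lyap (B : Mat r r) : Mat r r →L[ℝ] Mat r r :=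
  ContinuousLinearMap.mul ℝ (Mat r r) B + (ContinuousLinearMap.mul ℝ (Mat r r)).flip Bᵀ

lemma lyap_apply (B P : Mat r r) : lyap B P = B * P + P * Bᵀ := rfl

lemma _root_.Continuous.lyap {X : Type*} [TopologicalSpace X] {B : X → Mat r r}
    (hB : Continuous B) : Continuous fun a => KalmanBucy.lyap (B a) :=
  ((ContinuousLinearMap.mul ℝ (Mat r r)).continuous.comp hB).add
    ((ContinuousLinearMap.mul ℝ (Mat r r)).flip.continuous.comp hB.matrix_transpose)

/-- The solution of the linear equation `∂P = B P + P B' + Ξ` on a compact interval. -/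
lemma exists_lyapunov_solution {B Ξ : ℝ → Mat r r} (hB : Continuous B) (hΞ : Continuous Ξ)
    {s t : ℝ} (hst : s ≤ t) (Q : Mat r r) :
    ∃ p : ℝ → Mat r r, Continuous p ∧ p s = Q ∧ ∀ u ∈ Set.Icc s t,
      HasDerivWithinAt p (lyap (B u) (p u) + Ξ u) (Set.Icc s t) u := by
  obtain ⟨K, hK⟩ := isCompact_Icc.exists_bound_of_continuousOn (hB.continuousOn (s := Set.Icc s t))
  obtain ⟨K', hK'⟩ := isCompact_Icc.exists_bound_of_continuousOn
    (hB.matrix_transpose.continuousOn (s := Set.Icc s t))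
  have hK0 : 0 ≤ K := (norm_nonneg _).trans (hK s ⟨le_rfl, hst⟩)
  have hK'0 : 0 ≤ K' := (norm_nonneg _).trans (hK' s ⟨le_rfl, hst⟩)
  obtain ⟨p, hp0, hp⟩ := exists_solution_of_lipschitz (f := fun u P => lyap (B u) P + Ξ u)
    (K := (K + K').toNNReal) hst
    (fun u hu => LipschitzWith.of_dist_le_mul fun P P' => by
      rw [dist_add_right, dist_eq_norm, ← map_sub, dist_eq_norm,
        Real.coe_toNNReal _ (by positivity), lyap_apply]
      have h1 := (norm_mul_le (B u) (P - P')).trans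
        (mul_le_mul_of_nonneg_right (hK u hu) (norm_nonneg _))
      have h2 := (norm_mul_le (P - P') (B u)ᵀ).trans
        (mul_le_mul_of_nonneg_left (hK' u hu) (norm_nonneg _))
      linarith [norm_add_le (B u * (P - P')) ((P - P') * (B u)ᵀ)])
    (fun P => ((hB.lyap.clm_apply continuous_const).add hΞ).continuousOn) Q
  have hpc : ContinuousOn p (Set.Icc s t) := fun u hu => (hp u hu).continuousWithinAt
  have heq : ∀ u ∈ Set.Icc s t, Set.IccExtend hst (Set.domRestrict (Set.Icc s t) p) u = p u :=
    fun u hu => by rw [Set.IccExtend_of_mem _ _ hu, Set.domRestrict_apply]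
  refine ⟨Set.IccExtend hst (Set.domRestrict (Set.Icc s t) p), hpc.domRestrict.Icc_extend', ?_, ?_⟩
  · rw [heq s ⟨le_rfl, hst⟩, hp0]
  · intro u hu
    rw [heq u hu]
    exact (hp u hu).congr heq (heq u hu)

/-- One step of the covariance recursion agrees with one Euler step of the Lyapunov equation up to
a term of second order. -/
lemma eulerStep_conj (B P : Mat r r) (h : ℝ) :
    (1 + h • B) * P * (1 + h • B)ᵀ = P + h • lyap B P + h ^ 2 • (B * P * Bᵀ) := by
  rw [lyap_apply, Matrix.transpose_add, Matrix.transpose_one, Matrix.transpose_smul]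
  simp only [add_mul, mul_add, one_mul, mul_one, smul_mul_assoc, mul_smul_comm, smul_smul, smul_add,
    sq]
  abel

/-- The covariances of the Euler scheme converge to the solution of the Lyapunov equation. -/
theorem tendsto_eulerCov_solution {B Ξ : ℝ → Mat r r} (hB : Continuous B) (hΞ : Continuous Ξ)
    {s t : ℝ} (hst : s ≤ t) {p : ℝ → Mat r r} (hp : Continuous p)
    (hp' : ∀ u ∈ Set.Icc s t,
      HasDerivWithinAt p (lyap (B u) (p u) + Ξ u) (Set.Icc s t) u) :
    Tendsto (fun n : ℕ => eulerCov (eulerStep B s ((t - s) / n)) (p s)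
      (fun k => ∫ u in s..(s + k * ((t - s) / n)), Ξ u) n) atTop (𝓝 (p t)) := by
  have hBp : Continuous fun u => lyap (B u) (p u) := hB.lyap.clm_apply hp
  obtain ⟨K, hK⟩ := isCompact_Icc.exists_bound_of_continuousOn (hB.continuousOn (s := Set.Icc s t))
  obtain ⟨K', hK'⟩ := isCompact_Icc.exists_bound_of_continuousOn
    (hB.matrix_transpose.continuousOn (s := Set.Icc s t))
  have hK0 : 0 ≤ K := (norm_nonneg _).trans (hK s ⟨le_rfl, hst⟩)
  have hK'0 : 0 ≤ K' := (norm_nonneg _).trans (hK' s ⟨le_rfl, hst⟩)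
  have hmem : ∀ n k : ℕ, k ≤ n → s + k * ((t - s) / n) ∈ Set.Icc s t := by
    intro n k hk
    rcases Nat.eq_zero_or_pos n with rfl | hn
    · simp [hst]
    have h1 : (0 : ℝ) < n := by exact_mod_cast hn
    have h2 : (k : ℝ) ≤ n := by exact_mod_cast hk
    have h3 : 0 ≤ (t - s) / n := div_nonneg (by linarith) h1.le
    have h4 : n * ((t - s) / n) = t - s := by field_simp
    exact ⟨by nlinarith [k.cast_nonneg (α := ℝ)], by nlinarith⟩
  refine tendsto_euler (B := fun u => lyap (B u)) hB.lyap hp hst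
    (S := fun n k => (ContinuousLinearMap.mul ℝ (Mat r r)).flip (eulerStep B s ((t - s) / n) k)ᵀ ∘L
      ContinuousLinearMap.mul ℝ (Mat r r) (eulerStep B s ((t - s) / n) k))
    (D := K * K') (by positivity) ?_
    (x := fun n k => eulerCov (eulerStep B s ((t - s) / n)) (p s)
      (fun k => ∫ u in s..(s + k * ((t - s) / n)), Ξ u) k) (fun n => rfl) ?_
  · intro n k hk
    refine ContinuousLinearMap.opNorm_le_bound _ (by positivity) fun P => ?_
    have hτ := hmem n k hk.le
    set h := (t - s) / n
    set τ := s + k * h with hτd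
    have h1 : (((ContinuousLinearMap.mul ℝ (Mat r r)).flip (eulerStep B s h k)ᵀ ∘L
        ContinuousLinearMap.mul ℝ (Mat r r) (eulerStep B s h k)) - (1 + h • lyap (B τ))) P =
        h ^ 2 • (B τ * P * (B τ)ᵀ) := by
      have : ((ContinuousLinearMap.mul ℝ (Mat r r)).flip (eulerStep B s h k)ᵀ ∘L
        ContinuousLinearMap.mul ℝ (Mat r r) (eulerStep B s h k)) P =
        (1 + h • B τ) * P * (1 + h • B τ)ᵀ := rfl
      rw [sub_apply, this, eulerStep_conj, add_apply, one_apply_eq_self, smul_apply]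
      abel
    rw [h1, norm_smul, Real.norm_of_nonneg (sq_nonneg h)]
    calc _ ≤ h ^ 2 * (K * ‖P‖ * K') := by
          gcongr
          refine (norm_mul_le _ _).trans ?_
          gcongr
          · exact (norm_mul_le _ _).trans (by gcongr; exact hK τ hτ)
          · exact hK' τ hτ
      _ = _ := by ring
  · intro n k hk
    rw [eulerCov]
    congr 1
    rw [intervalIntegral.integral_interval_sub_left (hΞ.intervalIntegrable s _)
      (hΞ.intervalIntegrable s _)]
    have hτ := hmem n k hk.le
    have hτ' := hmem n (k + 1) hk
    push_cast at hτ' ⊢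
    set h := (t - s) / n with hh
    have hh0 : 0 ≤ h := div_nonneg (by linarith) n.cast_nonneg
    have hle : s + k * h ≤ s + (k + 1) * h := by nlinarith
    have hFTC := intervalIntegral.integral_eq_sub_of_hasDerivAt_of_le hle
      (f := p) (f' := fun u => lyap (B u) (p u) + Ξ u) hp.continuousOn
      (fun u hu => (hp' u ⟨hτ.1.trans hu.1.le, hu.2.le.trans hτ'.2⟩).hasDerivAt
        (Icc_mem_nhds (hτ.1.trans_lt hu.1) (hu.2.trans_le hτ'.2)))
      ((hBp.add hΞ).intervalIntegrable _ _)
    rw [← hFTC, intervalIntegral.integral_add (hBp.intervalIntegrable _ _)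
      (hΞ.intervalIntegrable _ _)]
    abel

end EulerSchemes

/-! ### Characteristic functions of Brownian increments -/

section Noise

variable {Ω : Type*} [MeasurableSpace Ω] {μ : Measure Ω}

lemma integral_exp_brownianReal_increments [IsProbabilityMeasure μ] {B : ℝ≥0 → Ω → ℝ}
    (hB : IsBrownianReal B μ) (hBm : ∀ t, Measurable (B t)) {τ : ℕ → ℝ≥0} {δ : ℝ≥0}
    (hτ : ∀ j, τ (j + 1) = τ j + δ) (M : ℕ) (a : ℕ → ℝ) :
    ∫ ω, Complex.exp ((∑ j ∈ Finset.range M, a j * (B (τ (j + 1)) ω - B (τ j) ω) : ℝ) *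
      Complex.I) ∂μ = Complex.exp (-(δ * ∑ j ∈ Finset.range M, a j ^ 2 / 2 : ℝ)) := by
  have hmono : Monotone τ := monotone_nat_of_le_succ fun j => by rw [hτ]; exact le_self_add
  have hind := (hB.toIsPreBrownianReal.hasIndepIncrements.nat hmono).precomp
    (g := (Fin.val : Fin M → ℕ)) Fin.val_injective
  have h := iIndepFun.integral_fun_prod_comp (𝕜 := ℂ)
    (X := fun (j : Fin M) ω => B (τ (j + 1)) ω - B (τ j) ω) hind
    (f := fun j x => Complex.exp ((a j * x : ℝ) * Complex.I))
    (fun j => ((hBm _).sub (hBm _)).aemeasurable)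
    (fun j => (by fun_prop : Continuous fun x : ℝ =>
      Complex.exp ((a j * x : ℝ) * Complex.I)).aestronglyMeasurable)
  have hone : ∀ j, ∫ ω, Complex.exp ((a j * (B (τ (j + 1)) ω - B (τ j) ω) : ℝ) * Complex.I) ∂μ =
      Complex.exp (-(δ * (a j ^ 2 / 2) : ℝ)) := by
    intro j
    have hlaw := hB.toIsPreBrownianReal.hasLaw_sub (τ (j + 1)) (τ j)
    have hnd : nndist (τ (j + 1)).1 (τ j).1 = δ := by
      ext
      rw [coe_nndist, Real.dist_eq, hτ]
      simp
    rw [hnd] at hlaw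
    have h1 := charFun_gaussianReal (μ := 0) (v := δ) (a j)
    rw [charFun_apply, ← hlaw.map_eq, integral_map hlaw.aemeasurable (by fun_prop)] at h1
    simp only [Pi.sub_apply] at h1
    have h2 : ∀ x : ℝ, inner ℝ x (a j) = a j * x := fun x => rfl
    simp only [h2] at h1
    rw [h1]
    congr 1
    push_cast
    ring
  calc _ = ∫ ω, ∏ j : Fin M,
        Complex.exp ((a j * (B (τ (j + 1)) ω - B (τ j) ω) : ℝ) * Complex.I) ∂μ := by
        congr 1 with ω
        rw [← Complex.exp_sum, Finset.sum_range, ← Finset.sum_mul]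
        push_cast
        rfl
    _ = _ := by
        refine h.trans ?_
        rw [Finset.prod_congr rfl fun (j : Fin M) _ => hone j, ← Complex.exp_sum]
        congr 1
        rw [Finset.sum_range]
        push_cast
        rw [Finset.mul_sum, Finset.sum_neg_distrib]

theorem IsBrownian.integral_exp_increments [IsProbabilityMeasure μ] {n : ℕ} {W : ℝ → Ω → Vec n}
    (hW : IsBrownian W μ) {s δ : ℝ} (hs : 0 ≤ s) (hδ : 0 ≤ δ) (M : ℕ) (a : ℕ → Vec n) :
    ∫ ω, Complex.exp ((∑ j ∈ Finset.range M,
      inner ℝ (a j) (W (s + (j + 1) * δ) ω - W (s + j * δ) ω) : ℝ) * Complex.I) ∂μ =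
      Complex.exp (-(δ * ∑ j ∈ Finset.range M, ‖a j‖ ^ 2 / 2 : ℝ)) := by
  lift s to ℝ≥0 using hs
  lift δ to ℝ≥0 using hδ
  obtain ⟨τ, hτ⟩ : ∃ τ : ℕ → ℝ≥0, ∀ j : ℕ, τ j = s + j * δ := ⟨_, fun _ => rfl⟩
  have hτc : ∀ j : ℕ, ((τ j : ℝ≥0) : ℝ) = s + j * δ := fun j => by simp [hτ]
  have hτs : ∀ j : ℕ, τ (j + 1) = τ j + δ := by
    intro j
    rw [hτ, hτ]
    push_cast
    ring
  have hm : ∀ (i : Fin n) (t : ℝ≥0), Measurable fun ω => W t ω i := fun i t =>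
    (by fun_prop : Measurable fun x : Vec n => x i).comp (hW.measurable t t.2)
  have h := iIndepFun.integral_fun_prod_comp (𝕜 := ℂ)
    (X := fun (i : Fin n) ω (t : ℝ≥0) => W t ω i) hW.indep
    (f := fun i p => Complex.exp ((∑ j ∈ Finset.range M, a j i * (p (τ (j + 1)) - p (τ j)) : ℝ) *
      Complex.I))
    (fun i => (measurable_pi_lambda _ fun t => hm i t).aemeasurable)
    (fun i => (by fun_prop : Measurable fun p : ℝ≥0 → ℝ =>
      Complex.exp ((∑ j ∈ Finset.range M, a j i * (p (τ (j + 1)) - p (τ j)) : ℝ) *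
      Complex.I)).aestronglyMeasurable)
  calc _ = _ := by
        congr 1 with ω
        rw [← Complex.exp_sum, ← Finset.sum_mul, ← Complex.ofReal_sum, Finset.sum_comm]
        congr 3
        refine Finset.sum_congr rfl fun j _ => ?_
        rw [EuclideanSpace.inner_eq_star_dotProduct, dotProduct]
        refine Finset.sum_congr rfl fun i _ => ?_
        simp [hτc, mul_comm]
    _ = _ := h
    _ = _ := by
        rw [Finset.prod_congr rfl fun (i : Fin n) _ =>
          integral_exp_brownianReal_increments (hW.coord i) (hm i) hτs M (fun j => a j i),
          ← Complex.exp_sum]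
        congr 1
        rw [Finset.sum_neg_distrib, ← Complex.ofReal_sum, ← Finset.mul_sum, Finset.sum_comm]
        congr 3
        refine Finset.sum_congr rfl fun j _ => ?_
        rw [EuclideanSpace.real_norm_sq_eq, Finset.sum_div]

lemma measurable_path {n : ℕ} {W : ℝ → Ω → Vec n} (hW : ∀ t : ℝ, 0 ≤ t → Measurable (W t)) :
    Measurable (path W) :=
  measurable_pi_lambda _ fun t => hW t t.2

lemma integral_mul_mul_of_indepFun {α β γ : Type*} [MeasurableSpace α] [MeasurableSpace β]
    [MeasurableSpace γ] {Z : Ω → α} {W : Ω → β} {V : Ω → γ} (hZ : Measurable Z) (hW : Measurable W)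
    (hV : Measurable V) (hWV : IndepFun W V μ) (hind : IndepFun Z (fun ω => (W ω, V ω)) μ)
    {f : α → ℂ} {g : β → ℂ} {h : γ → ℂ} (hf : Measurable f) (hg : Measurable g)
    (hh : Measurable h) :
    ∫ ω, f (Z ω) * (g (W ω) * h (V ω)) ∂μ =
      (∫ ω, f (Z ω) ∂μ) * ((∫ ω, g (W ω) ∂μ) * ∫ ω, h (V ω) ∂μ) := by
  have hgh : Measurable fun p : β × γ => g p.1 * h p.2 := by fun_prop
  rw [← hWV.integral_fun_comp_mul_comp hW.aemeasurable hV.aemeasurable hg.aestronglyMeasurable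
    hh.aestronglyMeasurable]
  exact hind.integral_fun_comp_mul_comp hZ.aemeasurable (hW.prodMk hV).aemeasurable
    hf.aestronglyMeasurable hgh.aestronglyMeasurable

lemma measurable_exp_path {n : ℕ} (M : ℕ) (a : ℕ → Vec n) (t t' : ℕ → ℝ≥0) :
    Measurable fun p : ℝ≥0 → Vec n => Complex.exp ((∑ j ∈ Finset.range M,
      inner ℝ (a j) (p (t' j) - p (t j)) : ℝ) * Complex.I) := by
  have h1 : ∀ j t, Measurable fun p : ℝ≥0 → Vec n => inner ℝ (a j) (p t) := fun j t =>
    (by fun_prop : Measurable fun y : Vec n => inner ℝ (a j) y).comp (measurable_pi_apply t)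
  have h2 : Measurable fun p : ℝ≥0 → Vec n =>
      ∑ j ∈ Finset.range M, inner ℝ (a j) (p (t' j) - p (t j)) := by
    refine Finset.measurable_fun_sum _ fun j _ => ?_
    simp only [inner_sub_right]
    exact (h1 j _).sub (h1 j _)
  exact Complex.measurable_exp.comp ((Complex.measurable_ofReal.comp h2).mul_const _)

lemma integral_exp_multivariateGaussian {r : ℕ} {Z₀ : Ω → Vec r} {x : Vec r} {Q : Mat r r}
    (hQ : Q.PosSemidef) (hlaw : HasLaw Z₀ (multivariateGaussian x Q) μ) (c : Vec r) :
    ∫ ω, Complex.exp ((inner ℝ c (Z₀ ω - x) : ℝ) * Complex.I) ∂μ =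
      Complex.exp (-(inner ℝ c (act Q c) / 2 : ℝ)) := by
  have h := charFun_multivariateGaussian (μ := x) hQ c
  rw [charFun_apply, ← hlaw.map_eq, integral_map hlaw.aemeasurable (by fun_prop)] at h
  have : ∀ ω, Complex.exp ((inner ℝ c (Z₀ ω - x) : ℝ) * Complex.I) =
      Complex.exp ((inner ℝ (Z₀ ω) c : ℝ) * Complex.I) *
        Complex.exp (-((inner ℝ c x : ℝ) * Complex.I)) := by
    intro ω
    rw [← Complex.exp_add, inner_sub_right, real_inner_comm c (Z₀ ω)]
    congr 1
    push_cast
    ring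
  simp only [this]
  rw [integral_mul_const, h, ← Complex.exp_add, inner_act_eq_dotProduct]
  congr 1
  push_cast
  ring

/-- The characteristic functional of a Gaussian vector and of finitely many increments of two
Brownian motions, all independent. -/
theorem integral_exp_gaussian_noise [IsProbabilityMeasure μ] {r r' : ℕ} {Wb : ℝ → Ω → Vec r}
    {Vb : ℝ → Ω → Vec r'} {Z₀ : Ω → Vec r} {x : Vec r} {Q : Mat r r} (hQ : Q.PosSemidef)
    (hW : IsBrownian Wb μ) (hV : IsBrownian Vb μ) (hWV : IndepFun (path Wb) (path Vb) μ)
    (hZ : Measurable Z₀) (hlaw : HasLaw Z₀ (multivariateGaussian x Q) μ)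
    (hind : IndepFun Z₀ (fun ω => (path Wb ω, path Vb ω)) μ)
    {s δ : ℝ} (hs : 0 ≤ s) (hδ : 0 ≤ δ) (M : ℕ) (c : Vec r) (a : ℕ → Vec r) (b : ℕ → Vec r') :
    ∫ ω, Complex.exp ((inner ℝ c (Z₀ ω - x) + ∑ j ∈ Finset.range M,
      (inner ℝ (a j) (Wb (s + (j + 1) * δ) ω - Wb (s + j * δ) ω) +
        inner ℝ (b j) (Vb (s + (j + 1) * δ) ω - Vb (s + j * δ) ω)) : ℝ) * Complex.I) ∂μ =
      Complex.exp (-((inner ℝ c (act Q c) +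
        δ * ∑ j ∈ Finset.range M, (‖a j‖ ^ 2 + ‖b j‖ ^ 2)) / 2 : ℝ)) := by
  obtain ⟨t, ht⟩ : ∃ t : ℕ → ℝ≥0, ∀ j : ℕ, (t j : ℝ) = s + j * δ :=
    ⟨fun j => ⟨s + j * δ, by positivity⟩, fun _ => rfl⟩
  obtain ⟨t', ht'⟩ : ∃ t : ℕ → ℝ≥0, ∀ j : ℕ, (t j : ℝ) = s + (j + 1) * δ :=
    ⟨fun j => ⟨s + (j + 1) * δ, by positivity⟩, fun _ => rfl⟩
  have h1 := integral_mul_mul_of_indepFun hZ (measurable_path hW.measurable)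
    (measurable_path hV.measurable) hWV hind
    (f := fun z => Complex.exp ((inner ℝ c (z - x) : ℝ) * Complex.I)) (by fun_prop)
    (measurable_exp_path M a t t') (measurable_exp_path M b t t')
  simp only [path, ht, ht'] at h1
  rw [integral_exp_multivariateGaussian hQ hlaw c, hW.integral_exp_increments hs hδ M a,
    hV.integral_exp_increments hs hδ M b, ← Complex.exp_add, ← Complex.exp_add] at h1
  have e1 : ∀ ω, Complex.exp ((inner ℝ c (Z₀ ω - x) + ∑ j ∈ Finset.range M,
      (inner ℝ (a j) (Wb (s + (j + 1) * δ) ω - Wb (s + j * δ) ω) +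
        inner ℝ (b j) (Vb (s + (j + 1) * δ) ω - Vb (s + j * δ) ω)) : ℝ) * Complex.I) =
      Complex.exp ((inner ℝ c (Z₀ ω - x) : ℝ) * Complex.I) * (Complex.exp ((∑ j ∈ Finset.range M,
        inner ℝ (a j) (Wb (s + (j + 1) * δ) ω - Wb (s + j * δ) ω) : ℝ) * Complex.I) *
      Complex.exp ((∑ j ∈ Finset.range M,
        inner ℝ (b j) (Vb (s + (j + 1) * δ) ω - Vb (s + j * δ) ω) : ℝ) * Complex.I)) := by
    intro ω
    rw [← Complex.exp_add, ← Complex.exp_add, Finset.sum_add_distrib]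
    congr 1
    rw [Complex.ofReal_add, Complex.ofReal_add, add_mul, add_mul]
  simp only [e1]
  rw [h1]
  congr 1
  rw [Finset.sum_add_distrib, ← Finset.sum_div, ← Finset.sum_div]
  simp only [Complex.ofReal_add, Complex.ofReal_div, Complex.ofReal_mul]
  ring

end Noise

/-! ### Conditional expectations of characteristic functions -/

section Conditioning

variable {Ω : Type*} [mΩ : MeasurableSpace Ω] {μ : Measure Ω} {β : Type*} [mβ : MeasurableSpace β]

/-- Conditionally on `O`, the noise `N` is integrated out with `O` frozen. -/
lemma condExp_comp_of_indepFun [IsProbabilityMeasure μ] {γ : Type*} [MeasurableSpace γ]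
    [StandardBorelSpace γ] [Nonempty γ] {O : Ω → β} {N : Ω → γ} (hO : Measurable O)
    (hN : Measurable N) (hind : IndepFun O N μ) {f : β × γ → ℂ} (hf : StronglyMeasurable f)
    (hb : ∀ p, ‖f p‖ ≤ 1) :
    μ[fun ω => f (O ω, N ω) | mβ.comap O] =ᵐ[μ] fun ω => ∫ ω', f (O ω, N ω') ∂μ := by
  have := Measure.isProbabilityMeasure_map (μ := μ) hN.aemeasurable
  have hκ : condDistrib N O μ =ᵐ[μ.map O] Kernel.const β (μ.map N) := by
    refine condDistrib_ae_eq_of_measure_eq_compProd O hN.aemeasurable ?_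
    rw [Measure.compProd_const]
    exact (indepFun_iff_map_prod_eq_prod_map_map hO.aemeasurable hN.aemeasurable).1 hind
  refine (condExp_prod_ae_eq_integral_condDistrib hO hN.aemeasurable hf ?_).trans ?_
  · exact Integrable.of_bound
      (hf.comp_measurable (hO.prodMk hN)).aestronglyMeasurable 1 (ae_of_all _ fun ω => hb _)
  · filter_upwards [ae_of_ae_map hO.aemeasurable hκ] with ω hω
    rw [hω, Kernel.const_apply, integral_map hN.aemeasurable]
    exact (hf.comp_measurable measurable_prodMk_left).aestronglyMeasurable

lemma _root_.MeasureTheory.StronglyMeasurable.act {α : Type*} [MeasurableSpace α] {m n : ℕ}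
    {M : α → Mat m n} {x : α → Vec n} (hM : StronglyMeasurable M) (hx : StronglyMeasurable x) :
    StronglyMeasurable fun a => KalmanBucy.act (M a) (x a) := by
  have hc : Continuous fun p : Mat m n × Vec n => KalmanBucy.act p.1 p.2 :=
    continuous_fst.act continuous_snd
  have h := hc.comp_stronglyMeasurable (hM.prodMk hx)
  exact h

lemma stronglyMeasurable_eulerPath {α : Type*} [MeasurableSpace α] {r : ℕ} {T : α → ℕ → Mat r r}
    {x : α → Vec r} {ξ : α → ℕ → Vec r} (hT : ∀ k, StronglyMeasurable fun a => T a k)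
    (hx : StronglyMeasurable x) (hξ : ∀ k, StronglyMeasurable fun a => ξ a k) (k : ℕ) :
    StronglyMeasurable fun a => eulerPath (T a) (x a) (ξ a) k := by
  induction k with
  | zero => exact hx
  | succ k ih => exact ((hT k).act ih).add ((hξ _).sub (hξ _))

/-- Given the observation, which determines the step matrices `T`, the gains `g` and the increments
`y` of the observation, the Euler scheme of the diffusion is Gaussian: its mean is the Euler scheme
of the filter and its covariance is `eulerCov`. -/
theorem condExp_exp_eulerPath [IsProbabilityMeasure μ] {r r' : ℕ} {R : Mat r r} {Sig : Mat r' r'}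
    (hR : R.PosSemidef) (hSig : Sig.PosSemidef)
    {Wb : ℝ → Ω → Vec r} {Vb : ℝ → Ω → Vec r'} {Z₀ : Ω → Vec r} {x : Vec r} {Q : Mat r r}
    (hQ : Q.PosSemidef) (hW : IsBrownian Wb μ) (hV : IsBrownian Vb μ)
    (hWV : IndepFun (path Wb) (path Vb) μ) (hZ : Measurable Z₀)
    (hlaw : HasLaw Z₀ (multivariateGaussian x Q) μ)
    (hind : IndepFun Z₀ (fun ω => (path Wb ω, path Vb ω)) μ)
    {O : Ω → β} (hO : Measurable O)
    (hOind : IndepFun O (fun ω => (Z₀ ω, path Wb ω, path Vb ω)) μ)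
    {s δ : ℝ} (hs : 0 ≤ s) (hδ : 0 ≤ δ) (m n : ℕ)
    {T : β → ℕ → Mat r r} (hT : ∀ k, StronglyMeasurable fun o => T o k)
    {g : β → ℕ → Mat r r'} (hg : ∀ j, StronglyMeasurable fun o => g o j)
    {y : β → ℕ → Vec r'} (hy : ∀ j, StronglyMeasurable fun o => y o j) (u : Vec r) :
    AEStronglyMeasurable (fun ω => Complex.exp ((inner ℝ u (eulerPath (T (O ω)) (Z₀ ω) (fun k =>
        ∑ j ∈ Finset.range (k * m),
          (act (CFC.sqrt R) (Wb (s + (j + 1) * δ) ω - Wb (s + j * δ) ω) +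
            act (g (O ω) j) (y (O ω) j -
              act (CFC.sqrt Sig) (Vb (s + (j + 1) * δ) ω - Vb (s + j * δ) ω)))) n) : ℝ) *
        Complex.I)) μ ∧
    μ[fun ω => Complex.exp ((inner ℝ u (eulerPath (T (O ω)) (Z₀ ω) (fun k =>
        ∑ j ∈ Finset.range (k * m),
          (act (CFC.sqrt R) (Wb (s + (j + 1) * δ) ω - Wb (s + j * δ) ω) +
            act (g (O ω) j) (y (O ω) j -
              act (CFC.sqrt Sig) (Vb (s + (j + 1) * δ) ω - Vb (s + j * δ) ω)))) n) : ℝ) *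
        Complex.I) | mβ.comap O] =ᵐ[μ]
      fun ω => Complex.exp ((inner ℝ u (eulerPath (T (O ω)) x (fun k =>
          ∑ j ∈ Finset.range (k * m), act (g (O ω) j) (y (O ω) j)) n) : ℝ) * Complex.I) *
        Complex.exp (-((inner ℝ u (act (eulerCov (T (O ω)) Q (fun k =>
          δ • ∑ j ∈ Finset.range (k * m), (R + g (O ω) j * Sig * (g (O ω) j)ᵀ)) n) u)) / 2 : ℝ)) :=
    by
  have hWm : ∀ t : ℝ, 0 ≤ t → Measurable fun p : Vec r × (ℝ≥0 → Vec r) × (ℝ≥0 → Vec r') =>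
      p.2.1 t.toNNReal := fun t _ => by fun_prop
  have hVm : ∀ t : ℝ, 0 ≤ t → Measurable fun p : Vec r × (ℝ≥0 → Vec r) × (ℝ≥0 → Vec r') =>
      p.2.2 t.toNNReal := fun t _ => by fun_prop
  have hτ : ∀ j : ℕ, 0 ≤ s + j * δ := fun j => by positivity
  have hτ' : ∀ j : ℕ, 0 ≤ s + (j + 1) * δ := fun j => by positivity
  -- the finite-dimensional noise: initial condition and increments
  let N : Ω → Vec r × (ℕ → Vec r) × (ℕ → Vec r') := fun ω => (Z₀ ω,
    fun j => Wb (s + (j + 1) * δ) ω - Wb (s + j * δ) ω,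
    fun j => Vb (s + (j + 1) * δ) ω - Vb (s + j * δ) ω)
  have hN : Measurable N := hZ.prodMk
    ((measurable_pi_lambda _ fun j => (hW.measurable _ (hτ' j)).sub (hW.measurable _ (hτ j))).prodMk
      (measurable_pi_lambda _ fun j => (hV.measurable _ (hτ' j)).sub (hV.measurable _ (hτ j))))
  have hON : IndepFun O N μ := by
    have h : Measurable fun p : Vec r × (ℝ≥0 → Vec r) × (ℝ≥0 → Vec r') =>
        ((p.1, fun j : ℕ => p.2.1 (s + (j + 1) * δ).toNNReal - p.2.1 (s + j * δ).toNNReal,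
          fun j : ℕ => p.2.2 (s + (j + 1) * δ).toNNReal - p.2.2 (s + j * δ).toNNReal) :
          Vec r × (ℕ → Vec r) × (ℕ → Vec r')) :=
      measurable_fst.prodMk ((measurable_pi_lambda _ fun j =>
        (hWm _ (hτ' j)).sub (hWm _ (hτ j))).prodMk (measurable_pi_lambda _ fun j =>
        (hVm _ (hτ' j)).sub (hVm _ (hτ j))))
    have h2 := hOind.comp measurable_id h
    have h3 : N = (fun p : Vec r × (ℝ≥0 → Vec r) × (ℝ≥0 → Vec r') =>
        ((p.1, fun j : ℕ => p.2.1 (s + (j + 1) * δ).toNNReal - p.2.1 (s + j * δ).toNNReal,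
          fun j : ℕ => p.2.2 (s + (j + 1) * δ).toNNReal - p.2.2 (s + j * δ).toNNReal) :
          Vec r × (ℕ → Vec r) × (ℕ → Vec r'))) ∘ fun ω => (Z₀ ω, path Wb ω, path Vb ω) := by
      funext ω
      simp only [N, Function.comp, path, Real.coe_toNNReal _ (hτ _), Real.coe_toNNReal _ (hτ' _)]
    rw [h3]
    exact h2
  let ξ : β × (Vec r × (ℕ → Vec r) × (ℕ → Vec r')) → ℕ → Vec r := fun p k =>
    ∑ j ∈ Finset.range (k * m), (act (CFC.sqrt R) (p.2.2.1 j) +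
      act (g p.1 j) (y p.1 j - act (CFC.sqrt Sig) (p.2.2.2 j)))
  let f : β × (Vec r × (ℕ → Vec r) × (ℕ → Vec r')) → ℂ := fun p =>
    Complex.exp ((inner ℝ u (eulerPath (T p.1) p.2.1 (ξ p) n) : ℝ) * Complex.I)
  have hf : StronglyMeasurable f := by
    have hξ : ∀ k, StronglyMeasurable fun p => ξ p k := fun k => by
      refine Finset.stronglyMeasurable_fun_sum _ fun j _ => ?_
      refine (stronglyMeasurable_const.act
        (by fun_prop : Measurable fun p : β × (Vec r × (ℕ → Vec r) × (ℕ → Vec r')) =>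
          p.2.2.1 j).stronglyMeasurable).add
        (((hg j).comp_measurable measurable_fst).act
          (((hy j).comp_measurable measurable_fst).sub (stronglyMeasurable_const.act
          (by fun_prop : Measurable fun p : β × (Vec r × (ℕ → Vec r) × (ℕ → Vec r')) =>
            p.2.2.2 j).stronglyMeasurable)))
    have h1 := stronglyMeasurable_eulerPath (T := fun p : β × (Vec r × (ℕ → Vec r) × (ℕ → Vec r'))
      => T p.1) (x := fun p => p.2.1) (ξ := ξ) (fun k => (hT k).comp_measurable measurable_fst)
      (by fun_prop : Measurable fun p : β × (Vec r × (ℕ → Vec r) × (ℕ → Vec r')) =>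
          p.2.1).stronglyMeasurable hξ n
    exact (by fun_prop : Continuous fun x : Vec r =>
      Complex.exp ((inner ℝ u x : ℝ) * Complex.I)).comp_stronglyMeasurable h1
  have hb : ∀ p, ‖f p‖ ≤ 1 := fun p => (Complex.norm_exp_ofReal_mul_I _).le
  refine ⟨(hf.comp_measurable (hO.prodMk hN)).aestronglyMeasurable,
    (condExp_comp_of_indepFun hO hN hON hf hb).trans (ae_of_all _ fun ω => ?_)⟩
  dsimp only
  set o := O ω
  obtain ⟨c, a, b, h1, h2⟩ := exists_inner_eulerPath (T o) (fun _ => CFC.sqrt R)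
    (fun j => -(g o j * CFC.sqrt Sig)) Q δ m n u
  -- the scheme is the sum of the scheme of the mean and of a scheme driven by centered noise
  have hsplit : ∀ ω', inner ℝ u (eulerPath (T o) (Z₀ ω') (ξ (o, N ω')) n) =
      inner ℝ u (eulerPath (T o) x (fun k => ∑ j ∈ Finset.range (k * m), act (g o j) (y o j)) n) +
      (inner ℝ c (Z₀ ω' - x) + ∑ j ∈ Finset.range (n * m),
        (inner ℝ (a j) (Wb (s + (j + 1) * δ) ω' - Wb (s + j * δ) ω') +
        inner ℝ (b j) (Vb (s + (j + 1) * δ) ω' - Vb (s + j * δ) ω'))) := by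
    intro ω'
    rw [← h1 (Z₀ ω' - x) (fun j => Wb (s + (j + 1) * δ) ω' - Wb (s + j * δ) ω')
      (fun j => Vb (s + (j + 1) * δ) ω' - Vb (s + j * δ) ω'), ← inner_add_right, ← eulerPath_add,
      add_sub_cancel]
    congr 3
    funext k
    rw [← Finset.sum_add_distrib]
    refine Finset.sum_congr rfl fun j _ => ?_
    simp only [N, act_sub_right, act_neg_left, act_mul]
    abel
  have hsqR : CFC.sqrt R * (CFC.sqrt R)ᵀ = R := by
    have h := (Matrix.nonneg_iff_posSemidef.1 (CFC.sqrt_nonneg R)).isHermitian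
    rw [Matrix.IsHermitian, Matrix.conjTranspose_eq_transpose_of_trivial] at h
    rw [h]
    exact CFC.sqrt_mul_sqrt_self R hR.nonneg
  have hsqS : CFC.sqrt Sig * (CFC.sqrt Sig)ᵀ = Sig := by
    have h := (Matrix.nonneg_iff_posSemidef.1 (CFC.sqrt_nonneg Sig)).isHermitian
    rw [Matrix.IsHermitian, Matrix.conjTranspose_eq_transpose_of_trivial] at h
    rw [h]
    exact CFC.sqrt_mul_sqrt_self Sig hSig.nonneg
  have hθ : ∀ j, CFC.sqrt R * (CFC.sqrt R)ᵀ +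
      -(g o j * CFC.sqrt Sig) * (-(g o j * CFC.sqrt Sig))ᵀ = R + g o j * Sig * (g o j)ᵀ := by
    intro j
    rw [hsqR, Matrix.transpose_neg, Matrix.neg_mul, Matrix.mul_neg, neg_neg, Matrix.transpose_mul]
    conv_rhs => rw [← hsqS]
    simp only [Matrix.mul_assoc]
  simp only [hθ] at h2
  rw [← h2]
  clear h2
  have hnoise := integral_exp_gaussian_noise hQ hW hV hWV hZ hlaw hind hs hδ (n * m) c a b
  rw [← hnoise, ← integral_const_mul]
  congr 1 with ω'
  simp only [f]
  rw [← Complex.exp_add]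
  congr 1
  change ((inner ℝ u (eulerPath (T o) (Z₀ ω') (ξ (o, N ω')) n) : ℝ) : ℂ) * _ = _
  rw [hsplit]
  push_cast
  ring

/-- Conditional expectations of bounded functions pass to the limit together with a continuous
function of them. -/
lemma condExp_limit [IsProbabilityMeasure μ] {f : ℕ → Ω → ℂ} {f₀ : Ω → ℂ}
    (hfm : ∀ l, AEStronglyMeasurable (f l) μ) {m : MeasurableSpace Ω} (hm : m ≤ mΩ)
    (hfb : ∀ l ω, ‖f l ω‖ ≤ 1)
    (hf : ∀ᵐ ω ∂μ, Tendsto (fun l => f l ω) atTop (𝓝 (f₀ ω)))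
    {F : Type*} [TopologicalSpace F] [T2Space F] {Φ : ℂ → F} (hΦ : Continuous Φ) {g : ℕ → Ω → F}
    {g₀ : Ω → F} (hg : ∀ᵐ ω ∂μ, Tendsto (fun l => g l ω) atTop (𝓝 (g₀ ω)))
    (h : ∀ l, ∀ᵐ ω ∂μ, Φ ((μ[f l | m]) ω) = g l ω) : ∀ᵐ ω ∂μ, Φ ((μ[f₀ | m]) ω) = g₀ ω := by
  have hf₀m : AEStronglyMeasurable[mΩ] f₀ μ := aestronglyMeasurable_of_tendsto_ae atTop hfm hf
  have hfint : ∀ l, Integrable (f l) μ := fun l => .of_bound (hfm l) 1 (ae_of_all _ (hfb l))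
  have hf₀b : ∀ᵐ ω ∂μ, ‖f₀ ω‖ ≤ 1 := by
    filter_upwards [hf] with ω hω
    exact le_of_tendsto hω.norm (Eventually.of_forall fun l => hfb l ω)
  have hf₀int : Integrable f₀ μ := .of_bound hf₀m 1 hf₀b
  -- dominated convergence and the `L¹` contraction give convergence in measure of the conditional
  -- expectations, hence almost surely along a subsequence
  have hL1 : Tendsto (fun l => ∫ ω, ‖f l ω - f₀ ω‖ ∂μ) atTop (𝓝 0) := by
    have := tendsto_integral_of_dominated_convergence (μ := μ) (F := fun l ω => ‖f l ω - f₀ ω‖)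
      (f := fun _ => 0) (fun _ => 2) (fun l => ((hfm l).sub hf₀m).norm) (integrable_const _)
      (fun l => by
        filter_upwards [hf₀b] with ω hω
        rw [norm_norm]
        exact (norm_sub_le _ _).trans (by linarith [hfb l ω]))
      (by
        filter_upwards [hf] with ω hω
        simpa using (hω.sub_const (f₀ ω)).norm)
    simpa using this
  have hL1' : Tendsto (fun l => eLpNorm (μ[f l | m] - μ[f₀ | m]) 1 μ) atTop (𝓝 0) := by
    have h1 : ∀ l, eLpNorm (μ[f l | m] - μ[f₀ | m]) 1 μ ≤ ENNReal.ofReal (∫ ω, ‖f l ω - f₀ ω‖ ∂μ) :=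
      fun l => by
        rw [eLpNorm_congr_ae (condExp_sub (hfint l) hf₀int m).symm]
        refine (eLpNorm_condExp_le_eLpNorm _ le_rfl).trans ?_
        have h2 := ofReal_integral_norm_eq_lintegral_enorm ((hfint l).sub hf₀int)
        simp only [Pi.sub_apply] at h2
        rw [eLpNorm_one_eq_lintegral_enorm, h2]
        rfl
    refine tendsto_of_tendsto_of_tendsto_of_le_of_le tendsto_const_nhds ?_ (fun _ => zero_le) h1
    simpa using ENNReal.tendsto_ofReal hL1
  have hm1 : ∀ h : Ω → ℂ, AEStronglyMeasurable[mΩ] (μ[h | m]) μ := fun h =>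
    (stronglyMeasurable_condExp.mono hm).aestronglyMeasurable
  have hTM : TendstoInMeasure μ (fun l => μ[f l | m]) atTop (μ[f₀ | m]) :=
    tendstoInMeasure_of_tendsto_eLpNorm (p := 1) one_ne_zero (fun l => hm1 (f l)) (hm1 f₀) hL1'
  obtain ⟨ns, hns, hae⟩ := hTM.exists_seq_tendsto_ae
  filter_upwards [hae, hg, ae_all_iff.2 h] with ω h1 h2 h3
  refine tendsto_nhds_unique ((hΦ.tendsto _).comp h1) ?_
  refine (h2.comp hns.tendsto_atTop).congr fun l => ?_
  exact (h3 (ns l)).symm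

end Conditioning

/-! ### Riemann sums of Itô integrals along subsequences -/

section RiemannSums

variable {Ω : Type*} [MeasurableSpace Ω] {μ : Measure Ω} {r r' : ℕ}

/-- Finitely many sequences that converge in measure converge almost surely along a common
subsequence. -/
lemma exists_common_subseq_tendsto_ae {E : Type*} [PseudoEMetricSpace E] {f : ℕ → ℕ → Ω → E}
    {g : ℕ → Ω → E} (n : ℕ) (h : ∀ k ≤ n, TendstoInMeasure μ (f k) atTop (g k)) :
    ∃ ns : ℕ → ℕ, StrictMono ns ∧
      ∀ᵐ ω ∂μ, ∀ k ≤ n, Tendsto (fun l => f k (ns l) ω) atTop (𝓝 (g k ω)) := by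
  induction n with
  | zero =>
    obtain ⟨ns, hns, hae⟩ := (h 0 le_rfl).exists_seq_tendsto_ae
    refine ⟨ns, hns, ?_⟩
    filter_upwards [hae] with ω hω k hk
    obtain rfl : k = 0 := by omega
    exact hω
  | succ n ih =>
    obtain ⟨ns, hns, hae⟩ := ih fun k hk => h k (by omega)
    obtain ⟨ms, hms, hae'⟩ :=
      ((h (n + 1) le_rfl).comp hns.tendsto_atTop).exists_seq_tendsto_ae
    refine ⟨ns ∘ ms, hns.comp hms, ?_⟩
    filter_upwards [hae, hae'] with ω h1 h2 k hk
    rcases Nat.lt_or_ge n k with hkn | hkn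
    · obtain rfl : k = n + 1 := by omega
      exact h2
    · exact (h1 k hkn).comp hms.tendsto_atTop

lemma itoSum_congr {Ω' : Type*} {m n : ℕ} {G G' : ℝ → Ω' → Mat m n} {U U' : ℝ → Ω' → Vec n}
    {s t : ℝ} (hst : s ≤ t) {ω : Ω'} (hG : ∀ u ∈ Set.Icc s t, G u ω = G' u ω)
    (hU : ∀ u ∈ Set.Icc s t, U u ω = U' u ω) (N : ℕ) :
    itoSum G U s t N ω = itoSum G' U' s t N ω := by
  refine Finset.sum_congr rfl fun k hk => ?_
  have hN : (0 : ℝ) < N := by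
    have := Finset.mem_range.1 hk
    exact_mod_cast (by omega : 0 < N)
  have h0 : 0 ≤ (t - s) / N := div_nonneg (by linarith) hN.le
  have hmem : ∀ i : ℕ, i ≤ N → s + i * ((t - s) / N) ∈ Set.Icc s t := fun i hi => by
    have h1 : (i : ℝ) * ((t - s) / N) ≤ N * ((t - s) / N) := by gcongr
    rw [mul_div_cancel₀ _ hN.ne'] at h1
    have h2 : 0 ≤ i * ((t - s) / N) := by positivity
    constructor <;> linarith
  have h1 := hmem k (Finset.mem_range.1 hk).le
  have h2 := hmem (k + 1) (Finset.mem_range.1 hk)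
  push_cast at h2
  rw [hG _ h1, hU _ h1, hU _ h2]

lemma IsItoIntegral.congr {m n : ℕ} {G G' : ℝ → Ω → Mat m n} {U U' : ℝ → Ω → Vec n} {s t : ℝ}
    {I I' : Ω → Vec m} (h : IsItoIntegral μ G U s t I) (hst : s ≤ t)
    (hG : ∀ᵐ ω ∂μ, ∀ u ∈ Set.Icc s t, G u ω = G' u ω)
    (hU : ∀ ω, ∀ u ∈ Set.Icc s t, U u ω = U' u ω)
    (hI : ∀ ω, I ω = I' ω) : IsItoIntegral μ G' U' s t I' := by
  refine TendstoInMeasure.congr' (Eventually.of_forall fun N => ?_) (ae_of_all _ hI) h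
  filter_upwards [hG] with ω hω
  exact itoSum_congr hst hω (hU ω) N

/-- Splitting off the drift from the integrator. -/
lemma sum_act_increment_eq {G : ℝ → Mat r r'} {C : Mat r' r} {D : ℝ → Vec r'} {Z : ℝ → Vec r}
    (hZ : Continuous Z) (s δ : ℝ) (M : ℕ) :
    ∑ j ∈ Finset.range M, act (G (s + j * δ)) (D (s + (j + 1) * δ) - D (s + j * δ)) =
      ∑ j ∈ Finset.range M, act (G (s + j * δ))
        ((D (s + (j + 1) * δ) - ∫ w in s..(s + (j + 1) * δ), act C (Z w)) -
          (D (s + j * δ) - ∫ w in s..(s + j * δ), act C (Z w))) +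
      ∑ j ∈ Finset.range M, ∫ w in (s + j * δ)..(s + (j + 1) * δ),
        act (G (s + j * δ)) (act C (Z w)) := by
  have hc : Continuous fun w => act C (Z w) := continuous_const.act hZ
  rw [← Finset.sum_add_distrib]
  refine Finset.sum_congr rfl fun j _ => ?_
  have h1 : ∫ w in (s + j * δ)..(s + (j + 1) * δ), act (G (s + j * δ)) (act C (Z w)) =
      act (G (s + j * δ)) (∫ w in (s + j * δ)..(s + (j + 1) * δ), act C (Z w)) :=
    ContinuousLinearMap.intervalIntegral_comp_comm (actL r r' (G (s + j * δ)))
      (hc.intervalIntegrable _ _)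
  have h2 := intervalIntegral.integral_interval_sub_left
    (hc.intervalIntegrable s (s + (j + 1) * δ)) (hc.intervalIntegrable (μ := volume) s (s + j * δ))
  rw [h1, ← act_add_right, ← h2]
  congr 1
  abel

/-- Along a subsequence of the grids that refine the `n`-step grid, the Riemann sums of
`∫ G dD`, up to each of the times `s + k (t - s) / n`, converge almost surely. -/
theorem exists_subseq_tendsto_sum {A : Mat r r} {C : Mat r' r} {G : ℝ → Ω → Mat r r'}
    {D : ℝ → Ω → Vec r'} {Z N : ℝ → Ω → Vec r} {s t : ℝ} (hst : s ≤ t)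
    (hG : ∀ᵐ ω ∂μ, Continuous fun u => G u ω) (hZ : ∀ᵐ ω ∂μ, Continuous fun u => Z u ω)
    (hN : ∀ ω, N s ω = 0)
    (hsde : ∀ t' ∈ Set.Icc s t,
      IsItoIntegral μ G (fun u ω => D u ω - ∫ w in s..u, act C (Z w ω)) s t'
      (fun ω => Z t' ω - Z s ω - (∫ u in s..t', act A (Z u ω)) - N t' ω))
    (n : ℕ) {σ : ℕ → ℕ} (hσ : Tendsto σ atTop atTop) :
    ∃ ns : ℕ → ℕ, StrictMono ns ∧ ∀ᵐ ω ∂μ, ∀ k ≤ n, Tendsto (fun l =>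
      N (s + k * ((t - s) / n)) ω + ∑ j ∈ Finset.range (k * σ (ns l)),
        act (G (s + j * ((t - s) / n / σ (ns l))) ω)
          (D (s + (j + 1) * ((t - s) / n / σ (ns l))) ω - D (s + j * ((t - s) / n / σ (ns l))) ω))
      atTop (𝓝 (Z (s + k * ((t - s) / n)) ω - Z s ω -
        ∫ u in s..(s + k * ((t - s) / n)), act (A - G u ω * C) (Z u ω))) := by
  set h := (t - s) / n with hh
  have hh0 : 0 ≤ h := div_nonneg (by linarith) n.cast_nonneg
  have hle : ∀ k : ℕ, s ≤ s + k * h := fun k => by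
    have : 0 ≤ k * h := by positivity
    linarith
  have hmem : ∀ k : ℕ, k ≤ n → s + k * h ∈ Set.Icc s t := fun k hk => by
    refine ⟨hle k, ?_⟩
    rcases Nat.eq_zero_or_pos n with hn | hn
    · simp [hh, hn, hst]
    · have h1 : (k : ℝ) * h ≤ n * h := by gcongr
      rw [hh, mul_div_cancel₀ _ (by positivity : (n : ℝ) ≠ 0)] at h1
      linarith
  -- with `k σ` steps on `[s, s + k h]` all the grids have the step `h / σ`; for `k = 0`, where the
  -- interval is a point, the factor `1` keeps the number of steps unbounded
  have h1 : ∀ k ≤ n, TendstoInMeasure μ (fun l => itoSum G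
      (fun u ω => D u ω - ∫ w in s..u, act C (Z w ω)) s (s + k * h) (max k 1 * σ l)) atTop
      (fun ω => Z (s + k * h) ω - Z s ω -
        (∫ u in s..(s + k * h), act A (Z u ω)) - N (s + k * h) ω) := by
    intro k hk
    have := hsde _ (hmem k hk)
    exact this.comp ((tendsto_id.const_mul_atTop' (by positivity : 0 < max k 1)).comp hσ)
  obtain ⟨ns, hns, hae⟩ := exists_common_subseq_tendsto_ae n h1
  refine ⟨ns, hns, ?_⟩
  filter_upwards [hae, hG, hZ] with ω h2 hGω hZω k hk
  rcases k with _ | k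
  · simp [hN]
  have h3 := h2 (k + 1) hk
  rw [max_eq_left (Nat.le_add_left 1 k)] at h3
  have hstep : ∀ M : ℕ, (s + (k + 1 : ℕ) * h - s) / ((k + 1) * M : ℕ) = h / M := by
    intro M
    rw [add_sub_cancel_left, Nat.cast_mul]
    push_cast
    exact mul_div_mul_left _ _ (by positivity)
  simp only [itoSum, hstep] at h3
  have h4 := tendsto_sum_integral_frozen (F := fun u w => act (G u ω) (act C (Z w ω)))
    ((hGω.comp continuous_fst).act (continuous_const.act (hZω.comp continuous_snd))) (hle (k + 1))
  have h5 := h4.comp ((tendsto_id.const_mul_atTop' (Nat.succ_pos k)).comp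
    (hσ.comp hns.tendsto_atTop))
  simp only [Function.comp_def, id, Nat.succ_eq_add_one, hstep] at h5
  have h6 := (h3.add h5).const_add (N (s + (k + 1 : ℕ) * h) ω)
  have hAc : Continuous fun u => act A (Z u ω) := continuous_const.act hZω
  have hGc : Continuous fun u => act (G u ω) (act C (Z u ω)) :=
    hGω.act (continuous_const.act hZω)
  have h7 : ∫ u in s..(s + (k + 1 : ℕ) * h), act (A - G u ω * C) (Z u ω) =
      (∫ u in s..(s + (k + 1 : ℕ) * h), act A (Z u ω)) -
        ∫ u in s..(s + (k + 1 : ℕ) * h), act (G u ω) (act C (Z u ω)) := by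
    rw [← intervalIntegral.integral_sub (hAc.intervalIntegrable _ _)
      (hGc.intervalIntegrable _ _)]
    simp only [act_sub_left, act_mul]
  have h8 : Z (s + (k + 1 : ℕ) * h) ω - Z s ω -
      ∫ u in s..(s + (k + 1 : ℕ) * h), act (A - G u ω * C) (Z u ω) =
      N (s + (k + 1 : ℕ) * h) ω + ((Z (s + (k + 1 : ℕ) * h) ω - Z s ω -
        ∫ u in s..(s + (k + 1 : ℕ) * h), act A (Z u ω)) - N (s + (k + 1 : ℕ) * h) ω +
        ∫ w in s..(s + (k + 1 : ℕ) * h), act (G w ω) (act C (Z w ω))) := by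
    rw [h7]
    abel
  rw [h8]
  refine h6.congr fun l => ?_
  rw [sum_act_increment_eq (G := fun u => G u ω) (D := fun u => D u ω) (Z := fun u => Z u ω)
    (C := C) hZω]

end RiemannSums

/-! ### The conditional characteristic function of the diffusion -/

section ConditionalCharFun

/-- On a fixed coarse grid, the covariances with Riemann sums as sources converge to those with the
exact integrals. -/
lemma tendsto_eulerCov_sum {r : ℕ} {Ξ : ℝ → Mat r r} (hΞ : Continuous Ξ) (T : ℕ → Mat r r)
    (Q : Mat r r) {s h : ℝ} (hh : 0 ≤ h) (n : ℕ) :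
    Tendsto (fun m : ℕ => eulerCov T Q (fun k => (h / m) • ∑ j ∈ Finset.range (k * m),
      Ξ (s + j * (h / m))) n) atTop
      (𝓝 (eulerCov T Q (fun k => ∫ u in s..(s + k * h), Ξ u) n)) := by
  refine tendsto_eulerCov T Q fun k _ => ?_
  rcases Nat.eq_zero_or_pos k with rfl | hk
  · simp
  have hle : s ≤ s + k * h := by
    have : 0 ≤ k * h := by positivity
    linarith
  have h1 := tendsto_sum_integral_frozen (F := fun u _ => Ξ u) (hΞ.comp continuous_fst) hle
  have h2 := h1.comp (tendsto_id.const_mul_atTop' hk)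
  refine h2.congr fun m => ?_
  have hstep : (s + k * h - s) / (k * m : ℕ) = h / m := by
    rw [add_sub_cancel_left, Nat.cast_mul]
    exact mul_div_mul_left _ _ (by positivity)
  simp only [Function.comp, id, hstep, intervalIntegral.integral_const]
  rw [Finset.smul_sum]
  refine Finset.sum_congr rfl fun j _ => ?_
  congr 1
  ring

variable {Ω : Type*} [mΩ : MeasurableSpace Ω] {μ : Measure Ω} {β : Type*} [mβ : MeasurableSpace β]

/-- The conditional characteristic function, given the observation, of the Euler scheme with the
exact increments replaced by Riemann sums on a grid `m` times finer. -/
lemma condExp_exp_grid [IsProbabilityMeasure μ] {r r' : ℕ} {A R : Mat r r} {C : Mat r' r}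
    {Sig : Mat r' r'} (hR : R.PosSemidef) (hSig : Sig.PosSemidef)
    {Wb : ℝ → Ω → Vec r} {Vb : ℝ → Ω → Vec r'} {Z₀ : Ω → Vec r} {x : Vec r} {Q : Mat r r}
    (hQ : Q.PosSemidef) (hW : IsBrownian Wb μ) (hV : IsBrownian Vb μ)
    (hWV : IndepFun (path Wb) (path Vb) μ) (hZ : Measurable Z₀)
    (hlaw : HasLaw Z₀ (multivariateGaussian x Q) μ)
    (hind : IndepFun Z₀ (fun ω => (path Wb ω, path Vb ω)) μ)
    {O : Ω → β} (hO : Measurable O)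
    (hOind : IndepFun O (fun ω => (Z₀ ω, path Wb ω, path Vb ω)) μ)
    {Y : ℝ → Ω → Vec r'} {G : ℝ → Ω → Mat r r'}
    (hY : ∀ u, ∃ y : β → Vec r', StronglyMeasurable y ∧ ∀ᵐ ω ∂μ, Y u ω = y (O ω))
    (hG : ∀ u, ∃ g : β → Mat r r', StronglyMeasurable g ∧ ∀ᵐ ω ∂μ, G u ω = g (O ω))
    {s h : ℝ} (hs : 0 ≤ s) (hh : 0 ≤ h) (n : ℕ) {m : ℕ} (hm : 1 ≤ m) (u : Vec r) :
    ∃ f : Ω → ℂ, AEStronglyMeasurable f μ ∧ (∀ ω, ‖f ω‖ ≤ 1) ∧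
      (∀ᵐ ω ∂μ, f ω = Complex.exp ((inner ℝ u (eulerPath (eulerStep (fun u => A - G u ω * C) s h)
        (Z₀ ω) (fun k => act (CFC.sqrt R) (Wb (s + k * h) ω - Wb s ω) +
          ∑ j ∈ Finset.range (k * m), act (G (s + j * (h / m)) ω)
            ((Y (s + (j + 1) * (h / m)) ω - act (CFC.sqrt Sig) (Vb (s + (j + 1) * (h / m)) ω)) -
            (Y (s + j * (h / m)) ω - act (CFC.sqrt Sig) (Vb (s + j * (h / m)) ω)))) n) : ℝ) *
          Complex.I)) ∧
      ∀ᵐ ω ∂μ, (μ[f | mβ.comap O]) ω =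
        Complex.exp ((inner ℝ u (eulerPath (eulerStep (fun u => A - G u ω * C) s h) x (fun k =>
          ∑ j ∈ Finset.range (k * m), act (G (s + j * (h / m)) ω)
            (Y (s + (j + 1) * (h / m)) ω - Y (s + j * (h / m)) ω)) n) : ℝ) * Complex.I) *
        Complex.exp (-((inner ℝ u (act (eulerCov (eulerStep (fun u => A - G u ω * C) s h) Q
          (fun k => (h / m) • ∑ j ∈ Finset.range (k * m),
            (R + G (s + j * (h / m)) ω * Sig * (G (s + j * (h / m)) ω)ᵀ)) n) u)) / 2 : ℝ)) := by
  choose y hym hy using hY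
  choose g hgm hg using hG
  have hδ : 0 ≤ h / m := by positivity
  obtain ⟨h1, h2⟩ := condExp_exp_eulerPath hR hSig hQ hW hV hWV hZ hlaw hind hO hOind hs hδ m n
    (T := fun o => eulerStep (fun u => A - g u o * C) s h)
    (fun k => by
      have hc : Continuous fun M : Mat r r' => (1 : Mat r r) + h • (A - M * C) := by fun_prop
      have := hc.comp_stronglyMeasurable (hgm (s + k * h))
      exact this)
    (g := fun o j => g (s + j * (h / m)) o) (fun j => hgm _)
    (y := fun o j => y (s + (j + 1) * (h / m)) o - y (s + j * (h / m)) o)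
    (fun j => (hym _).sub (hym _)) u
  have hT : ∀ᵐ ω ∂μ, eulerStep (fun u => A - g u (O ω) * C) s h =
      eulerStep (fun u => A - G u ω * C) s h := by
    filter_upwards [ae_all_iff.2 fun k : ℕ => hg (s + k * h)] with ω hω
    funext k
    simp only [eulerStep, hω k]
  have hg' := ae_all_iff.2 fun j : ℕ => hg (s + j * (h / m))
  have hy1 := ae_all_iff.2 fun j : ℕ => hy (s + j * (h / m))
  have hy2 := ae_all_iff.2 fun j : ℕ => hy (s + (j + 1) * (h / m))
  refine ⟨_, h1, fun ω => (Complex.norm_exp_ofReal_mul_I _).le, ?_, ?_⟩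
  · filter_upwards [hT, hg', hy1, hy2] with ω hTω hgω hy1ω hy2ω
    rw [hTω]
    simp only [← hgω, ← hy1ω, ← hy2ω]
    congr 6
    funext k
    rw [Finset.sum_add_distrib]
    congr 1
    · -- the increments of the Brownian motion telescope
      have h3 := Finset.sum_range_sub (fun j : ℕ => act (CFC.sqrt R) (Wb (s + j * (h / m)) ω))
        (k * m)
      have h4 : s + (k * m : ℕ) * (h / m) = s + k * h := by
        have : (m : ℝ) ≠ 0 := by positivity
        push_cast
        field_simp
      rw [h4] at h3
      simp only [act_sub_right]
      simpa using h3
    · refine Finset.sum_congr rfl fun j _ => ?_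
      congr 1
      rw [act_sub_right]
      abel
  · filter_upwards [h2, hT, hg', hy1, hy2] with ω h2ω hTω hgω hy1ω hy2ω
    rw [h2ω, hTω]
    simp only [← hgω, ← hy1ω, ← hy2ω]

/-- The conditional characteristic function of the diffusion given the observation, seen through a
multiplicative map `Φ` that is the identity on the positive reals. The covariance part of the
exponent is the solution `p` of the Lyapunov equation along the gain `G`; the mean part `χ` is the
limit of the means of the Euler schemes.

Two choices of `Φ` matter: the modulus, for which `χ = 1` and nothing need be known of the means,
and the identity, once a filter with gain `G` is given. -/
theorem condExp_exp_diffusion [IsProbabilityMeasure μ] {r r' : ℕ} {A R : Mat r r} {C : Mat r' r}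
    {Sig : Mat r' r'} (hR : R.PosSemidef) (hSig : Sig.PosSemidef)
    {Wb : ℝ → Ω → Vec r} {Vb : ℝ → Ω → Vec r'} {Z : ℝ → Ω → Vec r} {x : Vec r} {Q : Mat r r}
    {s t : ℝ} (hs : 0 ≤ s) (hst : s ≤ t)
    (hQ : Q.PosSemidef) (hW : IsBrownian Wb μ) (hV : IsBrownian Vb μ)
    (hWV : IndepFun (path Wb) (path Vb) μ) (hZs : Measurable (Z s))
    (hlaw : HasLaw (Z s) (multivariateGaussian x Q) μ)
    (hind : IndepFun (Z s) (fun ω => (path Wb ω, path Vb ω)) μ)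
    {O : Ω → β} (hO : Measurable O)
    (hOind : IndepFun O (fun ω => (Z s ω, path Wb ω, path Vb ω)) μ)
    {Y : ℝ → Ω → Vec r'} {G : ℝ → Ω → Mat r r'}
    (hY : ∀ u, ∃ y : β → Vec r', StronglyMeasurable y ∧ ∀ᵐ ω ∂μ, Y u ω = y (O ω))
    (hG : ∀ u, ∃ g : β → Mat r r', StronglyMeasurable g ∧ ∀ᵐ ω ∂μ, G u ω = g (O ω))
    (hGc : ∀ᵐ ω ∂μ, Continuous fun u => G u ω) (hZc : ∀ᵐ ω ∂μ, Continuous fun u => Z u ω)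
    (hsde : ∀ t' ∈ Set.Icc s t, IsItoIntegral μ G (fun u ω =>
      (Y u ω - act (CFC.sqrt Sig) (Vb u ω)) - ∫ w in s..u, act C (Z w ω)) s t'
      (fun ω => Z t' ω - Z s ω - (∫ u in s..t', act A (Z u ω)) -
        act (CFC.sqrt R) (Wb t' ω - Wb s ω))) (u : Vec r)
    {Φ : ℂ →* ℂ} (hΦ : Continuous Φ) (hΦr : ∀ a : ℝ, Φ (Complex.exp a) = Complex.exp a)
    {χn : ℕ → Ω → ℂ} {χ : Ω → ℂ}
    (hχn : ∀ (n : ℕ) (σ : ℕ → ℕ), Tendsto σ atTop atTop → ∃ ns : ℕ → ℕ, StrictMono ns ∧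
      ∀ᵐ ω ∂μ, Tendsto (fun l => Φ (Complex.exp ((inner ℝ u
        (eulerPath (eulerStep (fun u => A - G u ω * C) s ((t - s) / n)) x (fun k =>
          ∑ j ∈ Finset.range (k * σ (ns l)), act (G (s + j * ((t - s) / n / σ (ns l))) ω)
            (Y (s + (j + 1) * ((t - s) / n / σ (ns l))) ω -
              Y (s + j * ((t - s) / n / σ (ns l))) ω)) n) : ℝ) * Complex.I)))
        atTop (𝓝 (χn n ω)))
    (hχ : ∀ᵐ ω ∂μ, Tendsto (fun n => χn n ω) atTop (𝓝 (χ ω))) :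
    ∀ᵐ ω ∂μ, ∀ p : ℝ → Mat r r, Continuous p → p s = Q → (∀ τ ∈ Set.Icc s t,
      HasDerivWithinAt p (lyap (A - G τ ω * C) (p τ) + (R + G τ ω * Sig * (G τ ω)ᵀ))
        (Set.Icc s t) τ) →
      Φ ((μ[fun ω => Complex.exp ((inner ℝ u (Z t ω) : ℝ) * Complex.I) | mβ.comap O]) ω) =
        χ ω * Complex.exp (-(inner ℝ u (act (p t) u) / 2 : ℝ)) := by
  have hle : mβ.comap O ≤ mΩ := hO.comap_le
  -- the limit of the fine grids, for a fixed coarse grid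
  have key : ∀ n : ℕ, ∃ f : Ω → ℂ, AEStronglyMeasurable f μ ∧ (∀ ω, ‖f ω‖ ≤ 1) ∧
      (∀ ω, f ω = Complex.exp ((inner ℝ u (eulerPath (eulerStep (fun u => A - G u ω * C) s
        ((t - s) / n)) (Z s ω) (fun k => Z (s + k * ((t - s) / n)) ω - Z s ω -
          ∫ u in s..(s + k * ((t - s) / n)), act (A - G u ω * C) (Z u ω)) n) : ℝ) * Complex.I)) ∧
      ∀ᵐ ω ∂μ, Φ ((μ[f | mβ.comap O]) ω) = χn n ω *
        Complex.exp (-((inner ℝ u (act (eulerCov (eulerStep (fun u => A - G u ω * C) s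
          ((t - s) / n)) Q (fun k => ∫ u in s..(s + k * ((t - s) / n)),
            (R + G u ω * Sig * (G u ω)ᵀ)) n) u)) / 2 : ℝ)) := by
    intro n
    have hh : 0 ≤ (t - s) / n := div_nonneg (by linarith) n.cast_nonneg
    obtain ⟨ns, hns, hconv⟩ := exists_subseq_tendsto_sum (μ := μ) (A := A) (C := C) (G := G)
      (D := fun u ω => Y u ω - act (CFC.sqrt Sig) (Vb u ω)) (Z := Z)
      (N := fun u ω => act (CFC.sqrt R) (Wb u ω - Wb s ω)) hst hGc hZc (by simp) hsde n
      (tendsto_add_atTop_nat 1)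
    obtain ⟨ms, hms, hmean⟩ := hχn n (fun l => ns l + 1)
      ((tendsto_add_atTop_nat 1).comp hns.tendsto_atTop)
    have hσ : Tendsto (fun l => ns (ms l) + 1) atTop atTop :=
      (tendsto_add_atTop_nat 1).comp (hns.tendsto_atTop.comp hms.tendsto_atTop)
    choose f hfm hfb hf hE using fun l => condExp_exp_grid (A := A) (C := C) hR hSig hQ hW hV hWV
      hZs hlaw hind hO hOind hY hG hs hh n (m := ns (ms l) + 1) (by omega) u
    have hlim : ∀ᵐ ω ∂μ, Tendsto (fun l => f l ω) atTop (𝓝 (Complex.exp ((inner ℝ u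
        (eulerPath (eulerStep (fun u => A - G u ω * C) s
        ((t - s) / n)) (Z s ω) (fun k => Z (s + k * ((t - s) / n)) ω - Z s ω -
          ∫ u in s..(s + k * ((t - s) / n)), act (A - G u ω * C) (Z u ω)) n) : ℝ) *
            Complex.I))) := by
      filter_upwards [hconv, ae_all_iff.2 hf] with ω h1 h2
      simp only [h2]
      have h3 := tendsto_eulerPath (eulerStep (fun u => A - G u ω * C) s ((t - s) / n)) (Z s ω)
        (fun k hk => (h1 k hk).comp hms.tendsto_atTop)
      have h4 : Continuous fun x : Vec r => Complex.exp ((inner ℝ u x : ℝ) * Complex.I) := by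
        fun_prop
      exact (h4.tendsto _).comp h3
    refine ⟨_, aestronglyMeasurable_of_tendsto_ae atTop hfm hlim,
      fun ω => (Complex.norm_exp_ofReal_mul_I _).le, fun ω => rfl, ?_⟩
    refine condExp_limit hfm hle hfb hlim hΦ (g := fun l ω => Φ ((μ[f l | mβ.comap O]) ω)) ?_
      fun l => ae_of_all _ fun ω => rfl
    filter_upwards [hmean, ae_all_iff.2 hE, hGc] with ω h1 h2 h3
    simp only [h2, map_mul, hΦr, ← Complex.ofReal_neg]
    refine h1.mul ?_
    have hΞ : Continuous fun τ => R + G τ ω * Sig * (G τ ω)ᵀ := by fun_prop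
    have h4 := (tendsto_eulerCov_sum hΞ (eulerStep (fun u => A - G u ω * C) s ((t - s) / n)) Q
      (s := s) hh n).comp hσ
    have h5 : Continuous fun M : Mat r r =>
        Complex.exp (((-(inner ℝ u (act M u) / 2) : ℝ)) : ℂ) := by
      have : Continuous fun M : Mat r r => act M u := continuous_id.act continuous_const
      fun_prop
    exact (h5.tendsto _).comp h4
  choose f hfm hfb hf hE using key
  -- the limit of the coarse grids
  have hlim : ∀ᵐ ω ∂μ, Tendsto (fun n => f n ω) atTop
      (𝓝 (Complex.exp ((inner ℝ u (Z t ω) : ℝ) * Complex.I))) := by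
    filter_upwards [hGc, hZc] with ω h1 h2
    simp only [hf]
    have h3 := tendsto_eulerPath_solution (B := fun u => A - G u ω * C) (by fun_prop) h2 hst
    have h4 : Continuous fun x : Vec r => Complex.exp ((inner ℝ u x : ℝ) * Complex.I) := by
      fun_prop
    exact (h4.tendsto _).comp h3
  have hex : ∀ ω, ∃ p : ℝ → Mat r r, (Continuous fun u => G u ω) → (Continuous p ∧ p s = Q ∧
      ∀ τ ∈ Set.Icc s t, HasDerivWithinAt p (lyap (A - G τ ω * C) (p τ) +
        (R + G τ ω * Sig * (G τ ω)ᵀ)) (Set.Icc s t) τ) := by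
    intro ω
    by_cases hc : Continuous fun u => G u ω
    · obtain ⟨p, hp⟩ := exists_lyapunov_solution (B := fun u => A - G u ω * C)
        (Ξ := fun τ => R + G τ ω * Sig * (G τ ω)ᵀ) (by fun_prop) (by fun_prop) hst Q
      exact ⟨p, fun _ => hp⟩
    · exact ⟨0, fun h => absurd h hc⟩
  have hcov : ∀ᵐ ω ∂μ, ∀ p : ℝ → Mat r r, Continuous p → p s = Q → (∀ τ ∈ Set.Icc s t,
      HasDerivWithinAt p (lyap (A - G τ ω * C) (p τ) + (R + G τ ω * Sig * (G τ ω)ᵀ))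
        (Set.Icc s t) τ) →
      Tendsto (fun n : ℕ => Complex.exp (-((inner ℝ u (act (eulerCov
        (eulerStep (fun u => A - G u ω * C) s ((t - s) / n)) Q
        (fun k => ∫ u in s..(s + k * ((t - s) / n)), (R + G u ω * Sig * (G u ω)ᵀ)) n) u)) / 2 :
          ℝ))) atTop (𝓝 (Complex.exp (-(inner ℝ u (act (p t) u) / 2 : ℝ)))) := by
    filter_upwards [hGc] with ω h1 p hpc hps hp
    have h2 := tendsto_eulerCov_solution (B := fun u => A - G u ω * C)
      (Ξ := fun τ => R + G τ ω * Sig * (G τ ω)ᵀ) (by fun_prop) (by fun_prop) hst hpc hp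
    rw [hps] at h2
    have h5 : Continuous fun M : Mat r r =>
        Complex.exp (-((inner ℝ u (act M u) / 2 : ℝ) : ℂ)) := by
      have : Continuous fun M : Mat r r => act M u := continuous_id.act continuous_const
      fun_prop
    exact (h5.tendsto _).comp h2
  choose p hp using hex
  have hmain := condExp_limit hfm hle hfb hlim hΦ
    (g := fun n ω => Φ ((μ[f n | mβ.comap O]) ω))
    (g₀ := fun ω => χ ω * Complex.exp (-(inner ℝ u (act (p ω t) u) / 2 : ℝ))) (by
      filter_upwards [hχ, hcov, hGc, ae_all_iff.2 hE] with ω h1 h2 h3 h4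
      obtain ⟨h5, h6, h7⟩ := hp ω h3
      simp only [h4]
      exact h1.mul (h2 (p ω) h5 h6 h7)) fun n => ae_of_all _ fun ω => rfl
  filter_upwards [hmain, hcov, hGc] with ω h1 h2 h3 q hqc hqs hq
  obtain ⟨h5, h6, h7⟩ := hp ω h3
  rw [h1, tendsto_nhds_unique (h2 (p ω) h5 h6 h7) (h2 q hqc hqs hq)]

end ConditionalCharFun

/-! ### Covariance matrices and characteristic functions -/

section Covariance

lemma isClosed_posSemidef {r : ℕ} : IsClosed {M : Mat r r | M.PosSemidef} := by
  have h : {M : Mat r r | M.PosSemidef} = {M : Mat r r | Mᴴ = M} ∩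
      ⋂ x : Fin r → ℝ, {M : Mat r r | 0 ≤ star x ⬝ᵥ M *ᵥ x} := by
    ext M
    simp [Matrix.posSemidef_iff_dotProduct_mulVec, Matrix.IsHermitian]
  rw [h]
  refine (isClosed_eq (by fun_prop) continuous_id).inter (isClosed_iInter fun x => ?_)
  have hc : Continuous fun M : Mat r r => star x ⬝ᵥ M *ᵥ x := by
    refine Continuous.dotProduct continuous_const ?_
    exact continuous_id.matrix_mulVec continuous_const
  exact isClosed_le continuous_const hc

/-- A continuous self-map of the cone extends to the space of matrices. -/
lemma exists_continuous_extension {r : ℕ} (π : C(PSD r, PSD r)) :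
    ∃ F : Mat r r → Mat r r, Continuous F ∧ ∀ Q : PSD r, F Q.1 = (π Q).1 := by
  have he : IsClosedEmbedding (Subtype.val : PSD r → Mat r r) :=
    isClosed_posSemidef.isClosedEmbedding_subtypeVal
  have hN : NormalSpace (Mat r r) :=
    (inferInstance : NormalSpace (Fin r → Fin r → ℝ))
  have hT : TietzeExtension.{0, 0} (Mat r r) :=
    (inferInstance : TietzeExtension.{0, 0} (Fin r → Fin r → ℝ))
  obtain ⟨F, hF⟩ := ContinuousMap.exists_extension' he
    (⟨fun Q => (π Q).1, by fun_prop⟩ : C(PSD r, Mat r r))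
  exact ⟨F, F.continuous, fun Q => congrFun hF Q⟩

lemma stronglyMeasurable_covMatrix {α : Type*} [MeasurableSpace α] {r : ℕ}
    (κ : Kernel α (Vec r)) [IsMarkovKernel κ] :
    StronglyMeasurable fun a => covMatrix (κ a) := by
  have hx : ∀ i, StronglyMeasurable fun x : Vec r => x i := fun i =>
    (by fun_prop : Continuous fun x : Vec r => x i).stronglyMeasurable
  have hentry : ∀ i j, StronglyMeasurable fun a => covMatrix (κ a) i j := by
    intro i j
    have h1 : ∀ k, StronglyMeasurable fun p : α × Vec r => p.2 k - ∫ x, x k ∂κ p.1 := fun k =>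
      ((hx k).comp_measurable measurable_snd).sub
        (((hx k).integral_kernel (κ := κ)).comp_measurable measurable_fst)
    have h2 := ((h1 i).mul (h1 j)).integral_kernel_prod_right' (κ := κ)
    exact h2
  have hsum : (fun a => covMatrix (κ a)) =
      fun a => ∑ i, ∑ j, covMatrix (κ a) i j • Matrix.single i j (1 : ℝ) := by
    funext a
    conv_lhs => rw [Matrix.matrix_eq_sum_single (covMatrix (κ a))]
    simp [Matrix.smul_single]
  rw [hsum]
  exact Finset.stronglyMeasurable_fun_sum _ fun i _ => Finset.stronglyMeasurable_fun_sum _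
    fun j _ => (hentry i j).smul_const _

lemma inner_act_nonneg_iff {r : ℕ} {M : Mat r r} :
    (∀ u, 0 ≤ inner ℝ u (act M u)) ↔ ∀ x : Fin r → ℝ, 0 ≤ x ⬝ᵥ M *ᵥ x := by
  simp only [inner_act_eq_dotProduct]
  exact ⟨fun h x => h (WithLp.toLp 2 x), fun h u => h _⟩

lemma posSemidef_iff_inner_act {r : ℕ} {M : Mat r r} :
    M.PosSemidef ↔ M.IsSymm ∧ ∀ u, 0 ≤ inner ℝ u (act M u) := by
  rw [inner_act_nonneg_iff, Matrix.posSemidef_iff_dotProduct_mulVec, Matrix.IsHermitian,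
    Matrix.conjTranspose_eq_transpose_of_trivial]
  simp [Matrix.IsSymm]

/-- A law whose characteristic function has a Gaussian modulus has the corresponding covariance:
the law of the difference of two independent copies is Gaussian. -/
theorem covMatrix_eq_of_norm_charFun {r : ℕ} {η : Measure (Vec r)} [IsProbabilityMeasure η]
    {P : Mat r r} (hP : P.IsSymm)
    (h : ∀ u, ‖charFun η u‖ = Real.exp (-(inner ℝ u (act P u) / 2))) : covMatrix η = P := by
  have hPSD : P.PosSemidef := by
    refine posSemidef_iff_inner_act.2 ⟨hP, fun u => ?_⟩
    have h1 := norm_charFun_le_one (μ := η) u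
    rw [h u, Real.exp_le_one_iff] at h1
    linarith
  have h2P : ((2 : ℝ) • P).PosSemidef := hPSD.smul (by norm_num)
  let D : Vec r × Vec r → Vec r := fun p => p.1 - p.2
  have hD : Measurable D := by fun_prop
  have hmap : (η.prod η).map D = multivariateGaussian 0 ((2 : ℝ) • P) := by
    have := Measure.isProbabilityMeasure_map (μ := η.prod η) hD.aemeasurable
    refine Measure.ext_of_charFun (funext fun u => ?_)
    rw [charFun_multivariateGaussian h2P, ← inner_act_eq_dotProduct, act_smul_left,
      inner_smul_right, charFun_apply, integral_map hD.aemeasurable (by fun_prop)]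
    have h1 : ∀ p : Vec r × Vec r, Complex.exp ((inner ℝ (D p) u : ℝ) * Complex.I) =
        Complex.exp ((inner ℝ p.1 u : ℝ) * Complex.I) *
          Complex.exp ((inner ℝ p.2 (-u) : ℝ) * Complex.I) := by
      intro p
      rw [← Complex.exp_add]
      simp only [D, inner_sub_left, inner_neg_right]
      congr 1
      push_cast
      ring
    simp only [h1]
    rw [integral_prod_mul (fun x : Vec r => Complex.exp ((inner ℝ x u : ℝ) * Complex.I))
      (fun x : Vec r => Complex.exp ((inner ℝ x (-u) : ℝ) * Complex.I)), ← charFun_apply,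
      ← charFun_apply, charFun_neg, Complex.mul_conj, Complex.normSq_eq_norm_sq, h u,
      ← Real.exp_nat_mul]
    simp only [inner_zero_right, Complex.ofReal_exp]
    congr 1
    push_cast
    ring
  have hxm : ∀ i, AEStronglyMeasurable (fun x : Vec r => x i) η := fun i =>
    (by fun_prop : Continuous fun x : Vec r => x i).aestronglyMeasurable
  have hmem : ∀ i, MemLp (fun p : Vec r × Vec r => p.1 i - p.2 i) 2 (η.prod η) := by
    intro i
    have h1 : MemLp (fun x : Vec r => x i) 2 ((η.prod η).map D) := by
      rw [hmap]
      have h2 : MemLp (fun x : Vec r => x) 2 (multivariateGaussian 0 ((2 : ℝ) • P)) :=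
        IsGaussian.memLp_two_id
      exact (EuclideanSpace.proj (𝕜 := ℝ) i : Vec r →L[ℝ] ℝ).comp_memLp' h2
    exact h1.comp_of_map hD.aemeasurable
  -- a coordinate of `η` is square integrable: freeze the second copy
  have hmem' : ∀ i, MemLp (fun x : Vec r => x i) 2 η := by
    intro i
    have h1 := (memLp_two_iff_integrable_sq (hmem i).1).1 (hmem i)
    have h2 := h1.prod_left_ae
    obtain ⟨y, hy⟩ := h2.exists
    have h3 : MemLp (fun x : Vec r => x i - y i) 2 η := by
      refine (memLp_two_iff_integrable_sq ?_).2 hy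
      exact (hxm i).sub aestronglyMeasurable_const
    have h4 := h3.add (memLp_const (y i))
    refine h4.congr_norm (hxm i) (ae_of_all _ fun x => ?_)
    simp
  ext i j
  have h1 := covariance_eval_multivariateGaussian (μ := (0 : Vec r)) h2P i j
  rw [← hmap, covariance_map_fun (by fun_prop) (by fun_prop) hD.aemeasurable] at h1
  have h2 := covariance_fun_sub_fun_sub (μ := η.prod η) (X := fun p => p.1 i)
    (Y := fun p => p.2 i) (Z := fun p => p.1 j) (T := fun p => p.2 j)
    ((hmem' i).comp_fst η) ((hmem' i).comp_snd η) ((hmem' j).comp_fst η) ((hmem' j).comp_snd η)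
  have h3 : ∀ i j, covariance (fun p : Vec r × Vec r => p.1 i) (fun p => p.1 j) (η.prod η) =
      covMatrix η i j := by
    intro i j
    have := covariance_map_fun (μ := η.prod η) (Z := Prod.fst) (X := fun x : Vec r => x i)
      (Y := fun x : Vec r => x j) (by fun_prop) (by fun_prop) measurable_fst.aemeasurable
    rw [← this, Measure.map_fst_prod]
    simp [covMatrix]
  have h4 : ∀ i j, covariance (fun p : Vec r × Vec r => p.2 i) (fun p => p.2 j) (η.prod η) =
      covMatrix η i j := by
    intro i j
    have := covariance_map_fun (μ := η.prod η) (Z := Prod.snd) (X := fun x : Vec r => x i)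
      (Y := fun x : Vec r => x j) (by fun_prop) (by fun_prop) measurable_snd.aemeasurable
    rw [← this, Measure.map_snd_prod]
    simp [covMatrix]
  have h5 := covariance_fst_snd_prod (hmem' i) (hmem' j)
  have h6 := covariance_fst_snd_prod (hmem' j) (hmem' i)
  rw [covariance_comm] at h6
  have h7 : covariance (fun p : Vec r × Vec r => p.1 i - p.2 i) (fun p => p.1 j - p.2 j)
      (η.prod η) = 2 * P i j := by
    simpa [D, Matrix.smul_apply] using h1
  rw [h2, h3, h4, h5, h6] at h7
  linarith

lemma isSymm_eulerCov {r : ℕ} {T : ℕ → Mat r r} {Q : Mat r r} {θ : ℕ → Mat r r} (hQ : Q.IsSymm)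
    (hθ : ∀ k, (θ k).IsSymm) (k : ℕ) : (eulerCov T Q θ k).IsSymm := by
  induction k with
  | zero => exact hQ
  | succ k ih =>
    rw [eulerCov, Matrix.IsSymm]
    simp only [Matrix.transpose_add, Matrix.transpose_sub, Matrix.transpose_mul,
      Matrix.transpose_transpose, ih.eq, (hθ _).eq, Matrix.mul_assoc]

lemma isSymm_of_tendsto {r : ℕ} {M : ℕ → Mat r r} {M₀ : Mat r r} (h : Tendsto M atTop (𝓝 M₀))
    (hM : ∀ n, (M n).IsSymm) : M₀.IsSymm := by
  have hc : IsClosed {M : Mat r r | Mᵀ = M} :=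
    isClosed_eq (by fun_prop) continuous_id
  exact hc.mem_of_tendsto h (Eventually.of_forall hM)

/-- Solutions of the Lyapunov equation inherit symmetry from the covariances of the Euler scheme. -/
lemma isSymm_lyapunov_solution {r : ℕ} {B Ξ : ℝ → Mat r r} (hB : Continuous B) (hΞ : Continuous Ξ)
    (hsymm : ∀ u, (Ξ u).IsSymm) {s t : ℝ} (hst : s ≤ t) {p : ℝ → Mat r r} (hp : Continuous p)
    (hps : (p s).IsSymm) (hp' : ∀ u ∈ Set.Icc s t,
      HasDerivWithinAt p (lyap (B u) (p u) + Ξ u) (Set.Icc s t) u) : (p t).IsSymm := by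
  refine isSymm_of_tendsto (tendsto_eulerCov_solution hB hΞ hst hp hp') fun n =>
    isSymm_eulerCov hps (fun k => ?_) n
  have h : (∫ u in s..(s + k * ((t - s) / n)), Ξ u)ᵀ =
      ∫ u in s..(s + k * ((t - s) / n)), (Ξ u)ᵀ :=
    ((Matrix.transposeLinearEquiv (Fin r) (Fin r) ℝ ℝ).toLinearMap.toContinuousLinearMap
      |>.intervalIntegral_comp_comm (hΞ.intervalIntegrable _ _)).symm
  rw [Matrix.IsSymm, h]
  simp only [(hsymm _).eq]

end Covariance

/-! ### The conditional law of the diffusion along an observable gain -/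

section ConditionalLaw

variable {Ω : Type*} [mΩ : MeasurableSpace Ω] {μ : Measure Ω} {β : Type*} [mβ : MeasurableSpace β]
  {r r' : ℕ}

/-- A diffusion `dZ = A Z dt + R^{1/2} dW + G [dY - (C Z dt + Σ^{1/2} dV)]` on `[s, t]`, started
from the Gaussian law of mean `x` and covariance `Q`, whose gain `G` and driving path `Y` are
functions of an observation `O` that is independent of the noise. -/
structure IsGainDiffusion (A R : Mat r r) (C : Mat r' r) (Sig : Mat r' r') (μ : Measure Ω)
    (Wb : ℝ → Ω → Vec r) (Vb : ℝ → Ω → Vec r') (Z : ℝ → Ω → Vec r) (x : Vec r) (Q : Mat r r)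
    (s t : ℝ) (O : Ω → β) (Y : ℝ → Ω → Vec r') (G : ℝ → Ω → Mat r r') : Prop where
  nonneg : 0 ≤ s
  le : s ≤ t
  posSemidef : Q.PosSemidef
  brownianW : IsBrownian Wb μ
  brownianV : IsBrownian Vb μ
  indepWV : IndepFun (path Wb) (path Vb) μ
  measurable_init : Measurable (Z s)
  measurable : Measurable (Z t)
  init : HasLaw (Z s) (multivariateGaussian x Q) μ
  indepInit : IndepFun (Z s) (fun ω => (path Wb ω, path Vb ω)) μ
  measurable_obs : Measurable O
  indepObs : IndepFun O (fun ω => (Z s ω, path Wb ω, path Vb ω)) μ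
  driver : ∀ u, ∃ y : β → Vec r', StronglyMeasurable y ∧ ∀ᵐ ω ∂μ, Y u ω = y (O ω)
  gain : ∀ u, ∃ g : β → Mat r r', StronglyMeasurable g ∧ ∀ᵐ ω ∂μ, G u ω = g (O ω)
  cont_gain : ∀ᵐ ω ∂μ, Continuous fun u => G u ω
  cont : ∀ᵐ ω ∂μ, Continuous fun u => Z u ω
  sde : ∀ t' ∈ Set.Icc s t, IsItoIntegral μ G (fun u ω =>
    (Y u ω - act (CFC.sqrt Sig) (Vb u ω)) - ∫ w in s..u, act C (Z w ω)) s t'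
    (fun ω => Z t' ω - Z s ω - (∫ u in s..t', act A (Z u ω)) -
      act (CFC.sqrt R) (Wb t' ω - Wb s ω))

lemma condExp_exp_eq_charFun [IsProbabilityMeasure μ] {O : Ω → β} (hO : Measurable O)
    {Z : Ω → Vec r} (hZ : Measurable Z) (u : Vec r) :
    μ[fun ω => Complex.exp ((inner ℝ u (Z ω) : ℝ) * Complex.I) | mβ.comap O] =ᵐ[μ]
      fun ω => charFun (condDistrib Z O μ (O ω)) u := by
  have hf : Continuous fun z : Vec r => Complex.exp ((inner ℝ u z : ℝ) * Complex.I) := by fun_prop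
  have hint : Integrable (fun ω => Complex.exp ((inner ℝ u (Z ω) : ℝ) * Complex.I)) μ :=
    Integrable.of_bound (hf.measurable.comp hZ).aestronglyMeasurable 1
      (ae_of_all _ fun ω => (Complex.norm_exp_ofReal_mul_I _).le)
  refine (condExp_ae_eq_integral_condDistrib hO hZ.aemeasurable hf.stronglyMeasurable hint).trans
    (ae_of_all _ fun ω => ?_)
  simp only [charFun_apply, real_inner_comm u]

variable {A R : Mat r r} {C : Mat r' r} {Sig : Mat r' r'} {Wb : ℝ → Ω → Vec r}
  {Vb : ℝ → Ω → Vec r'} {Z : ℝ → Ω → Vec r} {x : Vec r} {Q : Mat r r} {s t : ℝ} {O : Ω → β}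
  {Y : ℝ → Ω → Vec r'} {G : ℝ → Ω → Mat r r'}

lemma IsGainDiffusion.isSymm_solution (h : IsGainDiffusion A R C Sig μ Wb Vb Z x Q s t O Y G)
    (hR : R.PosSemidef) (hSig : Sig.PosSemidef) :
    ∀ᵐ ω ∂μ, ∀ p : ℝ → Mat r r, Continuous p → p s = Q → (∀ τ ∈ Set.Icc s t,
      HasDerivWithinAt p (lyap (A - G τ ω * C) (p τ) + (R + G τ ω * Sig * (G τ ω)ᵀ))
        (Set.Icc s t) τ) → (p t).IsSymm := by
  filter_upwards [h.cont_gain] with ω hω p hp hps hp'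
  refine isSymm_lyapunov_solution (B := fun u => A - G u ω * C)
    (Ξ := fun τ => R + G τ ω * Sig * (G τ ω)ᵀ) (by fun_prop) (by fun_prop) (fun u => ?_) h.le hp
    ?_ hp'
  · have h1 := (posSemidef_iff_inner_act.1 hR).1
    have h2 := (posSemidef_iff_inner_act.1 hSig).1
    simp only [Matrix.IsSymm, Matrix.transpose_add, Matrix.transpose_mul,
      Matrix.transpose_transpose, h1.eq, h2.eq, Matrix.mul_assoc]
  · rw [hps]
    exact (posSemidef_iff_inner_act.1 h.posSemidef).1

/-- The conditional covariance solves the Lyapunov equation along the gain. No information on the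
conditional mean is used: the modulus of the conditional characteristic function is enough. -/
theorem IsGainDiffusion.covMatrix_eq [IsProbabilityMeasure μ]
    (h : IsGainDiffusion A R C Sig μ Wb Vb Z x Q s t O Y G)
    (hR : R.PosSemidef) (hSig : Sig.PosSemidef) :
    ∀ᵐ ω ∂μ, ∀ p : ℝ → Mat r r, Continuous p → p s = Q → (∀ τ ∈ Set.Icc s t,
      HasDerivWithinAt p (lyap (A - G τ ω * C) (p τ) + (R + G τ ω * Sig * (G τ ω)ᵀ))
        (Set.Icc s t) τ) → covMatrix (condDistrib (Z t) O μ (O ω)) = p t := by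
  -- the modulus, as a multiplicative map
  let Φ : ℂ →* ℂ := (Complex.ofRealHom : ℝ →* ℂ).comp (normHom : ℂ →*₀ ℝ).toMonoidHom
  have hΦ : ∀ z, Φ z = (‖z‖ : ℂ) := fun z => rfl
  have hΦc : Continuous Φ := by
    have : Continuous fun z : ℂ => ((‖z‖ : ℝ) : ℂ) := by fun_prop
    exact this
  have h1 : ∀ u : Vec r, _ := fun u => condExp_exp_diffusion hR hSig h.nonneg h.le h.posSemidef
    h.brownianW h.brownianV h.indepWV h.measurable_init h.init h.indepInit h.measurable_obs
    h.indepObs h.driver h.gain h.cont_gain h.cont h.sde u hΦc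
    (fun a => by rw [hΦ, ← Complex.ofReal_exp, Complex.norm_real, Real.norm_of_nonneg
      (Real.exp_pos a).le]) (χn := fun _ _ => 1) (χ := fun _ => 1)
    (fun n σ _ => ⟨id, strictMono_id, ae_of_all _ fun ω => by
      simp only [hΦ, Complex.norm_exp_ofReal_mul_I, Complex.ofReal_one]
      exact tendsto_const_nhds⟩) (ae_of_all _ fun ω => tendsto_const_nhds)
  have h2 := ae_all_iff.2 fun n : ℕ => h1 (TopologicalSpace.denseSeq (Vec r) n)
  have h3 := ae_all_iff.2 fun n : ℕ => condExp_exp_eq_charFun (μ := μ) h.measurable_obs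
    h.measurable (TopologicalSpace.denseSeq (Vec r) n)
  filter_upwards [h2, h3, h.isSymm_solution hR hSig] with ω h4 h5 h6 p hp hps hp'
  refine covMatrix_eq_of_norm_charFun (h6 p hp hps hp') fun u => ?_
  -- the identity of characteristic functions holds at a dense sequence, hence everywhere
  have hc1 : Continuous fun u => ‖charFun (condDistrib (Z t) O μ (O ω)) u‖ :=
    continuous_charFun.norm
  have hc2 : Continuous fun u : Vec r => Real.exp (-(inner ℝ u (act (p t) u) / 2)) := by
    have : Continuous fun u : Vec r => act (p t) u := continuous_const.act continuous_id
    fun_prop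
  refine congrFun ((TopologicalSpace.denseRange_denseSeq (Vec r)).equalizer hc1 hc2
    (funext fun n => ?_)) u
  have h7 := h4 n p hp hps hp'
  rw [h5 n, hΦ, one_mul, ← Complex.ofReal_neg, ← Complex.ofReal_exp] at h7
  exact_mod_cast h7

/-- The conditional law is Gaussian; its mean is the filter driven by the same gain, and its
covariance solves the Lyapunov equation along the gain. -/
theorem IsGainDiffusion.condDistrib_eq [IsProbabilityMeasure μ]
    (h : IsGainDiffusion A R C Sig μ Wb Vb Z x Q s t O Y G)
    (hR : R.PosSemidef) (hSig : Sig.PosSemidef) {ψ : ℝ → Ω → Vec r}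
    (hψc : ∀ᵐ ω ∂μ, Continuous fun u => ψ u ω) (hψs : ∀ᵐ ω ∂μ, ψ s ω = x)
    (hψ : ∀ t' ∈ Set.Icc s t,
      IsItoIntegral μ G (fun u ω => Y u ω - ∫ w in s..u, act C (ψ w ω)) s t'
      (fun ω => ψ t' ω - ψ s ω - ∫ u in s..t', act A (ψ u ω))) :
    ∀ᵐ ω ∂μ, ∀ p : ℝ → Mat r r, Continuous p → p s = Q → (∀ τ ∈ Set.Icc s t,
      HasDerivWithinAt p (lyap (A - G τ ω * C) (p τ) + (R + G τ ω * Sig * (G τ ω)ᵀ))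
        (Set.Icc s t) τ) → (p t).PosSemidef →
      condDistrib (Z t) O μ (O ω) = multivariateGaussian (ψ t ω) (p t) := by
  have h1 : ∀ u : Vec r, _ := fun u => condExp_exp_diffusion hR hSig h.nonneg h.le h.posSemidef
    h.brownianW h.brownianV h.indepWV h.measurable_init h.init h.indepInit h.measurable_obs
    h.indepObs h.driver h.gain h.cont_gain h.cont h.sde u (Φ := MonoidHom.id ℂ) continuous_id
    (fun a => rfl) (χn := fun n ω => Complex.exp ((inner ℝ u (eulerPath
        (eulerStep (fun u => A - G u ω * C) s ((t - s) / n)) x (fun k =>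
          ψ (s + k * ((t - s) / n)) ω - ψ s ω -
            ∫ u in s..(s + k * ((t - s) / n)), act (A - G u ω * C) (ψ u ω)) n) : ℝ) * Complex.I))
    (χ := fun ω => Complex.exp ((inner ℝ u (ψ t ω) : ℝ) * Complex.I))
    (fun n σ hσ => by
      obtain ⟨ns, hns, hae⟩ := exists_subseq_tendsto_sum (μ := μ) (A := A) (C := C) (G := G)
        (D := Y) (Z := ψ) (N := fun _ _ => 0) h.le h.cont_gain hψc (fun _ => rfl)
        (fun t' ht' => by simpa using hψ t' ht') n hσ
      refine ⟨ns, hns, ?_⟩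
      filter_upwards [hae] with ω h1
      simp only [zero_add] at h1
      have h3 := tendsto_eulerPath (eulerStep (fun u => A - G u ω * C) s ((t - s) / n)) x h1
      have h4 : Continuous fun x : Vec r => Complex.exp ((inner ℝ u x : ℝ) * Complex.I) := by
        fun_prop
      exact (h4.tendsto _).comp h3)
    (by
      filter_upwards [h.cont_gain, hψc, hψs] with ω h1 h2 h3
      have h4 := tendsto_eulerPath_solution (B := fun u => A - G u ω * C) (by fun_prop) h2 h.le
      rw [h3] at h4
      have h5 : Continuous fun x : Vec r => Complex.exp ((inner ℝ u x : ℝ) * Complex.I) := by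
        fun_prop
      rw [h3]
      exact (h5.tendsto _).comp h4)
  have h2 := ae_all_iff.2 fun n : ℕ => h1 (TopologicalSpace.denseSeq (Vec r) n)
  have h3 := ae_all_iff.2 fun n : ℕ => condExp_exp_eq_charFun (μ := μ) h.measurable_obs
    h.measurable (TopologicalSpace.denseSeq (Vec r) n)
  filter_upwards [h2, h3] with ω h4 h5 p hp hps hp' hPSD
  refine Measure.ext_of_charFun ((TopologicalSpace.denseRange_denseSeq (Vec r)).equalizer
    continuous_charFun continuous_charFun (funext fun n => ?_))
  have h7 := h4 n p hp hps hp'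
  rw [h5 n, MonoidHom.id_apply, ← Complex.exp_add] at h7
  rw [Function.comp_apply, h7, Function.comp_apply, charFun_multivariateGaussian hPSD,
    inner_act_eq_dotProduct]
  congr 1
  push_cast
  ring

end ConditionalLaw

/-! ### Comparison of Lyapunov and Riccati equations -/

section Comparison

variable {r : ℕ}

lemma _root_.HasDerivWithinAt.act {m n : ℕ} {M : ℝ → Mat m n} {x : ℝ → Vec n} {M' : Mat m n}
    {x' : Vec n} {S : Set ℝ} {u : ℝ} (hM : HasDerivWithinAt M M' S u)
    (hx : HasDerivWithinAt x x' S u) :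
    HasDerivWithinAt (fun u => KalmanBucy.act (M u) (x u))
      (KalmanBucy.act M' (x u) + KalmanBucy.act (M u) x') S u := by
  have h1 := ((actL m n).hasFDerivAt.comp_hasDerivWithinAt u hM).clm_apply hx
  exact h1

/-- The equation `y' = -B' y` with a prescribed value at the right end. -/
lemma exists_adjoint_solution {B : ℝ → Mat r r} {a b : ℝ} (hab : a ≤ b)
    (hB : ContinuousOn B (Set.Icc a b)) (y₀ : Vec r) :
    ∃ y : ℝ → Vec r, y b = y₀ ∧ ∀ u ∈ Set.Icc a b,
      HasDerivWithinAt y (-act (B u)ᵀ (y u)) (Set.Icc a b) u := by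
  obtain ⟨K, hK⟩ := isCompact_Icc.exists_bound_of_continuousOn
    (f := fun u => (B u)ᵀ) (s := Set.Icc a b) (by fun_prop)
  have hmem : ∀ {u}, u ∈ Set.Icc a b → a + b - u ∈ Set.Icc a b := fun hu =>
    ⟨by linarith [hu.2], by linarith [hu.1]⟩
  -- the equation is solved forward after the reversal of time
  obtain ⟨z, hz, hz'⟩ := exists_solution_of_lipschitz (E := Vec r) hab (K := K.toNNReal)
    (f := fun u y => act (B (a + b - u))ᵀ y) (fun u hu => by
      refine LipschitzWith.of_dist_le_mul fun x y => ?_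
      rw [dist_eq_norm, dist_eq_norm, ← act_sub_right]
      refine (norm_act_le _ _).trans ?_
      gcongr
      exact (hK _ (hmem hu)).trans (Real.le_coe_toNNReal K))
    (fun x => by
      have h1 : ContinuousOn (fun u => (B (a + b - u))ᵀ) (Set.Icc a b) := by
        have : ContinuousOn (fun u => B (a + b - u)) (Set.Icc a b) :=
          hB.comp (by fun_prop) fun u hu => hmem hu
        have hT : Continuous fun M : Mat r r => Mᵀ := by fun_prop
        exact hT.comp_continuousOn this
      have h2 : Continuous fun M : Mat r r => act M x := continuous_id.act continuous_const
      exact h2.comp_continuousOn h1) y₀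
  refine ⟨fun u => z (a + b - u), by simpa using hz, fun u hu => ?_⟩
  have h1 : HasDerivWithinAt (fun u : ℝ => a + b - u) (-1) (Set.Icc a b) u :=
    ((hasDerivAt_id u).const_sub (a + b)).hasDerivWithinAt
  have h2 := (hz' _ (hmem hu)).scomp u h1 fun v hv => hmem hv
  have h3 : (-1 : ℝ) • act (B (a + b - (a + b - u)))ᵀ (z (a + b - u)) =
      -act (B u)ᵀ (z (a + b - u)) := by
    rw [neg_one_smul, sub_sub_cancel]
  rw [h3] at h2
  exact h2

/-- A family of quadratic polynomials `y ↦ ⟪y, P y⟫ + 2 ⟪y, n⟫ + k`, transported by the linear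
drift `B` up to nonnegative sources, stays nonnegative. It is nondecreasing along the solutions of
the adjoint equation. -/
theorem quadratic_nonneg_of_lyapunov {B P E : ℝ → Mat r r} {n e : ℝ → Vec r} {k κ : ℝ → ℝ}
    {a b : ℝ} (hab : a ≤ b) (hB : ContinuousOn B (Set.Icc a b))
    (hP : ∀ u ∈ Set.Icc a b,
      HasDerivWithinAt P (B u * P u + P u * (B u)ᵀ + E u) (Set.Icc a b) u)
    (hn : ∀ u ∈ Set.Icc a b, HasDerivWithinAt n (act (B u) (n u) + e u) (Set.Icc a b) u)
    (hk : ∀ u ∈ Set.Icc a b, HasDerivWithinAt k (κ u) (Set.Icc a b) u)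
    (hE : ∀ u ∈ Set.Icc a b, ∀ y,
      0 ≤ inner ℝ y (act (E u) y) + 2 * inner ℝ y (e u) + κ u)
    (h0 : ∀ y, 0 ≤ inner ℝ y (act (P a) y) + 2 * inner ℝ y (n a) + k a) (y₀ : Vec r) :
    0 ≤ inner ℝ y₀ (act (P b) y₀) + 2 * inner ℝ y₀ (n b) + k b := by
  obtain ⟨y, hyb, hy⟩ := exists_adjoint_solution hab hB y₀
  have hd : ∀ u ∈ Set.Icc a b, HasDerivWithinAt
      (fun u => inner ℝ (y u) (act (P u) (y u)) + 2 * inner ℝ (y u) (n u) + k u)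
      (inner ℝ (y u) (act (E u) (y u)) + 2 * inner ℝ (y u) (e u) + κ u) (Set.Icc a b) u := by
    intro u hu
    have h1 := ((hy u hu).inner ℝ ((hP u hu).act (hy u hu))).add
      (((hy u hu).inner ℝ (hn u hu)).const_mul 2) |>.add (hk u hu)
    refine h1.congr_deriv ?_
    have e1 : ∀ z, inner ℝ (act (B u)ᵀ (y u)) z = inner ℝ (y u) (act (B u) z) := fun z =>
      (inner_act _ _ _).symm
    have e2 : act (P u * (B u)ᵀ) (y u) = act (P u) (act (B u)ᵀ (y u)) := act_mul _ _ _
    simp only [act_add_left, inner_add_right, inner_neg_left, e1, e2, act_mul]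
    have e3 : act (P u) (-act (B u)ᵀ (y u)) = -act (P u) (act (B u)ᵀ (y u)) := by
      rw [← actL_apply, map_neg]
      rfl
    rw [e3, inner_neg_right]
    ring
  have hmono := monotoneOn_of_hasDerivWithinAt_nonneg (convex_Icc a b)
    (fun u hu => (hd u hu).continuousWithinAt)
    (fun u hu => (hd u (interior_subset hu)).mono interior_subset)
    (fun u hu => hE u (interior_subset hu) (y u))
  have h1 := hmono (Set.left_mem_Icc.2 hab) (Set.right_mem_Icc.2 hab) hab
  simp only [hyb] at h1
  exact (h0 _).trans h1

lemma le_iff_inner_act {M N : Mat r r} (hM : M.IsSymm) (hN : N.IsSymm) :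
    M ≤ N ↔ ∀ u, inner ℝ u (act M u) ≤ inner ℝ u (act N u) := by
  rw [Matrix.le_iff, posSemidef_iff_inner_act]
  simp only [act_sub_left, inner_sub_right, sub_nonneg]
  refine ⟨fun h => h.2, fun h => ⟨?_, h⟩⟩
  rw [Matrix.IsSymm, Matrix.transpose_sub, hM.eq, hN.eq]

lemma inner_act_le_of_le {M N : Mat r r} (h : M ≤ N) (u : Vec r) :
    inner ℝ u (act M u) ≤ inner ℝ u (act N u) := by
  have := (posSemidef_iff_inner_act.1 (Matrix.le_iff.1 h)).2 u
  rwa [act_sub_left, inner_sub_right, sub_nonneg] at this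

/-- Comparison for Riccati equations with sources `E₁ ≥ E₂`. The difference of two solutions solves
a Lyapunov equation, because the quadratic terms are symmetric about the midpoint:
`U S U - L S L = M S (U - L) + (U - L) S M` with `M = (U + L) / 2`. -/
theorem riccati_comparison {A R S : Mat r r} (hS : S.IsSymm) {U L E₁ E₂ : ℝ → Mat r r} {a b : ℝ}
    (hab : a ≤ b)
    (hU : ∀ u ∈ Set.Icc a b, HasDerivWithinAt U
      (A * U u + U u * Aᵀ - U u * S * U u + R + E₁ u) (Set.Icc a b) u)
    (hL : ∀ u ∈ Set.Icc a b, HasDerivWithinAt L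
      (A * L u + L u * Aᵀ - L u * S * L u + R + E₂ u) (Set.Icc a b) u)
    (hUs : ∀ u ∈ Set.Icc a b, (U u).IsSymm) (hLs : ∀ u ∈ Set.Icc a b, (L u).IsSymm)
    (hE : ∀ u ∈ Set.Icc a b, ∀ y, inner ℝ y (act (E₂ u) y) ≤ inner ℝ y (act (E₁ u) y))
    (h0 : L a ≤ U a) : L b ≤ U b := by
  have hUc : ContinuousOn U (Set.Icc a b) := fun u hu => (hU u hu).continuousWithinAt
  have hLc : ContinuousOn L (Set.Icc a b) := fun u hu => (hL u hu).continuousWithinAt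
  rw [le_iff_inner_act (hLs b ⟨hab, le_rfl⟩) (hUs b ⟨hab, le_rfl⟩)]
  intro y₀
  have h := quadratic_nonneg_of_lyapunov (P := fun u => U u - L u) (E := fun u => E₁ u - E₂ u)
    (B := fun u => A - ((1 / 2 : ℝ) • (U u + L u)) * S) (n := fun _ => 0) (e := fun _ => 0)
    (k := fun _ => 0) (κ := fun _ => 0) hab (by fun_prop) (fun u hu => by
      refine ((hU u hu).sub (hL u hu)).congr_deriv ?_
      have e1 : (A - ((1 / 2 : ℝ) • (U u + L u)) * S)ᵀ =
          Aᵀ - S * ((1 / 2 : ℝ) • (U u + L u)) := by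
        simp only [Matrix.transpose_sub, Matrix.transpose_mul, Matrix.transpose_smul,
          Matrix.transpose_add, hS.eq, (hUs u hu).eq, (hLs u hu).eq]
      rw [e1]
      have e2 : U u * S * U u - L u * S * L u =
          ((1 / 2 : ℝ) • (U u + L u)) * S * (U u - L u) +
            (U u - L u) * (S * ((1 / 2 : ℝ) • (U u + L u))) := by
        simp only [Matrix.smul_mul, Matrix.mul_smul, add_mul, mul_add, mul_sub, sub_mul,
          ← Matrix.mul_assoc, smul_add]
        module
      rw [sub_mul A, mul_sub _ Aᵀ]
      have e3 : A * U u + U u * Aᵀ - U u * S * U u + R + E₁ u -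
          (A * L u + L u * Aᵀ - L u * S * L u + R + E₂ u) =
          A * (U u - L u) + (U u - L u) * Aᵀ - (U u * S * U u - L u * S * L u) +
            (E₁ u - E₂ u) := by
        rw [mul_sub, sub_mul]
        abel
      rw [e3, e2]
      abel)
    (fun u _ => by simpa using hasDerivWithinAt_const u (Set.Icc a b) (0 : Vec r))
    (fun u _ => hasDerivWithinAt_const u (Set.Icc a b) (0 : ℝ))
    (fun u hu y => by
      have := hE u hu y
      simp only [act_sub_left, inner_sub_right, inner_zero_right]
      linarith)
    (fun y => by
      have := inner_act_le_of_le h0 y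
      simp only [act_sub_left, inner_sub_right, inner_zero_right]
      linarith) y₀
  simp only [act_sub_left, inner_sub_right, inner_zero_right] at h
  linarith

end Comparison

/-! ### The Gramians and the lower bound on the Riccati flow -/

section Gramians

variable {r : ℕ}

lemma hasDerivAt_exp_smul_mul (A R : Mat r r) (u : ℝ) :
    HasDerivAt (fun u : ℝ => NormedSpace.exp (u • A) * R * NormedSpace.exp (u • Aᵀ))
      (A * (NormedSpace.exp (u • A) * R * NormedSpace.exp (u • Aᵀ)) +
        NormedSpace.exp (u • A) * R * NormedSpace.exp (u • Aᵀ) * Aᵀ) u := by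
  have h := ((hasDerivAt_exp_smul_const' A u).mul_const R).mul (hasDerivAt_exp_smul_const Aᵀ u)
  refine h.congr_deriv ?_
  simp only [Matrix.mul_assoc]

lemma continuous_exp_smul (A : Mat r r) : Continuous fun u : ℝ => NormedSpace.exp (u • A) :=
  continuous_iff_continuousAt.2 fun u => (hasDerivAt_exp_smul_const A u).continuousAt

lemma continuous_gram_integrand (A R : Mat r r) :
    Continuous fun u : ℝ => NormedSpace.exp (u • A) * R * NormedSpace.exp (u • Aᵀ) :=
  ((continuous_exp_smul A).mul continuous_const).mul (continuous_exp_smul Aᵀ)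

/-- The Lyapunov equation of the Gramian, in integrated form. -/
lemma exp_smul_mul_eq (A R : Mat r r) (u : ℝ) :
    NormedSpace.exp (u • A) * R * NormedSpace.exp (u • Aᵀ) =
      A * gramC A R u + gramC A R u * Aᵀ + R := by
  have hc := continuous_gram_integrand A R
  have h := intervalIntegral.integral_eq_sub_of_hasDerivAt (a := 0) (b := u)
    (fun v _ => hasDerivAt_exp_smul_mul A R v) (by
      refine Continuous.intervalIntegrable ?_ _ _
      exact (continuous_const.mul hc).add (hc.mul continuous_const))
  have hc1 : Continuous fun v : ℝ =>
      A * (NormedSpace.exp (v • A) * R * NormedSpace.exp (v • Aᵀ)) := continuous_const.mul hc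
  have hc2 : Continuous fun v : ℝ =>
      NormedSpace.exp (v • A) * R * NormedSpace.exp (v • Aᵀ) * Aᵀ := hc.mul continuous_const
  rw [intervalIntegral.integral_add (hc1.intervalIntegrable _ _)
    (hc2.intervalIntegrable _ _)] at h
  have h1 : ∫ v in (0 : ℝ)..u, A * (NormedSpace.exp (v • A) * R * NormedSpace.exp (v • Aᵀ)) =
      A * gramC A R u :=
    ContinuousLinearMap.intervalIntegral_comp_comm (ContinuousLinearMap.mul ℝ (Mat r r) A)
      (hc.intervalIntegrable _ _)
  have h2 : ∫ v in (0 : ℝ)..u, NormedSpace.exp (v • A) * R * NormedSpace.exp (v • Aᵀ) * Aᵀ =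
      gramC A R u * Aᵀ :=
    ContinuousLinearMap.intervalIntegral_comp_comm
      ((ContinuousLinearMap.mul ℝ (Mat r r)).flip Aᵀ) (hc.intervalIntegrable _ _)
  rw [h1, h2] at h
  rw [h]
  simp

lemma hasDerivAt_gramC (A R : Mat r r) (u : ℝ) :
    HasDerivAt (gramC A R) (A * gramC A R u + gramC A R u * Aᵀ + R) u := by
  have hc := continuous_gram_integrand A R
  rw [← exp_smul_mul_eq]
  exact intervalIntegral.integral_hasDerivAt_right (hc.intervalIntegrable _ _)
    (hc.stronglyMeasurableAtFilter _ _) hc.continuousAt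

lemma continuous_gramC (A R : Mat r r) : Continuous (gramC A R) :=
  continuous_iff_continuousAt.2 fun u => (hasDerivAt_gramC A R u).continuousAt

lemma isSymm_gramC {A R : Mat r r} (hR : R.IsSymm) (u : ℝ) : (gramC A R u).IsSymm := by
  have h : (gramC A R u)ᵀ =
      ∫ v in (0 : ℝ)..u, (NormedSpace.exp (v • A) * R * NormedSpace.exp (v • Aᵀ))ᵀ :=
    ((Matrix.transposeLinearEquiv (Fin r) (Fin r) ℝ ℝ).toLinearMap.toContinuousLinearMap
      |>.intervalIntegral_comp_comm
        ((continuous_gram_integrand A R).intervalIntegrable _ _)).symm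
  rw [Matrix.IsSymm, h]
  simp only [Matrix.transpose_mul, ← Matrix.exp_transpose, Matrix.transpose_smul,
    Matrix.transpose_transpose, hR.eq, Matrix.mul_assoc]
  simp only [gramC, Matrix.mul_assoc]

lemma integral_inner_act {F : ℝ → Mat r r} (hF : Continuous F) (w : Vec r) (a b : ℝ) :
    ∫ u in a..b, inner ℝ w (act (F u) w) = inner ℝ w (act (∫ u in a..b, F u) w) :=
  ContinuousLinearMap.intervalIntegral_comp_comm
    ((innerSL ℝ w).comp ((actL r r).flip w)) (hF.intervalIntegrable _ _)

/-- After the time `v`, the Riccati flow is bounded below by the inverse of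
`oPlus + 1 / cMinus`. The polynomial `⟪y, P y⟫ + 2 ⟪y, n⟫ + k` is transported along the flow, for
the path `n` that is steered from `0` to a given vector `x` by the control of minimal energy, and
for the cost `k` of that control. -/
theorem riccati_lower_bound (hr : 1 ≤ r) {A R S : Mat r r} (hR : R.PosSemidef) (hS : S.PosSemidef)
    {v cMinus oPlus : ℝ} (hv : 0 < v) (hcMinus : 0 < cMinus)
    (hC : cMinus • (1 : Mat r r) ≤ gramC A R v)
    (hO : gramOC A R S v ≤ oPlus • (1 : Mat r r)) {P : ℝ → Mat r r}
    (hP : ∀ u ∈ Set.Icc 0 v, HasDerivWithinAt P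
      (A * P u + P u * Aᵀ - P u * S * P u + R) (Set.Icc 0 v) u)
    (hPs : ∀ u ∈ Set.Icc 0 v, (P u).IsSymm) (h0 : (P 0).PosSemidef) :
    0 < oPlus + 1 / cMinus ∧
      ∀ y, (oPlus + 1 / cMinus)⁻¹ * ‖y‖ ^ 2 ≤ inner ℝ y (act (P v) y) := by
  obtain ⟨hRs, hRn⟩ := posSemidef_iff_inner_act.1 hR
  obtain ⟨hSs, hSn⟩ := posSemidef_iff_inner_act.1 hS
  set c := oPlus + 1 / cMinus with hc
  set Cv := gramC A R v with hCv
  have hCvs : Cv.IsSymm := isSymm_gramC hRs v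
  have hCvl : ∀ w, cMinus * ‖w‖ ^ 2 ≤ inner ℝ w (act Cv w) := fun w => by
    have := inner_act_le_of_le hC w
    rwa [act_smul_left, act_one, inner_smul_right, real_inner_self_eq_norm_sq] at this
  have hdet : IsUnit Cv.det := by
    rw [isUnit_iff_ne_zero]
    intro h
    obtain ⟨w, hw0, hw⟩ := Matrix.exists_mulVec_eq_zero_iff.2 h
    have h1 := hCvl (WithLp.toLp 2 w)
    rw [inner_act_eq_dotProduct] at h1
    simp only [hw, dotProduct_zero] at h1
    have h2 : 0 < ‖(WithLp.toLp 2 w : Vec r)‖ := by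
      rw [norm_pos_iff]
      intro h3
      exact hw0 (by simpa using h3)
    nlinarith [pow_pos h2 2]
  have hinv : Cv * Cv⁻¹ = 1 := Matrix.mul_nonsing_inv _ hdet
  have hinvs : (Cv⁻¹)ᵀ = Cv⁻¹ := by rw [Matrix.transpose_nonsing_inv, hCvs.eq]
  -- the key inequality, for the optimal control towards `x`
  have key : ∀ x y : Vec r, 0 ≤ inner ℝ y (act (P v) y) + 2 * inner ℝ y x + c * ‖x‖ ^ 2 := by
    intro x y₀
    set w := act Cv⁻¹ x with hw
    have hCw : act Cv w = x := by rw [hw, ← act_mul, hinv, act_one]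
    let M : ℝ → Mat r r := fun u => NormedSpace.exp ((v - u) • Aᵀ)
    have hM : ∀ u, HasDerivAt M (-(Aᵀ * M u)) u := fun u => by
      have h1 := (hasDerivAt_exp_smul_const' Aᵀ (v - u)).scomp u
        ((hasDerivAt_id u).const_sub v)
      have h2 := h1.congr_deriv (neg_one_smul ℝ _)
      exact h2
    have hMc : Continuous M := continuous_iff_continuousAt.2 fun u => (hM u).continuousAt
    have hMT : ∀ u, (M u)ᵀ = NormedSpace.exp ((v - u) • A) := fun u => by
      simp only [M, ← Matrix.exp_transpose, Matrix.transpose_smul, Matrix.transpose_transpose]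
    have hGc := continuous_gramC A R
    -- the path `n' = A n + R m`, which ends at `x`, its control `m`, and the running cost `κ`
    let n : ℝ → Vec r := fun u => act (gramC A R u * M u) w
    let m : ℝ → Vec r := fun u => act (M u) w
    have hmc : Continuous m := hMc.act continuous_const
    have hnc : Continuous n := (hGc.mul hMc).act continuous_const
    let κ : ℝ → ℝ := fun u => inner ℝ (m u) (act R (m u)) + inner ℝ (n u) (act S (n u))
    have hκ1 : Continuous fun u => inner ℝ (m u) (act R (m u)) :=
      hmc.inner (continuous_const.act hmc)
    have hκ2 : Continuous fun u => inner ℝ (n u) (act S (n u)) :=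
      hnc.inner (continuous_const.act hnc)
    have hκ : Continuous κ := hκ1.add hκ2
    have hPc : ContinuousOn P (Set.Icc 0 v) := fun u hu => (hP u hu).continuousWithinAt
    have h := quadratic_nonneg_of_lyapunov (P := P) (B := fun u => A - P u * S)
      (E := fun u => R + P u * S * P u) (n := n)
      (e := fun u => act (P u * S) (n u) + act R (m u))
      (k := fun u => ∫ τ in (0 : ℝ)..u, κ τ) (κ := κ) hv.le (by fun_prop)
      (fun u hu => by
        refine (hP u hu).congr_deriv ?_
        rw [Matrix.transpose_sub, Matrix.transpose_mul, hSs.eq, (hPs u hu).eq, sub_mul, mul_sub]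
        simp only [Matrix.mul_assoc]
        abel)
      (fun u hu => by
        have h1 := (((hasDerivAt_gramC A R u).mul (hM u)).hasDerivWithinAt (s := Set.Icc 0 v)).act
          (hasDerivWithinAt_const u (Set.Icc 0 v) w)
        refine h1.congr_deriv ?_
        simp only [n, m, ← act_mul, ← act_add_left, act_zero_right, add_zero]
        congr 1
        simp only [add_mul, sub_mul, mul_neg, Matrix.mul_assoc]
        abel)
      (fun u hu => (intervalIntegral.integral_hasDerivAt_right (hκ.intervalIntegrable _ _)
        (hκ.stronglyMeasurableAtFilter _ _) hκ.continuousAt).hasDerivWithinAt)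
      (fun u hu y => by
        have h1 := hRn (y + m u)
        have h2 := hSn (act (P u) y + n u)
        have e1 : ∀ a b : Vec r, inner ℝ a (act R b) = inner ℝ b (act R a) := fun a b => by
          rw [inner_act, hRs.eq, real_inner_comm]
        have e2 : ∀ a b : Vec r, inner ℝ a (act S b) = inner ℝ b (act S a) := fun a b => by
          rw [inner_act, hSs.eq, real_inner_comm]
        have e3 : ∀ a b : Vec r, inner ℝ a (act (P u) b) = inner ℝ (act (P u) a) b :=
          fun a b => by rw [inner_act, (hPs u hu).eq]
        simp only [act_add_right, inner_add_left, inner_add_right] at h1 h2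
        rw [e1 (m u) y] at h1
        rw [e2 (n u) (act (P u) y)] at h2
        simp only [act_add_left, act_mul, inner_add_right, κ]
        rw [e3 y, e3 y]
        linarith)
      (fun y => by
        have h1 := (posSemidef_iff_inner_act.1 h0).2 y
        have h2 : n 0 = 0 := by simp [n, gramC]
        simp only [h2, inner_zero_right, intervalIntegral.integral_same]
        linarith) y₀
    have hnv : n v = x := by
      have : M v = 1 := by simp [M]
      simp only [n, this, mul_one]
      exact hCw
    have hk1 : ∫ u in (0 : ℝ)..v, inner ℝ (m u) (act R (m u)) = inner ℝ w (act Cv w) := by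
      have e1 : ∀ u, inner ℝ (m u) (act R (m u)) = inner ℝ w (act
          (NormedSpace.exp ((v - u) • A) * R * NormedSpace.exp ((v - u) • Aᵀ)) w) := fun u => by
        have := inner_act (M u)ᵀ w (act R (m u))
        rw [Matrix.transpose_transpose] at this
        rw [act_mul, act_mul, ← hMT u]
        exact this.symm
      simp only [e1]
      rw [intervalIntegral.integral_comp_sub_left (fun u => inner ℝ w (act
          (NormedSpace.exp (u • A) * R * NormedSpace.exp (u • Aᵀ)) w)) v, sub_self, sub_zero,
        integral_inner_act (continuous_gram_integrand A R)]
      rfl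
    have hk2 : ∫ u in (0 : ℝ)..v, inner ℝ (n u) (act S (n u)) =
        inner ℝ x (act (gramOC A R S v) x) := by
      have e1 : ∀ u, inner ℝ (n u) (act S (n u)) = inner ℝ w (act
          (NormedSpace.exp ((v - u) • A) * gramC A R u * S * gramC A R u *
            NormedSpace.exp ((v - u) • Aᵀ)) w) := fun u => by
        have h1 := inner_act (gramC A R u * M u)ᵀ w (act S (n u))
        rw [Matrix.transpose_transpose] at h1
        change inner ℝ (act (gramC A R u * M u) w) (act S (n u)) = _
        rw [← h1, Matrix.transpose_mul, hMT, (isSymm_gramC hRs u).eq]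
        simp only [n, M, act_mul]
      have hc1 : Continuous fun u => NormedSpace.exp ((v - u) • A) * gramC A R u * S *
          gramC A R u * NormedSpace.exp ((v - u) • Aᵀ) := by
        have h1 : Continuous fun u => NormedSpace.exp ((v - u) • A) :=
          (continuous_exp_smul A).comp (continuous_const.sub continuous_id)
        exact (((h1.mul hGc).mul continuous_const).mul hGc).mul hMc
      simp only [e1]
      rw [integral_inner_act hc1, gramOC, act_mul, act_mul, inner_act Cv⁻¹, hinvs]
    have hkv : ∫ u in (0 : ℝ)..v, κ u ≤ c * ‖x‖ ^ 2 := by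
      simp only [κ]
      rw [intervalIntegral.integral_add (hκ1.intervalIntegrable _ _) (hκ2.intervalIntegrable _ _),
        hk1, hk2, hCw]
      have h1 := inner_act_le_of_le hO x
      rw [act_smul_left, act_one, inner_smul_right, real_inner_self_eq_norm_sq] at h1
      have h2 := hCvl w
      rw [hCw] at h2
      have h3 := real_inner_le_norm w x
      have h4 : cMinus * ‖w‖ ≤ ‖x‖ := by
        rcases (norm_nonneg w).eq_or_lt with h5 | h5
        · rw [← h5, mul_zero]
          exact norm_nonneg x
        · refine le_of_mul_le_mul_left ?_ h5
          nlinarith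
      have h6 : inner ℝ w x ≤ 1 / cMinus * ‖x‖ ^ 2 := by
        rw [div_mul_eq_mul_div, one_mul, le_div_iff₀ hcMinus]
        nlinarith [norm_nonneg x]
      rw [hc]
      linarith
    rw [hnv] at h
    linarith
  -- for `c ≤ 0` the key inequality would fail at a large negative multiple of `y`
  have hcpos : 0 < c := by
    by_contra hcn
    let e : Vec r := EuclideanSpace.single ⟨0, hr⟩ 1
    have he : ‖e‖ = 1 := by simp [e]
    have h1 := key ((-(inner ℝ e (act (P v) e) + 1) / 2) • e) e
    rw [inner_smul_right, real_inner_self_eq_norm_sq, he] at h1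
    have h2 : c * ‖(-(inner ℝ e (act (P v) e) + 1) / 2) • e‖ ^ 2 ≤ 0 :=
      mul_nonpos_of_nonpos_of_nonneg (not_lt.1 hcn) (by positivity)
    linarith
  refine ⟨hcpos, fun y => ?_⟩
  have h1 := key ((-c⁻¹) • y) y
  rw [inner_smul_right, real_inner_self_eq_norm_sq, norm_smul, norm_neg, mul_pow,
    Real.norm_of_nonneg (inv_nonneg.2 hcpos.le)] at h1
  have h2 : c * (c⁻¹ ^ 2 * ‖y‖ ^ 2) = c⁻¹ * ‖y‖ ^ 2 := by
    field_simp
  linarith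

end Gramians

/-! ### The conditional law of the nonlinear diffusion -/

section Diffusion

variable {Ω : Type*} [MeasurableSpace Ω] {μ : Measure Ω} {r r' : ℕ}

lemma isSymm_inv_of_posDef {n : ℕ} {M : Mat n n} (hM : M.PosDef) : (M⁻¹)ᵀ = M⁻¹ := by
  rw [Matrix.transpose_nonsing_inv, (posSemidef_iff_inner_act.1 hM.posSemidef).1.eq]

lemma posSemidef_obsS (C : Mat r' r) {Sig : Mat r' r'} (hSig : Sig.PosDef) :
    (obsS C Sig).PosSemidef := by
  have h := hSig.inv.posSemidef.conjTranspose_mul_mul_same C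
  rwa [Matrix.conjTranspose_eq_transpose_of_trivial] at h

/-- Along the gain `π(P) C' Σ⁻¹` the Lyapunov drift at `P` is the perturbed Riccati drift. -/
lemma lyap_gain_eq_riccPert (A R : Mat r r) (C : Mat r' r) {Sig : Mat r' r'} (hSig : Sig.PosDef)
    (π : C(PSD r, PSD r)) (P : PSD r) :
    lyap (A - (π P).1 * Cᵀ * Sig⁻¹ * C) P.1 +
      (R + (π P).1 * Cᵀ * Sig⁻¹ * Sig * ((π P).1 * Cᵀ * Sig⁻¹)ᵀ) =
      riccPert A R (obsS C Sig) π P := by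
  have h1 : (π P).1 * Cᵀ * Sig⁻¹ * C = (π P).1 * obsS C Sig := by
    simp only [obsS, Matrix.mul_assoc]
  have h2 : Sig⁻¹ * Sig = 1 := Matrix.nonsing_inv_mul _ ((Matrix.isUnit_iff_isUnit_det _).1
    hSig.isUnit)
  have h3 : (π P).1 * Cᵀ * Sig⁻¹ * Sig * ((π P).1 * Cᵀ * Sig⁻¹)ᵀ =
      (π P).1 * obsS C Sig * (π P).1 := by
    rw [Matrix.transpose_mul, Matrix.transpose_mul, Matrix.transpose_transpose,
      isSymm_inv_of_posDef hSig, (posSemidef_iff_inner_act.1 (π P).2).1.eq,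
      Matrix.mul_assoc _ Sig⁻¹ Sig, h2, Matrix.mul_one]
    simp only [obsS, Matrix.mul_assoc]
  rw [h1, h3, lyap_apply, riccPert]
  abel

variable {A R : Mat r r} {C : Mat r' r} {Sig : Mat r' r'}
  {X : ℝ → Ω → Vec r} {Y : ℝ → Ω → Vec r'} {Wb : ℝ → Ω → Vec r} {Vb : ℝ → Ω → Vec r'}
  {π : C(PSD r, PSD r)} {s : ℝ} {x : Vec r} {Q : PSD r} {Z : ℝ → Ω → Vec r}

lemma measurable_obsPath (hY : ∀ t : ℝ, 0 ≤ t → Measurable (Y t)) (hs : 0 ≤ s) (t : ℝ) :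
    Measurable (obsPath Y s t) :=
  measurable_pi_lambda _ fun u => hY u (hs.trans u.2.1)

lemma integral_comp_projIcc {E : Type*} [NormedAddCommGroup E] [NormedSpace ℝ E] (f : ℝ → E)
    {t u : ℝ} (hst : s ≤ t) (hu : u ∈ Set.Icc s t) :
    ∫ w in s..u, f (Set.projIcc s t hst w) = ∫ w in s..u, f w := by
  refine intervalIntegral.integral_congr fun w hw => ?_
  rw [Set.uIcc_of_le hu.1] at hw
  simp only [Set.projIcc_of_mem hst ⟨hw.1, hw.2.trans hu.2⟩]

/-- On `[s, t]` the nonlinear diffusion is a diffusion along an observable gain; the processes are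
frozen outside of `[s, t]`. -/
lemma IsDiffusion.isGainDiffusion [IsProbabilityMeasure μ]
    (h : IsDiffusion A R C Sig μ X Y Wb Vb π s x Q Z)
    (hY : ∀ t : ℝ, 0 ≤ t → Measurable (Y t)) (hs : 0 ≤ s) {P : ℝ → Ω → PSD r}
    (hPc : ∀ᵐ ω ∂μ, ContinuousOn (fun u => P u ω) (Set.Ici s))
    (hPcov : ∀ t : ℝ, s ≤ t → ∀ᵐ ω ∂μ, (P t ω).1 = covMatrix (condLaw μ Y s t Z ω))
    (hsde : ∀ t : ℝ, s ≤ t → IsItoIntegral μ (fun u ω => (π (P u ω)).1 * Cᵀ * Sig⁻¹)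
      (fun u ω => Y u ω - ((∫ w in s..u, act C (Z w ω)) + act (CFC.sqrt Sig) (Vb u ω))) s t
      (fun ω => Z t ω - Z s ω - (∫ u in s..t, act A (Z u ω)) -
        act (CFC.sqrt R) (Wb t ω - Wb s ω))) {t : ℝ} (hst : s ≤ t) :
    IsGainDiffusion A R C Sig μ Wb Vb (fun u => Z (Set.projIcc s t hst u)) x Q.1 s t
      (obsPath Y s t) (fun u => Y (Set.projIcc s t hst u))
      (fun u ω => (π (P (Set.projIcc s t hst u) ω)).1 * Cᵀ * Sig⁻¹) := by
  have hproj : ∀ {u}, u ∈ Set.Icc s t → (Set.projIcc s t hst u : ℝ) = u := fun hu => by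
    rw [Set.projIcc_of_mem hst hu]
  have hps : (Set.projIcc s t hst s : ℝ) = s := hproj ⟨le_rfl, hst⟩
  have hpt : (Set.projIcc s t hst t : ℝ) = t := hproj ⟨hst, le_rfl⟩
  have hpc : Continuous fun u : ℝ => (Set.projIcc s t hst u : ℝ) :=
    continuous_subtype_val.comp continuous_projIcc
  have hmaps : ∀ u : ℝ, s ≤ Set.projIcc s t hst u := fun u => (Set.projIcc s t hst u).2.1
  refine
    { nonneg := hs
      le := hst
      posSemidef := Q.2
      brownianW := h.brownianW
      brownianV := h.brownianV
      indepWV := h.indepWV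
      measurable_init := by simpa only [hps] using h.measurable s le_rfl
      measurable := by simpa only [hpt] using h.measurable t hst
      init := by simpa only [hps] using h.init
      indepInit := by simpa only [hps] using h.indepInit
      measurable_obs := measurable_obsPath hY hs t
      indepObs := ?_
      driver := fun u => ⟨fun o => o (Set.projIcc s t hst u),
        (measurable_pi_apply _).stronglyMeasurable, ae_of_all _ fun ω => rfl⟩
      gain := fun u => ?_
      cont_gain := ?_
      cont := ?_
      sde := fun t' ht' => ?_ }
  · have hm : Measurable fun p : (ℝ≥0 → Vec r) × (ℝ≥0 → Vec r') => fun u : Set.Icc s t =>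
        p.2 ⟨u, hs.trans u.2.1⟩ := by fun_prop
    have h1 := h.indepObs.comp hm measurable_id
    simp only [hps]
    exact h1
  · -- a version of the gain as a function of the observation path, through the regular conditional
    -- law of the diffusion given the shorter path up to the time `τ`
    obtain ⟨F, hF, hFπ⟩ := exists_continuous_extension π
    set τ : ℝ := ((Set.projIcc s t hst u : Set.Icc s t) : ℝ) with hτ
    have hτt : τ ≤ t := (Set.projIcc s t hst u).2.2
    let ρ : (Set.Icc s t → Vec r') → (Set.Icc s τ → Vec r') := fun o v =>
      o ⟨v, v.2.1, v.2.2.trans hτt⟩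
    have hρ : Measurable ρ := by fun_prop
    have h1 := (stronglyMeasurable_covMatrix
      (condDistrib (Z τ) (obsPath Y s τ) μ)).comp_measurable hρ
    have hc : Continuous fun M : Mat r r => F M * Cᵀ * Sig⁻¹ := by fun_prop
    refine ⟨_, hc.comp_stronglyMeasurable h1, ?_⟩
    filter_upwards [hPcov τ (hmaps u)] with ω hω
    have h2 : covMatrix (condDistrib (Z τ) (obsPath Y s τ) μ (ρ (obsPath Y s t ω))) =
        (P τ ω).1 := hω.symm
    simp only [Function.comp, h2, hFπ]
  · filter_upwards [hPc] with ω hω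
    have h1 : Continuous fun u => P (Set.projIcc s t hst u) ω :=
      hω.comp_continuous hpc hmaps
    have h2 : Continuous fun u => (π (P (Set.projIcc s t hst u) ω)).1 :=
      continuous_subtype_val.comp (π.continuous.comp h1)
    fun_prop
  · filter_upwards [h.cont] with ω hω
    exact hω.comp_continuous hpc hmaps
  · refine (hsde t' ht'.1).congr ht'.1 (ae_of_all _ fun ω u hu => ?_) (fun ω u hu => ?_)
      fun ω => ?_
    · rw [hproj ⟨hu.1, hu.2.trans ht'.2⟩]
    · have hu' : u ∈ Set.Icc s t := ⟨hu.1, hu.2.trans ht'.2⟩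
      rw [hproj hu', integral_comp_projIcc (fun w => act C (Z w ω)) hst hu']
      abel
    · rw [hproj ht', hps, integral_comp_projIcc (fun w => act A (Z w ω)) hst ht']

/-- The conditional covariance of the nonlinear diffusion solves the perturbed Riccati equation:
its paths are continuous and agree at all rational times with the solution of the Lyapunov equation
whose gain is given by the paths themselves. -/
theorem IsDiffusion.isSolution [IsProbabilityMeasure μ]
    (h : IsDiffusion A R C Sig μ X Y Wb Vb π s x Q Z) (hR : R.PosSemidef) (hSig : Sig.PosDef)
    (hY : ∀ t : ℝ, 0 ≤ t → Measurable (Y t)) (hs : 0 ≤ s) {P : ℝ → Ω → PSD r}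
    (hPc : ∀ᵐ ω ∂μ, ContinuousOn (fun u => P u ω) (Set.Ici s))
    (hPcov : ∀ t : ℝ, s ≤ t → ∀ᵐ ω ∂μ, (P t ω).1 = covMatrix (condLaw μ Y s t Z ω))
    (hsde : ∀ t : ℝ, s ≤ t → IsItoIntegral μ (fun u ω => (π (P u ω)).1 * Cᵀ * Sig⁻¹)
      (fun u ω => Y u ω - ((∫ w in s..u, act C (Z w ω)) + act (CFC.sqrt Sig) (Vb u ω))) s t
      (fun ω => Z t ω - Z s ω - (∫ u in s..t, act A (Z u ω)) -
        act (CFC.sqrt R) (Wb t ω - Wb s ω))) :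
    ∀ᵐ ω ∂μ, IsSolution (riccPert A R (obsS C Sig) π) Q fun u => P (s + u) ω := by
  have hT : ∀ T : ℕ, s ≤ s + T := fun T => by linarith [(T.cast_nonneg : (0 : ℝ) ≤ T)]
  -- the covariances at the times of a countable dense set
  have hq : ∀ (T : ℕ) (q : ℚ), _ := fun T q => (h.isGainDiffusion hY hs hPc hPcov hsde
    (Set.projIcc s (s + T) (hT T) q).2.1).covMatrix_eq hR hSig.posSemidef
  have hP := fun (T : ℕ) (q : ℚ) => hPcov (Set.projIcc s (s + T) (hT T) (q : ℝ))
    (Set.projIcc s (s + T) (hT T) q).2.1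
  filter_upwards [ae_all_iff.2 fun T => ae_all_iff.2 (hq T), ae_all_iff.2 fun T =>
    ae_all_iff.2 (hP T), hPc] with ω h1 h2 h3
  have main : ∀ T : ℕ, P s ω = Q ∧ ∀ u ∈ Set.Icc s (s + T), HasDerivWithinAt
      (fun u => (P u ω).1) (riccPert A R (obsS C Sig) π (P u ω)) (Set.Icc s (s + T)) u := by
    intro T
    have hproj : ∀ {u}, u ∈ Set.Icc s (s + T) → (Set.projIcc s (s + T) (hT T) u : ℝ) = u :=
      fun hu => by rw [Set.projIcc_of_mem (hT T) hu]
    have hpc : Continuous fun u : ℝ => (Set.projIcc s (s + T) (hT T) u : ℝ) :=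
      continuous_subtype_val.comp continuous_projIcc
    have hPω : Continuous fun u => P (Set.projIcc s (s + T) (hT T) u) ω :=
      h3.comp_continuous hpc fun u => (Set.projIcc s (s + T) (hT T) u).2.1
    have hG : Continuous fun u => (π (P (Set.projIcc s (s + T) (hT T) u) ω)).1 * Cᵀ * Sig⁻¹ := by
      have : Continuous fun u => (π (P (Set.projIcc s (s + T) (hT T) u) ω)).1 :=
        continuous_subtype_val.comp (π.continuous.comp hPω)
      fun_prop
    obtain ⟨p, hpc', hps, hp⟩ := exists_lyapunov_solution
      (B := fun u => A - (π (P (Set.projIcc s (s + T) (hT T) u) ω)).1 * Cᵀ * Sig⁻¹ * C)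
      (Ξ := fun u => R + (π (P (Set.projIcc s (s + T) (hT T) u) ω)).1 * Cᵀ * Sig⁻¹ * Sig *
        ((π (P (Set.projIcc s (s + T) (hT T) u) ω)).1 * Cᵀ * Sig⁻¹)ᵀ)
      (by fun_prop) (by fun_prop) (hT T) Q.1
    have hdense : (fun u => (P (Set.projIcc s (s + T) (hT T) u) ω).1) =
        fun u => p (Set.projIcc s (s + T) (hT T) u) := by
      refine Rat.denseRange_cast.equalizer
        (continuous_subtype_val.comp hPω) (hpc'.comp hpc) (funext fun q => ?_)
      simp only [Function.comp]
      set τ := Set.projIcc s (s + T) (hT T) (q : ℝ) with hτ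
      have h4 := h1 T q p hpc' hps (fun w hw => by
        have hw' : w ∈ Set.Icc s (s + T) := ⟨hw.1, hw.2.trans τ.2.2⟩
        have h5 := (hp w hw').mono (Set.Icc_subset_Icc_right τ.2.2)
        rw [hproj hw'] at h5
        rw [Set.projIcc_of_mem τ.2.1 hw]
        exact h5)
      rw [← h4, h2 T q, Set.projIcc_of_mem τ.2.1 ⟨τ.2.1, le_rfl⟩]
      rfl
    have hPp : ∀ u ∈ Set.Icc s (s + T), (P u ω).1 = p u := fun u hu => by
      have := congrFun hdense u
      simpa only [hproj hu] using this
    refine ⟨Subtype.ext ((hPp s ⟨le_rfl, hT T⟩).trans hps), fun u hu => ?_⟩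
    have h5 := (hp u hu).congr hPp (hPp u hu)
    rw [hproj hu, ← hPp u hu, lyap_gain_eq_riccPert A R C hSig] at h5
    exact h5
  refine ⟨by simpa using (main 0).1, fun t ht => ?_⟩
  obtain ⟨T, hT'⟩ := exists_nat_gt t
  have h4 := (main T).2 (s + t) ⟨by linarith, by linarith⟩
  have h5 : HasDerivWithinAt (fun u : ℝ => s + u) 1 (Set.Icc 0 T) t :=
    ((hasDerivAt_id t).const_add s).hasDerivWithinAt
  have h6 := h4.scomp t h5 fun u hu => ⟨by linarith [hu.1], by linarith [hu.2]⟩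
  rw [one_smul] at h6
  refine h6.mono_of_mem_nhdsWithin ?_
  filter_upwards [self_mem_nhdsWithin, mem_nhdsWithin_of_mem_nhds (Iic_mem_nhds hT')]
    with u hu hu'
  exact ⟨hu, hu'⟩

/-- The conditional law of the nonlinear diffusion is Gaussian: the mean is the filter and the
covariance is the flow of the perturbed Riccati equation. -/
theorem IsDiffusion.condLaw_eq [IsProbabilityMeasure μ]
    (h : IsDiffusion A R C Sig μ X Y Wb Vb π s x Q Z) (hR : R.PosSemidef) (hSig : Sig.PosDef)
    (hY : ∀ t : ℝ, 0 ≤ t → Measurable (Y t)) (hs : 0 ≤ s) {K : ℝ → PSD r}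
    (hK : ∀ P : ℝ → PSD r, IsSolution (riccPert A R (obsS C Sig) π) Q P →
      ∀ u, s ≤ u → P (u - s) = K u) {ψ : ℝ → Ω → Vec r}
    (hψ : IsFilter A C Sig μ Y (fun u => π (K u)) s x ψ) {t : ℝ} (hst : s ≤ t) :
    ∀ᵐ ω ∂μ, condLaw μ Y s t Z ω = multivariateGaussian (ψ t ω) (K t).1 := by
  obtain ⟨P, hPc, hPcov, hsde⟩ := h.sde
  have hsol := h.isSolution hR hSig hY hs hPc hPcov hsde
  have hPK : ∀ᵐ ω ∂μ, ∀ u, s ≤ u → P u ω = K u := by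
    filter_upwards [hsol] with ω h1 u hu
    have := hK _ h1 u hu
    simpa using this
  have hG := h.isGainDiffusion hY hs hPc hPcov hsde hst
  have hproj : ∀ {u}, u ∈ Set.Icc s t → (Set.projIcc s t hst u : ℝ) = u := fun hu => by
    rw [Set.projIcc_of_mem hst hu]
  have hps : (Set.projIcc s t hst s : ℝ) = s := hproj ⟨le_rfl, hst⟩
  have hpt : (Set.projIcc s t hst t : ℝ) = t := hproj ⟨hst, le_rfl⟩
  have hpc : Continuous fun u : ℝ => (Set.projIcc s t hst u : ℝ) :=
    continuous_subtype_val.comp continuous_projIcc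
  have hlaw := hG.condDistrib_eq hR hSig.posSemidef
    (ψ := fun u => ψ (Set.projIcc s t hst u))
    (by
      filter_upwards [hψ.cont] with ω hω
      exact hω.comp_continuous hpc fun u => (Set.projIcc s t hst u).2.1)
    (by simpa only [hps] using hψ.init)
    (fun t' ht' => by
      refine (hψ.sde t' ht'.1).congr ht'.1 ?_ (fun ω u hu => ?_) fun ω => ?_
      · filter_upwards [hPK] with ω hω u hu
        rw [hproj ⟨hu.1, hu.2.trans ht'.2⟩, hω u hu.1]
      · have hu' : u ∈ Set.Icc s t := ⟨hu.1, hu.2.trans ht'.2⟩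
        rw [hproj hu', integral_comp_projIcc (fun w => act C (ψ w ω)) hst hu']
      · rw [hproj ht', hps, integral_comp_projIcc (fun w => act A (ψ w ω)) hst ht'])
  filter_upwards [hlaw, hsol, hPc, hPK] with ω h1 h2 h3 h4
  have h5 := h1 (fun u => (P (max s u) ω).1)
    (continuous_subtype_val.comp (h3.comp_continuous (by fun_prop) fun u => le_max_left s u))
    (by
      have := h2.1
      simp only [add_zero] at this
      simp [this])
    (fun τ hτ => by
      have h6 := h2.2 (τ - s) (by linarith [hτ.1])
      have h7 : HasDerivWithinAt (fun u : ℝ => u - s) 1 (Set.Icc s t) τ :=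
        ((hasDerivAt_id τ).sub_const s).hasDerivWithinAt
      have h8 := h6.scomp τ h7 fun u hu => by
        simpa using hu.1
      rw [one_smul] at h8
      simp only [add_sub_cancel] at h8
      have h9 : ∀ u ∈ Set.Icc s t, (P (max s u) ω).1 =
          ((fun u => (P (s + u) ω).1) ∘ fun u => u - s) u := fun u hu => by
        simp [max_eq_right hu.1]
      have h10 := h8.congr h9 (h9 τ hτ)
      rw [hproj hτ, max_eq_right hτ.1, lyap_gain_eq_riccPert A R C hSig]
      exact h10) (P (max s t) ω).2
  rw [max_eq_right hst, h4 t hst] at h5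
  rw [condLaw]
  simpa only [hpt] using h5

end Diffusion

/-! ### Stability of the Riccati flow under perturbations -/

section Flows

variable {r : ℕ} {A R S : Mat r r} {Q : PSD r} {P Pπ : ℝ → PSD r} {π : C(PSD r, PSD r)}

lemma PSD.isSymm (Q : PSD r) : Q.1.IsSymm := (posSemidef_iff_inner_act.1 Q.2).1

lemma riccPert_eq (A R : Mat r r) (hS : S.IsSymm) (π : C(PSD r, PSD r)) (Q : PSD r) :
    riccPert A R S π Q = ricc A R S Q + ((π Q).1 - Q.1) * S * ((π Q).1 - Q.1) := by
  rw [riccPert, ricc, Matrix.transpose_sub, Matrix.transpose_mul, hS.eq, (π Q).isSymm.eq]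
  simp only [sub_mul, mul_sub, Matrix.mul_assoc]
  abel

lemma riccPert_id (A R : Mat r r) (hS : S.IsSymm) :
    riccPert A R S (ContinuousMap.id (PSD r)) = ricc A R S := by
  funext Q
  rw [riccPert_eq A R hS]
  simp

lemma IsSolution.hasDerivWithinAt_Icc {F : PSD r → Mat r r} (h : IsSolution F Q P) (t : ℝ) :
    ∀ u ∈ Set.Icc 0 t, HasDerivWithinAt (fun u => (P u).1) (F (P u)) (Set.Icc 0 t) u :=
  fun u hu => (h.2 u hu.1).mono Set.Icc_subset_Ici_self

lemma flow_eq {F : PSD r → Mat r r} (h : IsSolution F Q P)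
    (huniq : ∀ P₁ P₂, IsSolution F Q P₁ → IsSolution F Q P₂ → ∀ t : ℝ, 0 ≤ t → P₁ t = P₂ t)
    {s t : ℝ} (hst : s ≤ t) : flow F s t Q = P (t - s) := by
  have hex : ∃ P, IsSolution F Q P := ⟨P, h⟩
  rw [flow, dif_pos hex]
  exact huniq _ _ hex.choose_spec h _ (by linarith)

/-- The perturbation of the drift is nonnegative, so that the perturbed flow dominates. -/
theorem IsSolution.le_pert (hS : S.PosSemidef) (hP : IsSolution (ricc A R S) Q P)
    (hπ : IsSolution (riccPert A R S π) Q Pπ) {t : ℝ} (ht : 0 ≤ t) : (P t).1 ≤ (Pπ t).1 := by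
  obtain ⟨hSs, hSn⟩ := posSemidef_iff_inner_act.1 hS
  refine riccati_comparison (A := A) (R := R) hSs (U := fun u => (Pπ u).1) (L := fun u => (P u).1)
    (E₁ := fun u => ((π (Pπ u)).1 - (Pπ u).1) * S * ((π (Pπ u)).1 - (Pπ u).1)) (E₂ := fun _ => 0)
    ht (fun u hu => ?_) (fun u hu => ?_) (fun u _ => (Pπ u).isSymm) (fun u _ => (P u).isSymm)
    (fun u _ y => ?_) ?_
  · have h := hπ.hasDerivWithinAt_Icc t u hu
    rw [riccPert_eq A R hSs] at h
    exact h
  · have h := hP.hasDerivWithinAt_Icc t u hu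
    rw [add_zero]
    exact h
  · rw [act_zero_left, inner_zero_right, act_mul, act_mul, inner_act, Matrix.transpose_sub,
      (π (Pπ u)).isSymm.eq, (Pπ u).isSymm.eq]
    exact hSn _
  · simp only [hP.1, hπ.1, le_refl]

lemma IsSolution.unique_ricc (hS : S.PosSemidef) {P₁ P₂ : ℝ → PSD r}
    (h₁ : IsSolution (ricc A R S) Q P₁) (h₂ : IsSolution (ricc A R S) Q P₂) (t : ℝ) (ht : 0 ≤ t) :
    P₁ t = P₂ t := by
  have hid := riccPert_id A R (posSemidef_iff_inner_act.1 hS).1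
  exact Subtype.ext (le_antisymm (h₁.le_pert hS (hid.symm ▸ h₂) ht)
    (h₂.le_pert hS (hid.symm ▸ h₁) ht))

/-- If the perturbation of the drift is at most `κ R`, then `(1 + κ) P` is a supersolution of the
perturbed equation. -/
theorem IsSolution.pert_le (hS : S.PosSemidef) {κ : ℝ} (hκ : 0 ≤ κ)
    (hΓ : ∀ (Q : PSD r) (y : Vec r),
      inner ℝ y (act (((π Q).1 - Q.1) * S * ((π Q).1 - Q.1)) y) ≤ κ * inner ℝ y (act R y))
    (hP : IsSolution (ricc A R S) Q P) (hπ : IsSolution (riccPert A R S π) Q Pπ) {t : ℝ}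
    (ht : 0 ≤ t) : (Pπ t).1 ≤ (1 + κ) • (P t).1 := by
  obtain ⟨hSs, hSn⟩ := posSemidef_iff_inner_act.1 hS
  refine riccati_comparison (A := A) (R := R) hSs (U := fun u => (1 + κ) • (P u).1)
    (L := fun u => (Pπ u).1)
    (E₁ := fun u => (κ * (1 + κ)) • ((P u).1 * S * (P u).1) + κ • R)
    (E₂ := fun u => ((π (Pπ u)).1 - (Pπ u).1) * S * ((π (Pπ u)).1 - (Pπ u).1))
    ht (fun u hu => ?_) (fun u hu => ?_) (fun u _ => (P u).isSymm.smul _)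
    (fun u _ => (Pπ u).isSymm) (fun u _ y => ?_) ?_
  · have h := (hP.hasDerivWithinAt_Icc t u hu).const_smul (1 + κ)
    refine h.congr_deriv ?_
    simp only [ricc, Matrix.smul_mul, Matrix.mul_smul]
    module
  · have h := hπ.hasDerivWithinAt_Icc t u hu
    rw [riccPert_eq A R hSs] at h
    exact h
  · refine (hΓ (Pπ u) y).trans ?_
    rw [act_add_left, act_smul_left, act_smul_left, inner_add_right, inner_smul_right,
      inner_smul_right, act_mul, act_mul, inner_act (P u).1 y, (P u).isSymm.eq]
    have := mul_nonneg (mul_nonneg hκ (by linarith : 0 ≤ 1 + κ)) (hSn (act (P u).1 y))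
    linarith
  · simp only [hP.1, hπ.1]
    have h1 : (1 + κ) • Q.1 - Q.1 = κ • Q.1 := by module
    rw [Matrix.le_iff, h1]
    exact Q.2.smul hκ

theorem IsSolution.lower_bound (hr : 1 ≤ r) (hR : R.PosSemidef) (hS : S.PosSemidef)
    {v cMinus oPlus : ℝ} (hv : 0 < v) (hcMinus : 0 < cMinus)
    (hC : cMinus • (1 : Mat r r) ≤ gramC A R v)
    (hO : gramOC A R S v ≤ oPlus • (1 : Mat r r)) (hP : IsSolution (ricc A R S) Q P) {t : ℝ}
    (ht : v ≤ t) : 0 < oPlus + 1 / cMinus ∧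
      ∀ y, (oPlus + 1 / cMinus)⁻¹ * ‖y‖ ^ 2 ≤ inner ℝ y (act (P t).1 y) := by
  have h := riccati_lower_bound hr hR hS hv hcMinus hC hO (P := fun u => (P (t - v + u)).1)
    (fun u hu => by
      have h1 := hP.2 (t - v + u) (by linarith [hu.1])
      have h2 : HasDerivWithinAt (fun u : ℝ => t - v + u) 1 (Set.Icc 0 v) u :=
        ((hasDerivAt_id u).const_add (t - v)).hasDerivWithinAt
      have h3 := h1.scomp u h2 fun w hw => by
        have := hw.1
        simp only [Set.mem_Ici]
        linarith
      rw [one_smul] at h3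
      exact h3)
    (fun u _ => (P _).isSymm) (P _).2
  simpa only [sub_add_cancel] using h

lemma exists_pos_le_inner_act (hR : R.PosDef) :
    ∃ ρ : ℝ, 0 < ρ ∧ ∀ y : Vec r, ρ * ‖y‖ ^ 2 ≤ inner ℝ y (act R y) := by
  obtain ⟨hRs, hRn⟩ := posSemidef_iff_inner_act.1 hR.posSemidef
  have hinv : R * R⁻¹ = 1 :=
    Matrix.mul_nonsing_inv _ ((Matrix.isUnit_iff_isUnit_det _).1 hR.isUnit)
  set l : ℝ := (‖R⁻¹‖ + 1)⁻¹ with hl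
  have hl0 : 0 < l := by positivity
  have hl1 : l * ‖R⁻¹‖ ≤ 1 := by
    rw [hl, inv_mul_le_iff₀ (by positivity)]
    linarith
  refine ⟨l, hl0, fun y => ?_⟩
  -- expand the quadratic form at `y - l R⁻¹ y`
  have h1 := hRn (y - l • act R⁻¹ y)
  have h2 : act R (act R⁻¹ y) = y := by rw [← act_mul, hinv, act_one]
  have h3 : inner ℝ (act R⁻¹ y) (act R y) = ‖y‖ ^ 2 := by
    rw [inner_act, hRs.eq, h2, real_inner_self_eq_norm_sq]
  have h4 : inner ℝ (act R⁻¹ y) y ≤ ‖R⁻¹‖ * ‖y‖ ^ 2 := by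
    refine (real_inner_le_norm _ _).trans ?_
    rw [pow_two, ← mul_assoc]
    exact mul_le_mul_of_nonneg_right (norm_act_le _ _) (norm_nonneg y)
  rw [act_sub_right, act_smul_right, h2, inner_sub_left, inner_sub_right, inner_sub_right,
    inner_smul_left, inner_smul_left, inner_smul_right, inner_smul_right, h3,
    real_inner_self_eq_norm_sq] at h1
  simp only [conj_trivial] at h1
  have h5 : l * (l * inner ℝ (act R⁻¹ y) y) ≤ l * ‖y‖ ^ 2 := by
    refine mul_le_mul_of_nonneg_left ?_ hl0.le
    calc l * inner ℝ (act R⁻¹ y) y ≤ l * (‖R⁻¹‖ * ‖y‖ ^ 2) := by gcongr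
      _ = l * ‖R⁻¹‖ * ‖y‖ ^ 2 := by ring
      _ ≤ 1 * ‖y‖ ^ 2 := by gcongr
      _ = ‖y‖ ^ 2 := one_mul _
  linarith

/-- Perturbations close to the identity change the Riccati drift by at most `κ R`. -/
lemma exists_radius (hR : R.PosDef) (S : Mat r r) {κ : ℝ} (hκ : 0 < κ) :
    ∃ δ : ℝ, 0 < δ ∧ ∀ Δ : Mat r r, Δ.IsSymm → ‖Δ‖ ≤ δ →
      ∀ y : Vec r, inner ℝ y (act (Δ * S * Δ) y) ≤ κ * inner ℝ y (act R y) := by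
  obtain ⟨ρ, hρ, hρR⟩ := exists_pos_le_inner_act hR
  refine ⟨√(κ * ρ / (‖S‖ + 1)), by positivity, fun Δ hΔ hΔδ y => ?_⟩
  have h1 : ‖Δ‖ ^ 2 ≤ κ * ρ / (‖S‖ + 1) := by
    rw [← Real.sq_sqrt (show 0 ≤ κ * ρ / (‖S‖ + 1) by positivity)]
    gcongr
  calc inner ℝ y (act (Δ * S * Δ) y) = inner ℝ (act Δ y) (act S (act Δ y)) := by
        rw [act_mul, act_mul, inner_act, hΔ.eq]
    _ ≤ ‖act Δ y‖ * ‖act S (act Δ y)‖ := real_inner_le_norm _ _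
    _ ≤ ‖act Δ y‖ * (‖S‖ * ‖act Δ y‖) := by gcongr; exact norm_act_le _ _
    _ = ‖S‖ * ‖act Δ y‖ ^ 2 := by ring
    _ ≤ (‖S‖ + 1) * (‖Δ‖ * ‖y‖) ^ 2 := by
        gcongr
        · linarith
        · exact norm_act_le _ _
    _ = (‖S‖ + 1) * ‖Δ‖ ^ 2 * ‖y‖ ^ 2 := by ring
    _ ≤ (‖S‖ + 1) * (κ * ρ / (‖S‖ + 1)) * ‖y‖ ^ 2 := by gcongr
    _ = κ * (ρ * ‖y‖ ^ 2) := by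
        have : (‖S‖ + 1 : ℝ) ≠ 0 := by positivity
        field_simp
    _ ≤ κ * inner ℝ y (act R y) := by
        gcongr
        exact hρR y

end Flows

/-! ### Relative entropy of Gaussian measures -/

section RelativeEntropy

open InformationTheory

lemma klDiv_prod_le {α β : Type*} [MeasurableSpace α] [MeasurableSpace β] (μ μ' : Measure α)
    (ν ν' : Measure β) [IsProbabilityMeasure μ] [IsProbabilityMeasure μ'] [IsProbabilityMeasure ν]
    [IsProbabilityMeasure ν'] :
    klDiv (μ.prod ν) (μ'.prod ν') ≤ klDiv μ μ' + klDiv ν ν' := by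
  rw [← Measure.compProd_const, ← Measure.compProd_const, klDiv_compProd_eq_add]
  gcongr
  rw [Measure.compProd_const, Measure.compProd_const, ← Measure.prod_swap (μ := ν) (ν := μ),
    ← Measure.prod_swap (μ := ν') (ν := μ)]
  refine (klDiv_map_le _ _ measurable_swap).trans ?_
  rw [← Measure.compProd_const, ← Measure.compProd_const, klDiv_compProd_left]

lemma klDiv_pi_le : ∀ {n : ℕ} (μ ν : Fin n → Measure ℝ) [∀ i, IsProbabilityMeasure (μ i)]
    [∀ i, IsProbabilityMeasure (ν i)],
    klDiv (Measure.pi μ) (Measure.pi ν) ≤ ∑ i, klDiv (μ i) (ν i)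
  | 0, μ, ν, _, _ => by
    have : Measure.pi μ = Measure.pi ν := by
      rw [Measure.pi_of_empty, Measure.pi_of_empty]
    rw [this, klDiv_self]
    simp
  | n + 1, μ, ν, _, _ => by
    rw [Fin.sum_univ_succ,
      ← ((measurePreserving_piFinSuccAbove μ 0).symm).map_eq,
      ← ((measurePreserving_piFinSuccAbove ν 0).symm).map_eq]
    refine (klDiv_map_le _ _ (MeasurableEquiv.measurable _)).trans ?_
    refine (klDiv_prod_le _ _ _ _).trans ?_
    gcongr
    exact klDiv_pi_le (fun i => μ i.succ) (fun i => ν i.succ)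

lemma klDiv_gaussianReal (a : ℝ) {d : ℝ≥0} (hd : d ≠ 0) :
    klDiv (gaussianReal a d) (gaussianReal 0 1) =
      ENNReal.ofReal ((a ^ 2 + (d - 1) - Real.log d) / 2) := by
  have hd0 : (0 : ℝ) < d := by positivity
  let g : ℝ → ℝ := fun x => x ^ 2 / 2 - (x - a) ^ 2 / (2 * d) - Real.log d / 2
  have hg : Measurable g := by fun_prop
  -- the density of `N(a, d)` with respect to `N(0, 1)` is `exp g`
  have hdens : gaussianReal a d =
      (gaussianReal 0 1).withDensity fun x => ENNReal.ofReal (Real.exp (g x)) := by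
    rw [gaussianReal_of_var_ne_zero a hd, gaussianReal_of_var_ne_zero 0 one_ne_zero,
      ← withDensity_mul _ (measurable_gaussianPDF 0 1) (by fun_prop)]
    congr 1
    funext x
    rw [Pi.mul_apply, gaussianPDF, gaussianPDF, ← ENNReal.ofReal_mul (gaussianPDFReal_nonneg _ _ _)]
    congr 1
    rw [gaussianPDFReal_def, gaussianPDFReal_def]
    have h1 : (√(2 * Real.pi * d))⁻¹ = (√(2 * Real.pi))⁻¹ * Real.exp (-(Real.log d / 2)) := by
      rw [Real.sqrt_mul (by positivity), mul_inv, Real.exp_neg, ← Real.log_sqrt hd0.le,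
        Real.exp_log (by positivity)]
    simp only [h1, NNReal.coe_one, mul_one, sub_zero]
    rw [mul_assoc, mul_assoc, ← Real.exp_add, ← Real.exp_add]
    congr 2
    simp only [g]
    ring
  have hac : gaussianReal a d ≪ gaussianReal 0 1 := by
    rw [hdens]
    exact withDensity_absolutelyContinuous _ _
  have hllr : llr (gaussianReal a d) (gaussianReal 0 1) =ᵐ[gaussianReal a d] g := by
    refine hac.ae_le ?_
    have h1 := Measure.rnDeriv_withDensity (gaussianReal 0 1)
      (f := fun x => ENNReal.ofReal (Real.exp (g x))) (by fun_prop)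
    rw [← hdens] at h1
    filter_upwards [h1] with x hx
    rw [llr_def]
    simp only [hx, ENNReal.toReal_ofReal (Real.exp_pos _).le, Real.log_exp]
  have hmem : MemLp (fun x : ℝ => x) 2 (gaussianReal a d) := memLp_id_gaussianReal' 2 (by simp)
  have hint1 : Integrable (fun x : ℝ => x ^ 2) (gaussianReal a d) := hmem.integrable_sq
  have hint2 : Integrable (fun x : ℝ => (x - a) ^ 2) (gaussianReal a d) :=
    (hmem.sub (memLp_const a)).integrable_sq
  have hvar := variance_fun_id_gaussianReal (μ := a) (v := d)
  have hI2 : ∫ x, (x - a) ^ 2 ∂gaussianReal a d = d := by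
    rw [variance_eq_integral measurable_id'.aemeasurable, integral_id_gaussianReal] at hvar
    exact hvar
  have hI1 : ∫ x, x ^ 2 ∂gaussianReal a d = a ^ 2 + d := by
    rw [variance_eq_sub hmem, integral_id_gaussianReal] at hvar
    have h1 : ∫ x, ((fun x : ℝ => x) ^ 2) x ∂gaussianReal a d =
      ∫ x, x ^ 2 ∂gaussianReal a d := rfl
    rw [h1] at hvar
    linarith
  have hgint : Integrable g (gaussianReal a d) :=
    ((hint1.div_const 2).sub (hint2.div_const (2 * d))).sub (integrable_const _)
  rw [klDiv_of_ac_of_integrable hac ((integrable_congr hllr).2 hgint), integral_congr_ae hllr]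
  congr 1
  simp only [g]
  have hdiff : Integrable (fun x : ℝ => x ^ 2 / 2 - (x - a) ^ 2 / (2 * d)) (gaussianReal a d) :=
    (hint1.div_const 2).sub (hint2.div_const (2 * d))
  rw [integral_sub hdiff (integrable_const _), integral_sub (hint1.div_const 2)
    (hint2.div_const (2 * d)), integral_div, integral_div, hI1, hI2]
  simp only [integral_const, probReal_univ, smul_eq_mul, one_mul]
  field_simp
  ring

variable {r : ℕ}

/-- A Gaussian measure as the affine image of a product of one-dimensional Gaussian measures. -/
lemma multivariateGaussian_eq_map {P T : Mat r r} {d : Fin r → ℝ≥0} (hP : P.PosSemidef)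
    (hT : T * Matrix.diagonal (fun i => (d i : ℝ)) * Tᵀ = P) (m a : Vec r) :
    multivariateGaussian (m + act T a) P =
      (Measure.pi fun i => gaussianReal (a i) (d i)).map
        fun z => m + act T (WithLp.toLp 2 z) := by
  have hc : Continuous fun z : Vec r => m + act T z :=
    continuous_const.add (continuous_const.act continuous_id)
  have hL : Measurable (WithLp.toLp 2 : (Fin r → ℝ) → Vec r) := by fun_prop
  have hcomp : (fun z : Fin r → ℝ => m + act T (WithLp.toLp 2 z)) =
      (fun z : Vec r => m + act T z) ∘ WithLp.toLp 2 := rfl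
  rw [hcomp, ← Measure.map_map hc.measurable hL]
  have h1 := Measure.isProbabilityMeasure_map
    (μ := Measure.pi fun i => gaussianReal (a i) (d i)) hL.aemeasurable
  have h2 := Measure.isProbabilityMeasure_map
    (μ := (Measure.pi fun i => gaussianReal (a i) (d i)).map (WithLp.toLp 2 :
      (Fin r → ℝ) → Vec r)) hc.measurable.aemeasurable
  refine Measure.ext_of_charFun (funext fun u => ?_)
  rw [charFun_multivariateGaussian hP, charFun_apply,
    integral_map hc.measurable.aemeasurable (by fun_prop)]
  have h3 : ∀ z : Vec r, Complex.exp ((inner ℝ (m + act T z) u : ℝ) * Complex.I) =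
      Complex.exp ((inner ℝ u m : ℝ) * Complex.I) *
        Complex.exp ((inner ℝ z (act Tᵀ u) : ℝ) * Complex.I) := by
    intro z
    rw [← Complex.exp_add, real_inner_comm, inner_add_right, inner_act, real_inner_comm z]
    congr 1
    push_cast
    ring
  simp only [h3]
  rw [integral_const_mul, ← charFun_apply, charFun_pi, Finset.prod_congr rfl fun i _ =>
    charFun_gaussianReal (μ := a i) (v := d i) (act Tᵀ u i), ← Complex.exp_sum, ← Complex.exp_add]
  congr 1
  have h4 : inner ℝ u (act T a) = ∑ i, act Tᵀ u i * a i := by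
    rw [inner_act, PiLp.inner_apply]
    refine Finset.sum_congr rfl fun i _ => ?_
    simp [mul_comm]
  have h5 : (u : Fin r → ℝ) ⬝ᵥ P *ᵥ u = ∑ i, d i * act Tᵀ u i ^ 2 := by
    rw [← inner_act_eq_dotProduct, ← hT, act_mul, act_mul, inner_act, PiLp.inner_apply]
    refine Finset.sum_congr rfl fun i _ => ?_
    have h6 : act (Matrix.diagonal fun i => (d i : ℝ)) (act Tᵀ u) i = d i * act Tᵀ u i := by
      simp [act, Matrix.mulVec_diagonal]
    rw [h6]
    simp
    ring
  rw [Finset.sum_sub_distrib, inner_add_right, h4, h5]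
  push_cast
  rw [add_mul, Finset.sum_mul, Finset.sum_div]
  ring

lemma sub_log_one_add_le {x : ℝ} (hx : 0 ≤ x) : x - Real.log (1 + x) ≤ x ^ 2 / 2 := by
  have h1 := Real.le_log_one_add_of_nonneg hx
  have h2 : x - x ^ 2 / 2 ≤ 2 * x / (x + 2) := by
    rw [le_div_iff₀ (by linarith)]
    nlinarith [pow_nonneg hx 3]
  linarith

/-- Two symmetric matrices, the second one positive definite, are simultaneously diagonal in some
basis, which is orthonormal for the second one. -/
lemma exists_simultaneous_diagonal {P₁ P₂ : Mat r r} (hP₁ : P₁.IsSymm) (hP₂ : P₂.PosDef) :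
    ∃ (T : Mat r r) (d : Fin r → ℝ), IsUnit T.det ∧ T * Tᵀ = P₂ ∧
      T * Matrix.diagonal d * Tᵀ = P₁ := by
  set B := CFC.sqrt P₂ with hB
  have hBs : Bᵀ = B := (posSemidef_iff_inner_act.1
    (Matrix.nonneg_iff_posSemidef.1 (CFC.sqrt_nonneg P₂))).1
  have hBB : B * B = P₂ := CFC.sqrt_mul_sqrt_self P₂ hP₂.posSemidef.nonneg
  have hBdet : IsUnit B.det := by
    have h1 : IsUnit (B * B).det := by
      rw [hBB]
      exact (Matrix.isUnit_iff_isUnit_det _).1 hP₂.isUnit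
    rw [Matrix.det_mul] at h1
    exact isUnit_of_mul_isUnit_left h1
  have hBi : B * B⁻¹ = 1 := Matrix.mul_nonsing_inv _ hBdet
  have hBi' : B⁻¹ * B = 1 := Matrix.nonsing_inv_mul _ hBdet
  have hH : (B⁻¹ * P₁ * B⁻¹).IsHermitian := by
    rw [Matrix.IsHermitian, Matrix.conjTranspose_eq_transpose_of_trivial, Matrix.transpose_mul,
      Matrix.transpose_mul, Matrix.transpose_nonsing_inv, hBs, hP₁.eq, Matrix.mul_assoc]
  set U : Mat r r := hH.eigenvectorUnitary.1 with hU
  have hUU : U * Uᵀ = 1 := by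
    have := Unitary.coe_mul_star_self hH.eigenvectorUnitary
    rwa [Unitary.coe_star, Matrix.star_eq_conjTranspose,
      Matrix.conjTranspose_eq_transpose_of_trivial] at this
  have hspec : U * Matrix.diagonal hH.eigenvalues * Uᵀ = B⁻¹ * P₁ * B⁻¹ := by
    have h1 := hH.spectral_theorem
    rw [Unitary.conjStarAlgAut_apply] at h1
    exact h1.symm
  refine ⟨B * U, hH.eigenvalues, ?_, ?_, ?_⟩
  · rw [Matrix.det_mul]
    refine hBdet.mul ?_
    have h1 : IsUnit (U * Uᵀ).det := by simp [hUU]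
    rw [Matrix.det_mul] at h1
    exact isUnit_of_mul_isUnit_left h1
  · rw [Matrix.transpose_mul, hBs, Matrix.mul_assoc, ← Matrix.mul_assoc U, hUU, Matrix.one_mul,
      hBB]
  · rw [Matrix.transpose_mul, hBs]
    calc B * U * Matrix.diagonal hH.eigenvalues * (Uᵀ * B) =
        B * (U * Matrix.diagonal hH.eigenvalues * Uᵀ) * B := by simp only [Matrix.mul_assoc]
      _ = (B * B⁻¹) * P₁ * (B⁻¹ * B) := by rw [hspec]; simp only [Matrix.mul_assoc]
      _ = P₁ := by rw [hBi, hBi', Matrix.one_mul, Matrix.mul_one]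

/-- Entropy of Gaussian laws whose covariances are close in the sense `P₂ ≤ P₁ ≤ (1 + 1/r) P₂`. In
coordinates where `P₂ = 1` and `P₁ = diag d`, each of the `r` directions costs at most
`(a² + (d - 1)² / 2) / 2`, and `(d - 1)² ≤ (d - 1) / r`. -/
theorem klDiv_multivariateGaussian_le (hr : 1 ≤ r) {P₁ P₂ : Mat r r} {c : ℝ} (hc : 0 < c)
    (hP₁ : P₁.PosSemidef) (hP₂ : P₂.PosSemidef)
    (hlow : ∀ y, c⁻¹ * ‖y‖ ^ 2 ≤ inner ℝ y (act P₂ y)) (h₁ : P₂ ≤ P₁)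
    (h₂ : P₁ ≤ (1 + (1 / r : ℝ)) • P₂) (m₁ m₂ : Vec r) :
    klDiv (multivariateGaussian m₁ P₁) (multivariateGaussian m₂ P₂) ≤
      ENNReal.ofReal (1 / 2 * c * (‖m₁ - m₂‖ ^ 2 + 5 / 2 * √(r : ℝ) * ‖P₂ - P₁‖)) := by
  have hr0 : (1 : ℝ) ≤ r := by exact_mod_cast hr
  have hPD : P₂.PosDef := by
    rw [Matrix.posDef_iff_dotProduct_mulVec]
    refine ⟨hP₂.isHermitian, fun x hx => ?_⟩
    have h := hlow (WithLp.toLp 2 x)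
    rw [inner_act_eq_dotProduct] at h
    refine lt_of_lt_of_le ?_ h
    have : (0 : ℝ) < ‖(WithLp.toLp 2 x : Vec r)‖ := by
      rw [norm_pos_iff]
      intro h0
      exact hx (by simpa using h0)
    positivity
  obtain ⟨T, d, hTdet, hT₂, hT₁⟩ :=
    exists_simultaneous_diagonal (posSemidef_iff_inner_act.1 hP₁).1 hPD
  have hTi : T * T⁻¹ = 1 := Matrix.mul_nonsing_inv _ hTdet
  have hTi' : Tᵀ * (T⁻¹)ᵀ = 1 := by
    rw [← Matrix.transpose_mul, Matrix.nonsing_inv_mul _ hTdet, Matrix.transpose_one]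
  -- the quadratic forms at `z = T'⁻¹ y`
  have hq₂ : ∀ y : Vec r, inner ℝ (act (T⁻¹)ᵀ y) (act P₂ (act (T⁻¹)ᵀ y)) = ‖y‖ ^ 2 := fun y => by
    rw [← hT₂, act_mul, inner_act, ← act_mul, hTi', act_one, real_inner_self_eq_norm_sq]
  have hq₁ : ∀ y : Vec r, inner ℝ (act (T⁻¹)ᵀ y) (act P₁ (act (T⁻¹)ᵀ y)) =
      inner ℝ y (act (Matrix.diagonal d) y) := fun y => by
    rw [← hT₁, act_mul, act_mul, inner_act, ← act_mul Tᵀ, hTi', act_one]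
  have hz : ∀ y : Vec r, ‖act (T⁻¹)ᵀ y‖ ^ 2 ≤ c * ‖y‖ ^ 2 := fun y => by
    have := hlow (act (T⁻¹)ᵀ y)
    rwa [hq₂, inv_mul_le_iff₀ hc] at this
  have hd : ∀ i, 1 ≤ d i ∧ d i ≤ 1 + 1 / r ∧ d i - 1 ≤ c * ‖P₂ - P₁‖ := by
    intro i
    let e : Vec r := EuclideanSpace.single i 1
    have he : ‖e‖ = 1 := by simp [e]
    have hde : inner ℝ e (act (Matrix.diagonal d) e) = d i := by
      have : act (Matrix.diagonal d) e i = d i := by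
        simp [act, Matrix.mulVec_diagonal, e]
      rw [EuclideanSpace.inner_single_left, this]
      simp
    have e1 := inner_act_le_of_le h₁ (act (T⁻¹)ᵀ e)
    have e2 := inner_act_le_of_le h₂ (act (T⁻¹)ᵀ e)
    have e3 := hz e
    rw [hq₂, hq₁, hde, he] at e1
    rw [act_smul_left, inner_smul_right, hq₂, hq₁, hde, he] at e2
    rw [he] at e3
    refine ⟨by linarith, by linarith, ?_⟩
    have e4 : d i - 1 = inner ℝ (act (T⁻¹)ᵀ e) (act (P₁ - P₂) (act (T⁻¹)ᵀ e)) := by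
      rw [act_sub_left, inner_sub_right, hq₂, hq₁, hde, he, one_pow]
    rw [e4, norm_sub_rev]
    calc inner ℝ (act (T⁻¹)ᵀ e) (act (P₁ - P₂) (act (T⁻¹)ᵀ e)) ≤
        ‖act (T⁻¹)ᵀ e‖ * (‖P₁ - P₂‖ * ‖act (T⁻¹)ᵀ e‖) :=
          (real_inner_le_norm _ _).trans (by gcongr; exact norm_act_le _ _)
      _ = ‖act (T⁻¹)ᵀ e‖ ^ 2 * ‖P₁ - P₂‖ := by ring
      _ ≤ c * ‖P₁ - P₂‖ := by
          gcongr
          linarith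
  -- the difference of the means in the same coordinates
  set a := act T⁻¹ (m₁ - m₂) with ha
  have hTa : act T a = m₁ - m₂ := by rw [ha, ← act_mul, hTi, act_one]
  have ha2 : ‖a‖ ^ 2 ≤ c * ‖m₁ - m₂‖ ^ 2 := by
    have e1 : ‖a‖ ^ 2 = inner ℝ (act (T⁻¹)ᵀ a) (m₁ - m₂) := by
      rw [← inner_act, ← ha, real_inner_self_eq_norm_sq]
    have e2 := real_inner_le_norm (act (T⁻¹)ᵀ a) (m₁ - m₂)
    have e3 := hz a
    rw [← e1] at e2
    have e4 : (‖a‖ ^ 2) ^ 2 ≤ c * ‖a‖ ^ 2 * ‖m₁ - m₂‖ ^ 2 := by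
      calc (‖a‖ ^ 2) ^ 2 ≤ (‖act (T⁻¹)ᵀ a‖ * ‖m₁ - m₂‖) ^ 2 := by gcongr
        _ = ‖act (T⁻¹)ᵀ a‖ ^ 2 * ‖m₁ - m₂‖ ^ 2 := mul_pow _ _ _
        _ ≤ _ := by gcongr
    rcases (sq_nonneg ‖a‖).eq_or_lt with h0 | h0
    · rw [← h0]
      positivity
    · refine le_of_mul_le_mul_left ?_ h0
      nlinarith
  have hN₁ : multivariateGaussian m₁ P₁ =
      (Measure.pi fun i => gaussianReal (a i) (d i).toNNReal).map
        fun z => m₂ + act T (WithLp.toLp 2 z) := by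
    have h := multivariateGaussian_eq_map (T := T) (d := fun i => (d i).toNNReal) hP₁ (by
      have : (fun i => ((d i).toNNReal : ℝ)) = d := funext fun i =>
        Real.coe_toNNReal _ (zero_le_one.trans (hd i).1)
      rw [this, hT₁]) m₂ a
    rwa [hTa, add_sub_cancel] at h
  have hN₂ : multivariateGaussian m₂ P₂ =
      (Measure.pi fun _ : Fin r => gaussianReal 0 1).map
        fun z => m₂ + act T (WithLp.toLp 2 z) := by
    have h := multivariateGaussian_eq_map (T := T) (d := fun _ => 1) hP₂ (by simpa using hT₂) m₂ 0
    simpa using h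
  have hmeas : Measurable fun z : Fin r → ℝ => m₂ + act T (WithLp.toLp 2 z) := by
    have h1 : Continuous fun z : Vec r => m₂ + act T z :=
      continuous_const.add (continuous_const.act continuous_id)
    exact h1.measurable.comp (by fun_prop)
  have hterm : ∀ i, klDiv (gaussianReal (a i) (d i).toNNReal) (gaussianReal 0 1) ≤
      ENNReal.ofReal ((a i ^ 2 + c * ‖P₂ - P₁‖ / (2 * r)) / 2) := by
    intro i
    obtain ⟨h3, h4, h5⟩ := hd i
    rw [klDiv_gaussianReal (a i) (by simp; linarith), Real.coe_toNNReal _ (by linarith)]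
    refine ENNReal.ofReal_le_ofReal ?_
    have h6 := sub_log_one_add_le (x := d i - 1) (by linarith)
    rw [add_sub_cancel] at h6
    have h7 : (d i - 1) ^ 2 ≤ 1 / r * (c * ‖P₂ - P₁‖) := by
      rw [pow_two]
      gcongr
      linarith
    have h8 : 1 / r * (c * ‖P₂ - P₁‖) / 2 = c * ‖P₂ - P₁‖ / (2 * r) := by
      field_simp
    linarith
  rw [hN₁, hN₂]
  -- entropy does not increase under maps, and for product measures it is at most the sum over the
  -- coordinates
  refine (klDiv_map_le _ _ hmeas).trans ((klDiv_pi_le _ _).trans ?_)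
  refine (Finset.sum_le_sum fun i _ => hterm i).trans ?_
  rw [← ENNReal.ofReal_sum_of_nonneg fun i _ => by positivity]
  refine ENNReal.ofReal_le_ofReal ?_
  rw [← Finset.sum_div, Finset.sum_add_distrib, ← EuclideanSpace.real_norm_sq_eq]
  simp only [Finset.sum_const, Finset.card_univ, Fintype.card_fin, nsmul_eq_mul]
  have h6 : (r : ℝ) * (c * ‖P₂ - P₁‖ / (2 * r)) = c * ‖P₂ - P₁‖ / 2 := by
    field_simp
  rw [h6]
  have h7 : 1 ≤ √(r : ℝ) := Real.one_le_sqrt.2 hr0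
  have h8 : c * ‖P₂ - P₁‖ ≤ √(r : ℝ) * (c * ‖P₂ - P₁‖) :=
    le_mul_of_one_le_left (by positivity) h7
  have h9 : 0 ≤ c * ‖P₂ - P₁‖ := by positivity
  nlinarith

end RelativeEntropy

end KalmanBucy

open KalmanBucy in
theorem theorem3p3 {r r' : ℕ} (hr : 1 ≤ r) (A R : Mat r r) (C : Mat r' r) (Sig : Mat r' r')
    (hR : R.PosDef) (hSig : Sig.PosDef) (hobs : Observable A C)
    (v cMinus oPlus : ℝ) (hv : 0 < v) (hcMinus : 0 < cMinus)
    (hC : cMinus • (1 : Mat r r) ≤ gramC A R v)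
    (hO : gramOC A R (obsS C Sig) v ≤ oPlus • (1 : Mat r r))
    (Pert : Set C(PSD r, PSD r))
    (hwp : ∀ π ∈ Pert, WellPosed (riccPert A R (obsS C Sig) π))
    (B₀ B₁ B₂ : C(PSD r, PSD r) → Mat r r) (Rem : C(PSD r, PSD r) → PSD r → Mat r r)
    (H0 : QuadraticPert A R (obsS C Sig) Pert B₀ B₁ B₂ Rem)
    (H2 : ContinuousAtId A R (obsS C Sig) Pert B₀ B₁ B₂ Rem) :
    ∃ δ : ℝ, 0 < δ ∧ ∀ π ∈ nearId Pert δ, ∀ s t : ℝ, 0 ≤ s → s + v ≤ t →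
      ∀ (x : Vec r) (Q : PSD r)
        (Ω : Type*) [MeasurableSpace Ω] (μ : Measure Ω) [IsProbabilityMeasure μ]
        (W : ℝ → Ω → Vec r) (V : ℝ → Ω → Vec r') (X : ℝ → Ω → Vec r) (Y : ℝ → Ω → Vec r')
        (Wb : ℝ → Ω → Vec r) (Vb : ℝ → Ω → Vec r')
        (ψ ψπ ψbar ψbarπ : ℝ → Ω → Vec r),
        IsSignalObservation A R C Sig μ W V X Y →
        IsFilter A C Sig μ Y (fun u => flow (ricc A R (obsS C Sig)) s u Q) s x ψ →
        IsFilter A C Sig μ Y (fun u => π (flow (riccPert A R (obsS C Sig) π) s u Q)) s x ψπ →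
        IsDiffusion A R C Sig μ X Y Wb Vb (ContinuousMap.id (PSD r)) s x Q ψbar →
        IsDiffusion A R C Sig μ X Y Wb Vb π s x Q ψbarπ →
        ∀ᵐ ω ∂μ,
          InformationTheory.klDiv (condLaw μ Y s t ψbarπ ω) (condLaw μ Y s t ψbar ω) ≤
            ENNReal.ofReal (1 / 2 * (oPlus + 1 / cMinus) *
              (‖ψπ t ω - ψ t ω‖ ^ 2 + 5 / 2 * √(r : ℝ) *
                ‖(flow (ricc A R (obsS C Sig)) s t Q).1 -
                  (flow (riccPert A R (obsS C Sig) π) s t Q).1‖)) := by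
  have hS : (obsS C Sig).PosSemidef := posSemidef_obsS C hSig
  have hr0 : (0 : ℝ) < 1 / r := by
    have : (0 : ℝ) < r := by exact_mod_cast hr
    positivity
  -- the radius makes `Γ_π ≤ R / r`, so that the two flows stay within the factor `1 + 1 / r`
  obtain ⟨δ, hδ, hrad⟩ := exists_radius hR (obsS C Sig) hr0
  refine ⟨δ, hδ, ?_⟩
  intro π hπ s t hs hst x Q Ω _ μ _ W V X Y Wb Vb ψ ψπ ψbar ψbarπ hXY hψ hψπ hbar hbarπ
  have hY := hXY.measurableY
  have hst' : s ≤ t := by linarith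
  -- the nominal Riccati equation is solved by the conditional covariances themselves
  obtain ⟨P, hP⟩ : ∃ P, IsSolution (ricc A R (obsS C Sig)) Q P := by
    obtain ⟨P, hPc, hPcov, hsde⟩ := hbar.sde
    obtain ⟨ω, hω⟩ := (hbar.isSolution hR.posSemidef hSig hY hs hPc hPcov hsde).exists
    rw [riccPert_id A R (posSemidef_iff_inner_act.1 hS).1] at hω
    exact ⟨_, hω⟩
  obtain ⟨⟨Pπ, hPπ⟩, huniq⟩ := hwp π hπ.1 Q
  have hlaw := hbar.condLaw_eq hR.posSemidef hSig hY hs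
    (K := fun u => flow (ricc A R (obsS C Sig)) s u Q) (fun P' hP' u hu => by
      rw [riccPert_id A R (posSemidef_iff_inner_act.1 hS).1] at hP'
      exact (flow_eq hP' (fun _ _ => IsSolution.unique_ricc hS) hu).symm) hψ hst'
  have hlawπ := hbarπ.condLaw_eq hR.posSemidef hSig hY hs
    (K := fun u => flow (riccPert A R (obsS C Sig) π) s u Q)
    (fun P' hP' u hu => (flow_eq hP' huniq hu).symm) hψπ hst'
  rw [flow_eq hP (fun _ _ => IsSolution.unique_ricc hS) hst'] at hlaw ⊢
  rw [flow_eq hPπ huniq hst'] at hlawπ ⊢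
  obtain ⟨hc, hlow⟩ := hP.lower_bound hr hR.posSemidef hS hv hcMinus hC hO
    (show v ≤ t - s by linarith)
  have hle := hP.le_pert hS hPπ (show 0 ≤ t - s by linarith)
  have hge := hP.pert_le hS hr0.le (fun Q' => hrad _ ((π Q').isSymm.sub Q'.isSymm) (hπ.2 Q')) hPπ
    (show 0 ≤ t - s by linarith)
  filter_upwards [hlaw, hlawπ] with ω h1 h2
  rw [h1, h2]
  exact klDiv_multivariateGaussian_le hr hc (Pπ (t - s)).2 (P (t - s)).2 hlow hle hge _ _
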